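/- For $n\ge 0$ let $\mathrm{Ar}(\Delta^n)=\mathrm{Fun}(\Delta^1,\Delta^n)$, i.e. the nerve of the poset of pairs $(i;j)$ with $0\le i\le j\le n$, where $(i;j)\le(i';j')$ iff $i\le i'$ and $j\le j'$; these form a cosimplicial $\infty$-category $\mathrm{Ar}(\Delta^\bullet)$. A map $\sigma\colon\Delta^k\times\Delta^l\to\mathrm{Ar}(\Delta^n)$ is a square if there are integers $a,b$ with $\sigma(i,j)=(a+i;b+j)$ on vertices, and a small square if moreover $k,l\le 1$. A simplicial subset $X\subseteq\mathrm{Ar}(\Delta^n)$ is saturated if, whenever it contains a simplex with first vertex $v$ and last vertex $w$, it contains every simplex (of any dimension) with first vertex $v$ and last vertex $w$. Let $\mathrm{Tw}(\Delta^n)$ be the poset of pairs $(a;b)$ with $0\le a\le b\le n$, where $(a;b)\le(a';b')$ iff $a\le a'$ and $b'\le b$. Let $\mathcal T^{\mathrm{op}}$ be the category whose objects are the pairs $(n,ab)$ with $0\le a\le b\le n$ and whose morphisms $(m,a'b')\to(n,ab)$ are the maps $\phi\colon[m]\to[n]$ in $\mathbf{\Delta}$ with $\phi(a')\le a$ and $b\le\phi(b')$;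 let $p\colon\mathcal T^{\mathrm{op}}\to\mathbf{\Delta}$, $(n,ab)\mapsto[n]$, be the projection (its fiber over $[n]$ is $\mathrm{Tw}(\Delta^n)$), and let $F\colon\mathcal T^{\mathrm{op}}\to\mathbf{\Delta}\times\mathbf{\Delta}$ be the functor sending $(n,ab)$ to $([a],[n-b])$ and $\phi$ to the pair of maps $i\mapsto\phi(i)$ and $j\mapsto\phi(j+b')-b$. For a functor $E\colon\mathbf{\Delta}\times\mathbf{\Delta}\to\mathrm{Cat}_\infty$ let $L^{\mathrm{op}}(E)\colon\mathbf{\Delta}\to\mathrm{Cat}_\infty$ be the ($\infty$-categorical) left Kan extension of $E\circ F$ along $p$. Left Kan extensions and colimits in $\mathrm{Cat}_\infty$ are computed as the left derived functors of the ordinary ones for diagrams in simplicial sets with the Joyal model structure (projectively cofibrant replacement of the diagram). Let $\Delta^{\bullet,\bullet}([m],[n])=\Delta^m\times\Delta^n$, and let $\theta\colon\Delta^{\bullet,\bullet}\circ F\to\mathrm{Ar}(\Delta^\bullet)\circ p$ be the natural transformation with components $\Delta^a\times\Delta^{n-b}\to\mathrm{Ar}(\Delta^n)$, $(i,j)\mapsto(i;b+j)$.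 Then: 1. For every $n\ge0$ and every saturated simplicial subset $X\subseteq\mathrm{Ar}(\Delta^n)$ that contains all small squares, the inclusion $X\to\mathrm{Ar}(\Delta^n)$ is inner anodyne. 2. The canonical map $L^{\mathrm{op}}(\Delta^{\bullet,\bullet})\to\mathrm{Ar}(\Delta^\bullet)$ adjoint to $\theta$ is an equivalence of cosimplicial $\infty$-categories. 3. For every $n\ge 0$, the squares $\Delta^a\times\Delta^{n-b}\to\mathrm{Ar}(\Delta^n)$, $(i,j)\mapsto(i;b+j)$, exhibit $\mathrm{Ar}(\Delta^n)$ as the homotopy colimit, in $\mathrm{Cat}_\infty$, of the diagram $(a;b)\mapsto\Delta^a\times\Delta^{n-b}$ over $\mathrm{Tw}(\Delta^n)$. -/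

import Mathlib

open CategoryTheory MonoidalCategory Limits Simplicial Opposite

/-! ### The arrow categories of the simplices and their squares -/

/-- The objects `(i;j)` of `Ar(Δ^n)`, i.e. the arrows `i ⟶ j` of `[n]`. A (unique) morphism
`(i;j) ⟶ (i';j')` exists if and only if `i ≤ i'` and `j ≤ j'`. -/
abbrev ArObj (n : ℕ) : Type := {p : Fin (n + 1) × Fin (n + 1) // p.1 ≤ p.2}

/-- The map `(i;j) ↦ (φ i; φ j)`. -/
def ArObj.map {m n : SimplexCategory} (φ : m ⟶ n) : ArObj m.len →o ArObj n.len where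
  toFun p := ⟨(φ.toOrderHom p.1.1, φ.toOrderHom p.1.2), φ.toOrderHom.monotone p.2⟩
  monotone' _ _ h := ⟨φ.toOrderHom.monotone h.1, φ.toOrderHom.monotone h.2⟩

/-- The cosimplicial `∞`-category `Ar(Δ^•)`: `Ar(Δ^n)` is the nerve of the category of arrows of
`[n]`. See `ArIsoFun` for the identification with `Fun(Δ^1, Δ^n)`. -/
def Ar : SimplexCategory ⥤ SSet.{0} where
  obj n := nerve (ArObj n.len)
  map φ := nerveMap (ArObj.map φ).monotone.functor

/-- The `i`-th vertex of a simplex of `Ar(Δ^n)`. -/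
def Ar.vertex {n : SimplexCategory} {k : SimplexCategoryᵒᵖ} (φ : (Ar.obj n).obj k)
    (i : Fin (k.unop.len + 1)) : ArObj n.len :=
  Functor.obj (C := Fin (k.unop.len + 1)) (D := ArObj n.len) φ i

lemma Ar.vertex_monotone {n : SimplexCategory} {k : SimplexCategoryᵒᵖ} (φ : (Ar.obj n).obj k) :
    Monotone (Ar.vertex φ) :=
  fun _ _ h ↦ leOfHom (CategoryTheory.Functor.map (C := Fin (k.unop.len + 1)) (D := ArObj n.len) φ (homOfLE h))

lemma Ar.ext {n : SimplexCategory} {k : SimplexCategoryᵒᵖ} {φ ψ : (Ar.obj n).obj k}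
    (h : ∀ i, Ar.vertex φ i = Ar.vertex ψ i) : φ = ψ :=
  CategoryTheory.Functor.ext (C := Fin (k.unop.len + 1)) (D := ArObj n.len) h
    (fun _ _ _ ↦ Subsingleton.elim _ _)

/-- The simplex of `Ar(Δ^n)` with given vertices. -/
def Ar.mk {n : SimplexCategory} {k : SimplexCategoryᵒᵖ}
    (v : Fin (k.unop.len + 1) →o ArObj n.len) : (Ar.obj n).obj k :=
  v.monotone.functor

/-- The evaluation `Δ^1 × Ar(Δ^n) ⟶ Δ^n`, which sends `(0, (i;j))` to `i` and `(1, (i;j))`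
to `j`. -/
def Ar.ev (n : SimplexCategory) : Δ[1] ⊗ Ar.obj n ⟶ SSet.stdSimplex.obj n where
  app k := ↾fun (z : (Δ[1] ⊗ Ar.obj n : SSet.{0}).obj k) ↦
    SSet.stdSimplex.objEquiv.symm (SimplexCategory.Hom.mk
      { toFun r := if (SSet.stdSimplex.objEquiv z.1).toOrderHom r = 0
          then (Ar.vertex z.2 r).1.1 else (Ar.vertex z.2 r).1.2
        monotone' r s h := by
          have h1 := (SSet.stdSimplex.objEquiv z.1).toOrderHom.monotone h
          have h2 := Ar.vertex_monotone z.2 h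
          dsimp only
          split_ifs with hr hs hs
          · exact h2.1
          · exact h2.1.trans (Ar.vertex z.2 s).2
          · rw [hs] at h1
            exact absurd (le_antisymm h1 (Fin.zero_le _)) hr
          · exact h2.2 })
  naturality _ _ _ := rfl

lemma Ar.ev_natural {m n : SimplexCategory} (φ : m ⟶ n) :
    Δ[1] ◁ Ar.map φ ≫ Ar.ev n = Ar.ev m ≫ SSet.stdSimplex.map φ := by
  ext k z
  apply SSet.stdSimplex.objEquiv.injective
  ext r
  change ((if (SSet.stdSimplex.objEquiv z.1).toOrderHom r = 0 then
      φ.toOrderHom (Ar.vertex z.2 r).1.1 else φ.toOrderHom (Ar.vertex z.2 r).1.2 : Fin _) : ℕ) =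
    (φ.toOrderHom (if (SSet.stdSimplex.objEquiv z.1).toOrderHom r = 0
      then (Ar.vertex z.2 r).1.1 else (Ar.vertex z.2 r).1.2) : ℕ)
  split_ifs <;> rfl

/-- The simplex `(ε, id)` of `Δ^1 × Δ^k`. -/
def Ar.slice (ε : Fin 2) (k : ℕ) : (Δ[1] ⊗ Δ[k] : SSet.{0}).obj (op ⦋k⦌) :=
  (SSet.stdSimplex.objEquiv.symm (SimplexCategory.const ⦋k⦌ ⦋1⦌ ε),
    SSet.stdSimplex.objEquiv.symm (𝟙 _))

lemma Ar.ev_bijective (n : SimplexCategory) (k : ℕ) : Function.Bijective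
    (fun s : Δ[k] ⟶ Ar.obj n ↦ Δ[1] ◁ s ≫ Ar.ev n) := by
  constructor
  · intro s t h
    apply SSet.yonedaEquiv.injective
    apply Ar.ext
    intro r
    have h' (ε : Fin 2) := congrArg (fun g : Δ[1] ⊗ Δ[k] ⟶ SSet.stdSimplex.obj n ↦
      (SSet.stdSimplex.objEquiv (g.app _ (Ar.slice ε k))).toOrderHom r) h
    exact Subtype.ext (Prod.ext (h' 0) (h' 1))
  · intro g
    let G (ε : Fin 2) (i : Fin (k + 1)) : Fin (n.len + 1) :=
      (SSet.stdSimplex.objEquiv (g.app (op ⦋0⦌) (SSet.stdSimplex.obj₀Equiv.symm ε,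
        SSet.stdSimplex.obj₀Equiv.symm i))).toOrderHom 0
    have hG {l : SimplexCategoryᵒᵖ} (w : (Δ[1] ⊗ Δ[k] : SSet.{0}).obj l)
        (r : Fin (l.unop.len + 1)) :
        (SSet.stdSimplex.objEquiv (g.app l w)).toOrderHom r =
          G ((SSet.stdSimplex.objEquiv w.1).toOrderHom r)
            ((SSet.stdSimplex.objEquiv w.2).toOrderHom r) := by
      have := congrArg (fun y ↦ (SSet.stdSimplex.objEquiv y).toOrderHom 0)
        (ConcreteCategory.congr_hom (g.naturality (SimplexCategory.const ⦋0⦌ l.unop r).op) w)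
      refine this.symm.trans ?_
      dsimp only [G]
      congr 4
    have hmono : Monotone (fun p : Fin 2 × Fin (k + 1) ↦ G p.1 p.2) := by
      intro p q hpq
      let w : (Δ[1] ⊗ Δ[k] : SSet.{0}).obj (op ⦋1⦌) :=
        (SSet.stdSimplex.objEquiv.symm (SimplexCategory.mkOfLe p.1 q.1 hpq.1),
          SSet.stdSimplex.objEquiv.symm (SimplexCategory.mkOfLe p.2 q.2 hpq.2))
      have := (SSet.stdSimplex.objEquiv (g.app _ w)).toOrderHom.monotone (Fin.zero_le 1)
      rw [hG, hG] at this
      exact this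
    refine ⟨SSet.yonedaEquiv.symm (Ar.mk
      ⟨fun r ↦ ⟨(G 0 r, G 1 r), hmono (a := (0, r)) (b := (1, r)) ⟨Fin.zero_le _, le_rfl⟩⟩,
        fun r s h ↦ ⟨hmono (a := (0, r)) (b := (0, s)) ⟨le_rfl, h⟩,
          hmono (a := (1, r)) (b := (1, s)) ⟨le_rfl, h⟩⟩⟩), ?_⟩
    ext l w
    apply SSet.stdSimplex.objEquiv.injective
    ext r
    refine Eq.trans ?_ (congrArg Fin.val (hG w r)).symm
    change ((if (SSet.stdSimplex.objEquiv w.1).toOrderHom r = 0 then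
      G 0 ((SSet.stdSimplex.objEquiv w.2).toOrderHom r) else
      G 1 ((SSet.stdSimplex.objEquiv w.2).toOrderHom r) : Fin _) : ℕ) = _
    split_ifs with h
    · rw [h]
    · rw [Fin.eq_one_of_ne_zero _ h]

/-- The identification `Ar(Δ^•) ≅ Fun(Δ^1, Δ^•)`. -/
noncomputable def ArIsoFun : Ar ≅ SSet.stdSimplex ⋙ ihom (Δ[1] : SSet.{0}) :=
  have (n : SimplexCategory) : IsIso (MonoidalClosed.curry (Ar.ev n)) := by
    rw [NatTrans.isIso_iff_isIso_app]
    rintro ⟨⟨k⟩⟩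
    rw [isIso_iff_bijective]
    have h : Function.Bijective (fun s : Δ[k] ⟶ Ar.obj n ↦ s ≫ MonoidalClosed.curry (Ar.ev n)) := by
      have h' := ((ihom.adjunction (Δ[1] : SSet.{0})).homEquiv Δ[k] _).bijective.comp
        (Ar.ev_bijective n k)
      convert h' using 1
      ext1 s
      exact (MonoidalClosed.curry_natural_left _ _).symm
    have h' := (SSet.yonedaEquiv.bijective.comp h).comp SSet.yonedaEquiv.symm.bijective
    convert h' using 1
    ext1 s
    simp
  NatIso.ofComponents (fun n ↦ asIso (MonoidalClosed.curry (Ar.ev n))) (fun φ ↦ by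
    dsimp only [asIso_hom]
    rw [← MonoidalClosed.curry_natural_left, Ar.ev_natural,
      MonoidalClosed.curry_natural_right]
    rfl)

/-- A simplicial subset of `Ar(Δ^n)` is saturated if, with a simplex, it contains every simplex
(of any dimension) with the same first vertex and the same last vertex. -/
def Ar.IsSaturated {n : ℕ} (X : (Ar.obj ⦋n⦌).Subcomplex) : Prop :=
  ∀ ⦃k l : ℕ⦄ (φ : (Ar.obj ⦋n⦌) _⦋k⦌) (ψ : (Ar.obj ⦋n⦌) _⦋l⦌),
    Ar.vertex φ 0 = Ar.vertex ψ 0 → Ar.vertex φ (Fin.last k) = Ar.vertex ψ (Fin.last l) →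
    φ ∈ X.obj (op ⦋k⦌) → ψ ∈ X.obj (op ⦋l⦌)

/-- A map `σ : Δ^k × Δ^l ⟶ Ar(Δ^n)` is a square if it is given on vertices by
`σ(i, j) = (a + i; b + j)` for some `a` and `b`. -/
def Ar.IsSquare {n k l : ℕ} (σ : Δ[k] ⊗ Δ[l] ⟶ Ar.obj ⦋n⦌) : Prop :=
  ∃ a b : ℕ, ∀ (i : Fin (k + 1)) (j : Fin (l + 1)),
    let v := Ar.vertex (σ.app (op ⦋0⦌)
      (SSet.stdSimplex.obj₀Equiv.symm i, SSet.stdSimplex.obj₀Equiv.symm j)) 0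
    (v.1.1 : ℕ) = a + i ∧ (v.1.2 : ℕ) = b + j

/-- The simplicial subset `X` contains all the small squares, i.e. the squares
`Δ^k × Δ^l ⟶ Ar(Δ^n)` with `k ≤ 1` and `l ≤ 1`. -/
def Ar.ContainsSmallSquares {n : ℕ} (X : (Ar.obj ⦋n⦌).Subcomplex) : Prop :=
  ∀ ⦃k l : ℕ⦄ (σ : Δ[k] ⊗ Δ[l] ⟶ Ar.obj ⦋n⦌), k ≤ 1 → l ≤ 1 → Ar.IsSquare σ →
    SSet.Subcomplex.range σ ≤ X

/-! ### Functors with values in the `∞`-category of `∞`-categories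

The `∞`-category of functors from a small category `D` to the `∞`-category of `∞`-categories is
presented by the diagrams `D ⥤ SSet` and the objectwise categorical equivalences. The
`∞`-categorical left Kan extensions and colimits are the total left derived functors of the ordinary
left Kan extensions and colimits, computed on projectively cofibrant diagrams
(for the Joyal model structure on simplicial sets). -/

/-- A map of simplicial sets is a categorical equivalence (a weak equivalence for the Joyal model
structure) if, for every quasi-category `C`, it induces an equivalence between the homotopy
categories of `Fun(Y, C)` and of `Fun(X, C)`. -/
def IsCategoricalEquivalence {X Y : SSet.{0}} (f : X ⟶ Y) : Prop :=
  ∀ (C : SSet.{0}) [SSet.Quasicategory C],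
    (SSet.hoFunctor.map ((MonoidalClosed.pre f).app C)).toFunctor.IsEquivalence

/-- A diagram of simplicial sets is projectively cofibrant if maps from it lift along the objectwise
trivial fibrations, where a trivial fibration is a map with the right lifting property with respect
to all monomorphisms. -/
def IsProjectivelyCofibrant {D : Type} [SmallCategory D] (Q : D ⥤ SSet.{0}) : Prop :=
  ∀ ⦃X Y : D ⥤ SSet.{0}⦄ (π : X ⟶ Y),
    (∀ d, (MorphismProperty.monomorphisms SSet.{0}).rlp (π.app d)) →
      ∀ g : Q ⟶ Y, ∃ h : Q ⟶ X, h ≫ π = g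

/-- A projectively cofibrant replacement of a diagram of simplicial sets. -/
structure CofibrantReplacement {D : Type} [SmallCategory D] (A : D ⥤ SSet.{0}) where
  /-- the projectively cofibrant diagram -/
  obj : D ⥤ SSet.{0}
  /-- the objectwise categorical equivalence -/
  hom : obj ⟶ A
  cofibrant : IsProjectivelyCofibrant obj
  isEquivalence (d : D) : IsCategoricalEquivalence (hom.app d)

/-- The value at `A` of the derived left Kan extension along `p`, computed with the cofibrant
replacement `R` of `A`. -/
noncomputable def derivedLan {D E : Type} [SmallCategory D] [SmallCategory E] (p : D ⥤ E)
    {A : D ⥤ SSet.{0}} (R : CofibrantReplacement A) : E ⥤ SSet.{0} :=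
  p.lan.obj R.obj

/-- The canonical map from the derived left Kan extension of `A` to `B` that corresponds by
adjunction to a map `θ : A ⟶ p ⋙ B`. -/
noncomputable def derivedLanDesc {D E : Type} [SmallCategory D] [SmallCategory E] (p : D ⥤ E)
    {A : D ⥤ SSet.{0}} (R : CofibrantReplacement A) {B : E ⥤ SSet.{0}} (θ : A ⟶ p ⋙ B) :
    derivedLan p R ⟶ B :=
  ((p.lanAdjunction SSet.{0}).homEquiv R.obj B).symm (R.hom ≫ θ)

/-- The homotopy colimit of `A`, computed with the cofibrant replacement `R` of `A`. -/
noncomputable def hocolim {D : Type} [SmallCategory D]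
    {A : D ⥤ SSet.{0}} (R : CofibrantReplacement A) : SSet.{0} :=
  colimit R.obj

/-- The canonical map from the homotopy colimit of `A` to the vertex of a cocone under `A`. -/
noncomputable def hocolimDesc {D : Type} [SmallCategory D]
    {A : D ⥤ SSet.{0}} (R : CofibrantReplacement A) (c : Cocone A) : hocolim R ⟶ c.pt :=
  colimit.desc R.obj ((Cocone.precompose R.hom).obj c)

/-! ### The category `𝒯` and the functor `L^op` -/

/-- The twisted arrow category `Tw(Δ^n)`: its objects are the pairs `(a;b)` with `a ≤ b`, and a
(unique) morphism `(a;b) ⟶ (a';b')` exists if and only if `a ≤ a'` and `b' ≤ b`. -/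
@[ext]
structure TwObj (n : ℕ) : Type where
  a : Fin (n + 1)
  b : Fin (n + 1)
  le : a ≤ b

instance (n : ℕ) : PartialOrder (TwObj n) where
  le x y := x.a ≤ y.a ∧ y.b ≤ x.b
  le_refl _ := ⟨le_rfl, le_rfl⟩
  le_trans _ _ _ h h' := ⟨h.1.trans h'.1, h'.2.trans h.2⟩
  le_antisymm _ _ h h' := TwObj.ext (le_antisymm h.1 h'.1) (le_antisymm h'.2 h.2)

/-- The objects `(n, ab)` of the category `𝒯ᵒᵖ`. -/
structure TOp : Type where
  n : SimplexCategory
  ab : TwObj n.len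

/-- A morphism `(m, a'b') ⟶ (n, ab)` in `𝒯ᵒᵖ` (i.e. a morphism `(n, ab) ⟶ (m, a'b')` in `𝒯`) is a
map `φ : [m] ⟶ [n]` such that `φ(a') ≤ a` and `b ≤ φ(b')`. -/
@[ext]
structure TOp.Hom (x y : TOp) : Type where
  φ : x.n ⟶ y.n
  le_a : φ.toOrderHom x.ab.a ≤ y.ab.a
  b_le : y.ab.b ≤ φ.toOrderHom x.ab.b

instance : SmallCategory TOp where
  Hom := TOp.Hom
  id x := ⟨𝟙 x.n, le_rfl, le_rfl⟩
  comp f g := ⟨f.φ ≫ g.φ, (g.φ.toOrderHom.monotone f.le_a).trans g.le_a,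
    g.b_le.trans (g.φ.toOrderHom.monotone f.b_le)⟩

/-- The projection `𝒯ᵒᵖ ⥤ Δ`. -/
def TOp.proj : TOp ⥤ SimplexCategory where
  obj x := x.n
  map f := f.φ

/-- The inclusion of the fiber `Tw(Δ^n)` of `𝒯ᵒᵖ ⥤ Δ` over `[n]`. -/
def TOp.fiber (n : ℕ) : TwObj n ⥤ TOp where
  obj x := ⟨⦋n⦌, x⟩
  map h := ⟨𝟙 _, (leOfHom h).1, (leOfHom h).2⟩

/-- The inclusion `[a] ⟶ [n]`, `i ↦ i`. -/
def TwObj.low {n : ℕ} (x : TwObj n) : Fin (x.a.val + 1) →o Fin (n + 1) where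
  toFun i := ⟨i.val, by have := x.a.isLt; omega⟩
  monotone' _ _ h := h

/-- The inclusion `[n - b] ⟶ [n]`, `j ↦ j + b`. -/
def TwObj.high {n : ℕ} (x : TwObj n) : Fin (n - x.b.val + 1) →o Fin (n + 1) where
  toFun j := ⟨j.val + x.b.val, by have := x.b.isLt; omega⟩
  monotone' _ _ h := Fin.le_def.2 (Nat.add_le_add_right h _)

lemma TwObj.low_le_high {n : ℕ} (x : TwObj n) (i : Fin (x.a.val + 1))
    (j : Fin (n - x.b.val + 1)) : x.low i ≤ x.high j :=
  Fin.le_def.2 (((Nat.lt_succ_iff.1 i.isLt).trans x.le).trans (Nat.le_add_left _ _))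

/-- The first component `[a'] ⟶ [a]` of `F^op`, which is the restriction of `φ`. -/
def TOp.ψa {x y : TOp} (f : x ⟶ y) : ⦋x.ab.a.val⦌ ⟶ ⦋y.ab.a.val⦌ :=
  SimplexCategory.Hom.mk
    { toFun i := ⟨f.φ.toOrderHom (x.ab.low i), Nat.lt_succ_iff.2
        ((f.φ.toOrderHom.monotone (Fin.le_def.2 (Nat.lt_succ_iff.1 i.isLt))).trans f.le_a)⟩
      monotone' _ _ h := f.φ.toOrderHom.monotone h }

lemma TOp.b_le_φ_high {x y : TOp} (f : x ⟶ y) (j : Fin (x.n.len - x.ab.b.val + 1)) :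
    y.ab.b ≤ f.φ.toOrderHom (x.ab.high j) :=
  f.b_le.trans (f.φ.toOrderHom.monotone (Fin.le_def.2 (Nat.le_add_left _ _)))

/-- The second component `[m - b'] ⟶ [n - b]` of `F^op`, which sends `j` to `φ(j + b') - b`. -/
def TOp.ψb {x y : TOp} (f : x ⟶ y) : ⦋x.n.len - x.ab.b.val⦌ ⟶ ⦋y.n.len - y.ab.b.val⦌ :=
  SimplexCategory.Hom.mk
    { toFun j := ⟨f.φ.toOrderHom (x.ab.high j) - y.ab.b.val, Nat.lt_succ_iff.2
        (Nat.sub_le_sub_right (Nat.lt_succ_iff.1 (f.φ.toOrderHom (x.ab.high j)).isLt) _)⟩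
      monotone' _ _ h := Fin.le_def.2 (Nat.sub_le_sub_right
        (f.φ.toOrderHom.monotone (x.ab.high.monotone h)) _) }

lemma TOp.high_ψb {x y : TOp} (f : x ⟶ y) (j : Fin (x.n.len - x.ab.b.val + 1)) :
    y.ab.high ((TOp.ψb f).toOrderHom j) = f.φ.toOrderHom (x.ab.high j) :=
  Fin.ext (Nat.sub_add_cancel (TOp.b_le_φ_high f j))

/-- The functor `F^op : 𝒯ᵒᵖ ⥤ Δ × Δ`, which sends `(n, ab)` to `([a], [n - b])`. -/
def TOp.F : TOp ⥤ SimplexCategory × SimplexCategory where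
  obj x := (⦋x.ab.a.val⦌, ⦋x.n.len - x.ab.b.val⦌)
  map f := (TOp.ψa f, TOp.ψb f)
  map_id x := by
    refine Prod.ext ?_ ?_
    · rfl
    · ext i
      exact Nat.add_sub_cancel _ _
  map_comp f g := by
    refine Prod.ext ?_ ?_
    · rfl
    · ext j
      exact congrArg (fun t ↦ (g.φ.toOrderHom t : ℕ) - _) (TOp.high_ψb f j).symm

/-- The functor `L^op`, i.e. the derived left Kan extension along `𝒯ᵒᵖ ⥤ Δ` of the restriction
along `F^op` of a bicosimplicial object `E` (computed with a cofibrant replacement). -/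
noncomputable def Lop (E : SimplexCategory × SimplexCategory ⥤ SSet.{0})
    (R : CofibrantReplacement (TOp.F ⋙ E)) : SimplexCategory ⥤ SSet.{0} :=
  derivedLan TOp.proj R

/-- The functor `Δ^{•,•}`, which sends `([m], [n])` to `Δ^m × Δ^n`. -/
def bisimplex : SimplexCategory × SimplexCategory ⥤ SSet.{0} :=
  SSet.stdSimplex.prod SSet.stdSimplex ⋙ MonoidalCategory.tensor SSet.{0}

/-- The map `θ(n, ab) : Δ^a × Δ^{n-b} ⟶ Ar(Δ^n)`, which sends `(i, j)` to `(i; j + b)`. -/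
def thetaApp (x : TOp) : (TOp.F ⋙ bisimplex).obj x ⟶ Ar.obj x.n where
  app k := ↾fun (z : (Δ[x.ab.a.val] ⊗ Δ[x.n.len - x.ab.b.val] : SSet.{0}).obj k) ↦
    Monotone.functor (X := Fin (k.unop.len + 1)) (Y := ArObj x.n.len)
      (f := fun r ↦
        ⟨(x.ab.low ((SSet.stdSimplex.objEquiv z.1).toOrderHom r),
          x.ab.high ((SSet.stdSimplex.objEquiv z.2).toOrderHom r)), x.ab.low_le_high _ _⟩)
      (fun _ _ h ↦ ⟨x.ab.low.monotone ((SSet.stdSimplex.objEquiv z.1).toOrderHom.monotone h),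
        x.ab.high.monotone ((SSet.stdSimplex.objEquiv z.2).toOrderHom.monotone h)⟩)

/-- The natural transformation `θ`. -/
def theta : TOp.F ⋙ bisimplex ⟶ TOp.proj ⋙ Ar where
  app x := thetaApp x
  naturality x y f := by
    ext k z
    refine CategoryTheory.Functor.ext (fun r ↦ Subtype.ext (Prod.ext rfl ?_))
      (fun _ _ _ ↦ Subsingleton.elim _ _)
    exact TOp.high_ψb f _

/-- The canonical map `L^op(Δ^{•,•}) ⟶ Ar(Δ^•)`, which corresponds to `θ` by adjunction. -/
noncomputable def LopToAr (R : CofibrantReplacement (TOp.F ⋙ bisimplex)) :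
    Lop bisimplex R ⟶ Ar :=
  derivedLanDesc TOp.proj R theta

/-- The diagram `(a;b) ↦ Δ^a × Δ^{n-b}` indexed by `Tw(Δ^n)`. -/
def twDiagram (n : ℕ) : TwObj n ⥤ SSet.{0} := TOp.fiber n ⋙ TOp.F ⋙ bisimplex

/-- The cocone with vertex `Ar(Δ^n)` given by the squares `Δ^a × Δ^{n-b} ⟶ Ar(Δ^n)` that send
`(i, j)` to `(i; j + b)`. -/
def twCocone (n : ℕ) : Cocone (twDiagram n) where
  pt := Ar.obj ⦋n⦌
  ι :=
    { app x := theta.app ((TOp.fiber n).obj x)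
      naturality _ _ f := theta.naturality ((TOp.fiber n).map f) }

/-! ### Inner anodyne extensions of subcomplexes of nerves of partial orders -/

/-! Part 1 is an instance of a matching argument. Since `X` is saturated, membership of a simplex
depends only on its end vertices `v ≤ w`. The missing nondegenerate simplices are chains, and they
are matched in pairs that differ by one vertex. For ends `v, w` of a missing chain there is an
element `c` (`cutPoint v w`) that is strictly above `v`, is not above `w`, and satisfies `v < x ⊓ c`
whenever `v < x ≤ w`. If `m` is the first vertex of the chain not below `c`, the toggled vertex is
`m ⊓ c`. It lies strictly between the ends, so each pair is attached along an inner horn, and a rank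
function gives an admissible order of attachment. Such a `c` exists because the ends of a missing
chain are not opposite corners of a small square.

For part 3, let `Q` be a projectively cofibrant replacement of the diagram of squares. The poset
`Tw(Δ^n)` is a finite meet-semilattice, and cofibrancy forces each `Q.obj y` to embed in the
colimit, with the intersection of the images at `y` and `y'` contained in the image at `y ⊓ y'`. The
images of the squares in `Ar(Δ^n)`, called rectangles, behave in the same way. Adding one maximal
index at a time builds both unions by pushouts along monomorphisms, so the gluing lemma makes the
map from the colimit to the union of the rectangles an equivalence
(`isCategoricalEquivalence_union`). This union is saturated and contains the small squares, so part
1 concludes.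

Part 2 follows from the same argument. The fiber `Tw(Δ^n)` is final in the category of objects of
`𝒯ᵒᵖ` over `[n]`, so the Kan extension at `[n]` is a colimit over the fiber, and restriction to the
fiber preserves cofibrant diagrams.

The homotopy theory needed is that inner anodyne maps are categorical equivalences, and the gluing
lemma. The latter rests on Joyal's filling of special outer horns (`exists_extension_zeroHorn`),
which makes invertible homotopies extend along monomorphisms. It follows that pointwise invertible
homotopies are invertible in the simplicial set of functors, and then that categorical equivalences
are stable under pushout along monomorphisms. -/

namespace NervePairing

variable {P : Type} [PartialOrder P]

/-- The set of vertices of a simplex of the nerve of a partial order. -/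
def supp {d : ℕ} (x : (nerve P) _⦋d⦌) : Set P := Set.range x.obj

lemma finite_supp {d : ℕ} (x : (nerve P) _⦋d⦌) : (supp x).Finite := Set.finite_range _

lemma nonempty_supp {d : ℕ} (x : (nerve P) _⦋d⦌) : (supp x).Nonempty := ⟨_, 0, rfl⟩

lemma isChain_supp {d : ℕ} (x : (nerve P) _⦋d⦌) : IsChain (· ≤ ·) (supp x) := by
  rintro _ ⟨i, rfl⟩ _ ⟨j, rfl⟩ _
  rcases le_total i j with h | h
  · exact Or.inl (x.monotone h)
  · exact Or.inr (x.monotone h)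

lemma supp_map_subset {d e : ℕ} (f : ⦋e⦌ ⟶ ⦋d⦌) (x : (nerve P) _⦋d⦌) :
    supp ((nerve P).map f.op x) ⊆ supp x := by
  rintro _ ⟨i, rfl⟩
  exact ⟨f.toOrderHom i, rfl⟩

lemma nerve_ext {d : ℕ} {x y : (nerve P) _⦋d⦌} (h : ∀ i, x.obj i = y.obj i) : x = y :=
  CategoryTheory.Functor.ext h (fun _ _ _ ↦ Subsingleton.elim _ _)

lemma exists_map_eq_of_supp_subset {d e : ℕ} {x : (nerve P) _⦋d⦌} {y : (nerve P) _⦋e⦌}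
    (h : supp y ⊆ supp x) : ∃ f : ⦋e⦌ ⟶ ⦋d⦌, (nerve P).map f.op x = y := by
  classical
  have h' (i : Fin (e + 1)) : ∃ k : Fin (d + 1), x.obj k = y.obj i := h ⟨i, rfl⟩
  -- The least index is chosen because `x` may repeat vertices; minimality is what makes the choice
  -- monotone.
  have hmin (i : Fin (e + 1)) : ∃ k : Fin (d + 1), x.obj k = y.obj i ∧
      ∀ l, x.obj l = y.obj i → k ≤ l := by
    obtain ⟨k, hk, hk'⟩ := (Finset.univ.filter (fun k ↦ x.obj k = y.obj i)).exists_minimal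
      (by obtain ⟨k, hk⟩ := h' i; exact ⟨k, by simp [hk]⟩)
    refine ⟨k, by simpa using hk, fun l hl ↦ ?_⟩
    rcases le_total k l with h1 | h1
    · exact h1
    · exact hk' (by simpa using hl) h1
  choose f hf hf' using hmin
  refine ⟨SimplexCategory.Hom.mk ⟨f, fun i j hij ↦ ?_⟩, nerve_ext fun i ↦ hf i⟩
  rcases le_total (f i) (f j) with h1 | h1
  · exact h1
  · refine hf' i _ (le_antisymm ?_ ?_)
    · rw [← hf i]; exact x.monotone h1
    · rw [hf j]; exact y.monotone hij

/-- Inclusion of supports makes `y` the image of `x` under an endomorphism of `[d]`. Strictness of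
`y` makes this endomorphism injective, hence the identity. -/
lemma eq_of_supp_eq {d : ℕ} {x y : (nerve P) _⦋d⦌} (hy : StrictMono y.obj) (h : supp x = supp y) : x = y := by
  obtain ⟨f, rfl⟩ := exists_map_eq_of_supp_subset (x := x) (y := y) h.ge
  have hf : Mono f := by
    rw [SimplexCategory.mono_iff_injective]
    intro a b hab
    exact hy.injective (congrArg x.obj hab)
  rw [SimplexCategory.eq_id_of_mono f]
  simp

lemma ncard_supp {d : ℕ} {x : (nerve P) _⦋d⦌} (hx : StrictMono x.obj) :
    (supp x).ncard = d + 1 := by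
  rw [supp, ← Set.image_univ, Set.ncard_image_of_injective _ hx.injective, Set.ncard_univ]
  simp

lemma dim_eq_of_supp_eq {d e : ℕ} {x : (nerve P) _⦋d⦌} {y : (nerve P) _⦋e⦌}
    (hx : StrictMono x.obj) (hy : StrictMono y.obj) (h : supp x = supp y) : d = e := by
  have h1 := ncard_supp hx
  have h2 := ncard_supp hy
  rw [h] at h1
  omega

lemma supp_δ {d : ℕ} (x : (nerve P) _⦋d + 1⦌) (hx : StrictMono x.obj) (k : Fin (d + 2)) :
    supp ((nerve P).δ k x) = supp x \ {x.obj k} := by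
  ext p
  constructor
  · rintro ⟨i, rfl⟩
    exact ⟨⟨k.succAbove i, rfl⟩, fun h ↦ Fin.succAbove_ne k i (hx.injective h)⟩
  · rintro ⟨⟨i, rfl⟩, h⟩
    obtain ⟨l, rfl⟩ := Fin.exists_succAbove_eq (x := i) (y := k) (fun h' ↦ h (by rw [h']; rfl))
    exact ⟨l, rfl⟩

/-- Insertion of a vertex in a simplex of the nerve of a partial order. -/
lemma exists_insert {d : ℕ} (x : (nerve P) _⦋d⦌) (hx : StrictMono x.obj) (t : P)
    (ht : t ∉ supp x) (hc : ∀ u ∈ supp x, u ≤ t ∨ t ≤ u)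
    (h0 : ∃ u ∈ supp x, u < t) (h1 : ∃ u ∈ supp x, t < u) :
    ∃ (y : (nerve P) _⦋d + 1⦌) (k : Fin (d + 2)), StrictMono y.obj ∧ k ≠ 0 ∧ k ≠ Fin.last _ ∧
      (nerve P).δ k y = x ∧ y.obj k = t ∧ supp y = insert t (supp x) := by
  classical
  have hlt (i : Fin (d + 1)) : x.obj i < t ∨ t < x.obj i := by
    rcases hc (x.obj i) ⟨i, rfl⟩ with h | h
    · exact Or.inl (lt_of_le_of_ne h (fun h' ↦ ht ⟨i, h'⟩))
    · exact Or.inr (lt_of_le_of_ne h (fun h' ↦ ht ⟨i, h'.symm⟩))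
  obtain ⟨k, hk, hk'⟩ : ∃ k : Fin (d + 1), t < x.obj k ∧ ∀ i < k, x.obj i < t := by
    obtain ⟨_, ⟨i, rfl⟩, hi⟩ := h1
    obtain ⟨k, hk, hk'⟩ := (Finset.univ.filter (fun k ↦ t < x.obj k)).exists_minimal
      ⟨i, by simpa using hi⟩
    refine ⟨k, by simpa using hk, fun l hl ↦ (hlt l).resolve_right fun h ↦ ?_⟩
    exact absurd (hk' (by simpa using h) hl.le) (not_le.2 hl)
  have hk'' (i : Fin (d + 1)) (hi : k ≤ i) : t < x.obj i := hk.trans_le (x.monotone hi)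
  let v : Fin (d + 2) → P := k.castSucc.insertNth (α := fun _ ↦ P) t x.obj
  have hv0 : v k.castSucc = t := Fin.insertNth_apply_same _ _ _
  have hv1 (i) : v (k.castSucc.succAbove i) = x.obj i := Fin.insertNth_apply_succAbove _ _ _ _
  have hv : StrictMono v := by
    intro a b hab
    rcases Fin.eq_self_or_eq_succAbove k.castSucc a with rfl | ⟨a, rfl⟩
    · rcases Fin.eq_self_or_eq_succAbove k.castSucc b with rfl | ⟨b, rfl⟩
      · exact absurd hab (lt_irrefl _)
      · rw [hv0, hv1]
        apply hk''
        by_contra h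
        rw [Fin.succAbove_of_castSucc_lt _ _ (Fin.castSucc_lt_castSucc_iff.2 (not_le.1 h))] at hab
        exact h (Fin.castSucc_lt_castSucc_iff.1 hab).le
    · rcases Fin.eq_self_or_eq_succAbove k.castSucc b with rfl | ⟨b, rfl⟩
      · rw [hv0, hv1]
        apply hk'
        by_contra h
        rw [Fin.succAbove_of_le_castSucc _ _ (Fin.castSucc_le_castSucc_iff.2 (not_lt.1 h))] at hab
        exact h (Fin.succ_le_castSucc_iff.1 hab.le)
      · rw [hv1, hv1]
        exact hx ((Fin.strictMono_succAbove _).lt_iff_lt.1 hab)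
  refine ⟨hv.monotone.functor, k.castSucc, hv, ?_, Fin.castSucc_ne_last k, nerve_ext hv1, hv0, ?_⟩
  · obtain ⟨_, ⟨i, rfl⟩, hi⟩ := h0
    intro h
    have : k = 0 := by simpa using h
    exact lt_asymm hi (hk'' i (by simp [this]))
  · ext p
    constructor
    · rintro ⟨i, rfl⟩
      rcases Fin.eq_self_or_eq_succAbove k.castSucc i with rfl | ⟨i, rfl⟩
      · exact Or.inl hv0
      · exact Or.inr ⟨i, (hv1 i).symm⟩
    · rintro (rfl | ⟨i, rfl⟩)
      · exact ⟨k.castSucc, hv0⟩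
      · exact ⟨_, hv1 i⟩

/-- The finite nonempty chains which satisfy `QX` but not `QA`. -/
structure IsMissing (QX QA : Set P → Prop) (s : Set P) : Prop where
  finite : s.Finite
  nonempty : s.Nonempty
  isChain : IsChain (· ≤ ·) s
  mem : QX s
  notMem : ¬ QA s

/-- The combinatorial data of a matching of the finite nonempty chains of a partial order `P` which
satisfy `QX` but not `QA`: each such chain `s` is matched with the chain obtained from `s` by
inserting or removing the element `e s`, which has to be strictly between the least and the greatest
element of `s`. -/
structure Matching (QX QA : Set P → Prop) where
  /-- the element which is inserted or removed -/
  e : Set P → P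
  /-- the rank of a chain -/
  r : Set P → ℕ
  comparable {s : Set P} (_ : IsMissing QX QA s) : ∀ u ∈ s, u ≤ e s ∨ e s ≤ u
  exists_lt {s : Set P} (_ : IsMissing QX QA s) : ∃ u ∈ s, u < e s
  exists_gt {s : Set P} (_ : IsMissing QX QA s) : ∃ u ∈ s, e s < u
  insert_mem {s : Set P} (_ : IsMissing QX QA s) (_ : e s ∉ s) : QX (insert (e s) s)
  e_insert {s : Set P} (_ : IsMissing QX QA s) (_ : e s ∉ s) : e (insert (e s) s) = e s
  diff_notMem {s : Set P} (_ : IsMissing QX QA s) (_ : e s ∈ s) : ¬ QA (s \ {e s})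
  e_diff {s : Set P} (_ : IsMissing QX QA s) (_ : e s ∈ s) : e (s \ {e s}) = e s
  -- Acyclicity: attaching the pair of `s` may require the simplex of another pair as a facet. Such
  -- a facet must have smaller rank.
  r_lt {s : Set P} (_ : IsMissing QX QA s) (_ : e s ∉ s) (u : P) (_ : u ∈ s)
    (_ : IsMissing QX QA (insert (e s) s \ {u}))
    (_ : e (insert (e s) s \ {u}) ∉ insert (e s) s \ {u}) : r (insert (e s) s \ {u}) < r s

/-! ### The regular inner pairing attached to a matching. -/

section

variable {X : SSet.{0}} {j : X ⟶ nerve P} [Mono j] {A : X.Subcomplex} {QX QA : Set P → Prop}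
  (M : Matching QX QA)
  (hX : ∀ {d : ℕ} (z : (nerve P) _⦋d⦌), QX (supp z) ↔ ∃ x, j.app _ x = z)
  (hA : ∀ {d : ℕ} (x : X _⦋d⦌), x ∈ A.obj _ ↔ QA (supp (j.app _ x)))

lemma strictMono_of_nonDegenerate {d : ℕ} {x : X _⦋d⦌} (hx : x ∈ X.nonDegenerate d) :
    StrictMono (j.app _ x).obj := by
  rwa [← SSet.nonDegenerate_iff_of_mono j, PartialOrder.mem_nerve_nonDegenerate_iff_strictMono]
    at hx

lemma app_injective_of_mono {d : ℕ} : Function.Injective (j.app (op ⦋d⦌)) :=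
  injective_of_mono (j.app (op ⦋d⦌))

lemma sMk_eq_of_supp_eq {d e : ℕ} {x : X _⦋d⦌} {y : X _⦋e⦌} (hx : x ∈ X.nonDegenerate d)
    (hy : y ∈ X.nonDegenerate e) (h : supp (j.app _ x) = supp (j.app _ y)) :
    SSet.S.mk x = SSet.S.mk y := by
  have hx' := strictMono_of_nonDegenerate (j := j) hx
  have hy' := strictMono_of_nonDegenerate (j := j) hy
  obtain rfl := dim_eq_of_supp_eq hx' hy' h
  obtain rfl := app_injective_of_mono (eq_of_supp_eq hy' h)
  rfl

omit [Mono j] in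
lemma supp_eq_of_sMk_eq {d e : ℕ} {x : X _⦋d⦌} {y : X _⦋e⦌} (h : SSet.S.mk x = SSet.S.mk y) :
    supp (j.app _ x) = supp (j.app _ y) := by
  obtain rfl := SSet.S.dim_eq_of_mk_eq h
  obtain rfl := (SSet.S.ext_iff _ _).1 h
  rfl

lemma supp_app_δ {d : ℕ} {x : X _⦋d + 1⦌} (hx : x ∈ X.nonDegenerate _) (k : Fin (d + 2)) :
    supp (j.app _ (X.δ k x)) = supp (j.app _ x) \ {(j.app _ x).obj k} := by
  rw [← supp_δ _ (strictMono_of_nonDegenerate hx), SSet.δ_naturality_apply]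

omit [Mono j] in
lemma supp_app_map_subset {d e : ℕ} (f : ⦋e⦌ ⟶ ⦋d⦌) (x : X _⦋d⦌) :
    supp (j.app _ (X.map f.op x)) ⊆ supp (j.app _ x) := by
  rw [NatTrans.naturality_apply]
  exact supp_map_subset f (j.app _ x)

include hX hA in
omit [Mono j] in
lemma isMissing {d : ℕ} {x : X _⦋d⦌} (hx' : x ∉ A.obj _) :
    IsMissing QX QA (supp (j.app _ x)) where
  finite := finite_supp _
  nonempty := nonempty_supp _
  isChain := isChain_supp _
  mem := (hX _).2 ⟨_, rfl⟩
  notMem := by rwa [← hA]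

variable (A) in
/-- The index type of the pairing attached to a matching of chains. -/
structure Index where
  /-- the dimension of the type (II) simplex -/
  dim : ℕ
  /-- the type (I) simplex -/
  simplex : X _⦋dim + 1⦌
  /-- the index of the face -/
  index : Fin (dim + 2)
  nonDegenerate : simplex ∈ X.nonDegenerate _
  notMem : X.δ index simplex ∉ A.obj _
  obj_index : (j.app _ simplex).obj index = M.e (supp (j.app _ simplex))

variable (s : Index (j := j) A M)

omit [Mono j] in
lemma Index.notMem' : s.simplex ∉ A.obj _ := fun h ↦ s.notMem (A.map _ h)

omit [Mono j] in
lemma Index.e_mem : M.e (supp (j.app _ s.simplex)) ∈ supp (j.app _ s.simplex) := by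
  rw [← s.obj_index]; exact ⟨_, rfl⟩

lemma Index.supp_δ : supp (j.app _ (X.δ s.index s.simplex)) =
    supp (j.app _ s.simplex) \ {M.e (supp (j.app _ s.simplex))} := by
  rw [supp_app_δ s.nonDegenerate, s.obj_index]

include hX hA in
lemma Index.e_supp_δ : M.e (supp (j.app _ (X.δ s.index s.simplex))) =
    M.e (supp (j.app _ s.simplex)) := by
  rw [s.supp_δ, M.e_diff (isMissing hX hA s.notMem') s.e_mem]

include hX hA in
lemma Index.e_supp_δ_notMem : M.e (supp (j.app _ (X.δ s.index s.simplex))) ∉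
    supp (j.app _ (X.δ s.index s.simplex)) := by
  rw [s.e_supp_δ M hX hA, s.supp_δ]
  exact fun h ↦ h.2 rfl

include hX hA in
lemma Index.supp_simplex : supp (j.app _ s.simplex) =
    insert (M.e (supp (j.app _ (X.δ s.index s.simplex))))
      (supp (j.app _ (X.δ s.index s.simplex))) := by
  rw [s.e_supp_δ M hX hA, s.supp_δ, Set.insert_sdiff_singleton, Set.insert_eq_of_mem s.e_mem]

variable {M} in
lemma Index.ext_of_supp_eq {s t : Index (j := j) A M}
    (h : supp (j.app _ s.simplex) = supp (j.app _ t.simplex)) : s = t := by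
  have := sMk_eq_of_supp_eq s.nonDegenerate t.nonDegenerate h
  obtain ⟨d, x, k, hx, _, hk⟩ := s
  obtain ⟨d', x', k', hx', _, hk'⟩ := t
  obtain rfl : d = d' := by simpa using SSet.S.dim_eq_of_mk_eq this
  obtain rfl := (SSet.S.ext_iff _ _).1 this
  obtain rfl : k = k' := (strictMono_of_nonDegenerate (j := j) hx).injective (hk.trans hk'.symm)
  rfl

include hX in
lemma exists_index_of_e_notMem {d : ℕ} {x : X _⦋d⦌} (hx : x ∈ X.nonDegenerate d)
    (hx' : IsMissing QX QA (supp (j.app _ x)))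
    (he : M.e (supp (j.app _ x)) ∉ supp (j.app _ x)) :
    ∃ (y : X _⦋d + 1⦌) (k : Fin (d + 2)), y ∈ X.nonDegenerate _ ∧ k ≠ 0 ∧ k ≠ Fin.last _ ∧
      X.δ k y = x ∧ (j.app _ y).obj k = M.e (supp (j.app _ y)) ∧
      supp (j.app _ y) = insert (M.e (supp (j.app _ x))) (supp (j.app _ x)) := by
  obtain ⟨z, k, hz, hk0, hk1, hz', hzk, hz''⟩ := exists_insert (j.app _ x)
    (strictMono_of_nonDegenerate hx) _ he (M.comparable hx') (M.exists_lt hx') (M.exists_gt hx')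
  obtain ⟨y, rfl⟩ := (hX z).1 (by rw [hz'']; exact M.insert_mem hx' he)
  refine ⟨y, k, ?_, hk0, hk1, ?_, ?_, hz''⟩
  · rwa [← SSet.nonDegenerate_iff_of_mono j, PartialOrder.mem_nerve_nonDegenerate_iff_strictMono]
  · apply app_injective_of_mono (j := j)
    rwa [SSet.δ_naturality_apply]
  · rw [hzk, hz'', M.e_insert hx' he]

include hA in
lemma exists_index_of_e_mem {d : ℕ} {x : X _⦋d⦌} (hx : x ∈ X.nonDegenerate d)
    (hx' : IsMissing QX QA (supp (j.app _ x)))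
    (he : M.e (supp (j.app _ x)) ∈ supp (j.app _ x)) :
    ∃ s : Index (j := j) A M, SSet.S.mk x = SSet.S.mk s.simplex := by
  obtain ⟨k, hk⟩ := id he
  -- A single vertex cannot have its toggled element strictly above one of its own elements, so the
  -- dimension is positive.
  obtain _ | d := d
  · obtain ⟨_, ⟨l, rfl⟩, hl⟩ := M.exists_lt hx'
    obtain rfl : l = k := Subsingleton.elim (α := Fin 1) l k
    rw [← hk] at hl
    exact absurd hl (lt_irrefl _)
  · refine ⟨⟨d, x, k, hx, fun h ↦ ?_, hk⟩, rfl⟩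
    rw [hA, supp_app_δ hx, hk] at h
    exact M.diff_notMem hx' he h

/-- The pairing attached to a matching of chains. -/
noncomputable def pairingCore : A.PairingCore where
  ι := Index (j := j) A M
  dim s := s.dim
  simplex s := s.simplex
  index s := s.index
  nonDegenerate₁ s := s.nonDegenerate
  nonDegenerate₂ s := by
    have := SSet.Nonsingular.of_mono j
    exact SSet.nonDegenerate_δ s.nonDegenerate _
  notMem₁ s := s.notMem'
  notMem₂ s := s.notMem
  injective_type₁' h := Index.ext_of_supp_eq (supp_eq_of_sMk_eq h)
  injective_type₂' {s t} h := Index.ext_of_supp_eq (by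
    rw [s.supp_simplex M hX hA, t.supp_simplex M hX hA, supp_eq_of_sMk_eq h])
  type₁_ne_type₂' s t h := by
    apply t.e_supp_δ_notMem M hX hA
    rw [← supp_eq_of_sMk_eq h]
    exact s.e_mem
  -- A missing simplex is of type (I) or of type (II) according to whether it contains its toggled
  -- element.
  surjective' x := by
    have hx := isMissing (j := j) hX hA x.notMem
    by_cases he : M.e (supp (j.app _ x.simplex)) ∈ supp (j.app _ x.simplex)
    · obtain ⟨d, x, hx₀, hx₁, rfl⟩ := x.mk_surjective
      obtain ⟨s, hs⟩ := exists_index_of_e_mem M hA hx₀ hx he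
      exact ⟨s, Or.inl hs⟩
    · obtain ⟨y, k, hy, _, _, hyx, hyk, _⟩ := exists_index_of_e_notMem M hX x.nonDegenerate hx he
      exact ⟨⟨_, y, k, hy, by rw [hyx]; exact x.notMem, hyk⟩, Or.inr (congrArg SSet.S.mk hyx.symm)⟩

include hX hA M in
/-- A subcomplex for which there is a matching of the missing chains is an inner anodyne
extension. -/
theorem Matching.innerAnodyneExtensions : SSet.innerAnodyneExtensions A.ι := by
  have := SSet.Nonsingular.of_mono j
  let p := pairingCore M hX hA
  -- An index is determined by the support of its type (I) simplex, so it coincides with the one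
  -- obtained by inserting the toggled element, which is an interior vertex.
  have hi : p.IsInner := by
    suffices h : ∀ s : Index (j := j) A M, s.index ≠ 0 ∧ s.index ≠ Fin.last _ from
      ⟨fun s ↦ (h s).1, fun s ↦ (h s).2⟩
    intro s
    obtain ⟨y, k, hy, hk0, hk1, hyx, hyk, hy'⟩ := exists_index_of_e_notMem M hX
      (SSet.nonDegenerate_δ s.nonDegenerate s.index) (isMissing hX hA s.notMem)
      (s.e_supp_δ_notMem M hX hA)
    have : s = ⟨s.dim, y, k, hy, by rw [hyx]; exact s.notMem, hyk⟩ :=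
      Index.ext_of_supp_eq (by rw [hy', s.supp_simplex M hX hA])
    rw [this]
    exact ⟨hk0, hk1⟩
  have hr : p.IsRegular := SSet.Subcomplex.PairingCore.WeakRankFunction.isRegular (α := ℕ)
    { rank (s : Index (j := j) A M) := M.r (supp (j.app _ (X.δ s.index s.simplex)))
      lt {s t} hst hd := by
        change Index (j := j) A M at s
        change Index (j := j) A M at t
        obtain ⟨hne, hlt⟩ := hst
        have hsub : supp (j.app _ (X.δ s.index s.simplex)) ⊆ supp (j.app _ t.simplex) := by
          obtain ⟨f, hf⟩ := SSet.S.le_iff.1 (SSet.N.le_iff.1 hlt.le)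
          replace hf : X.map f.op t.simplex = X.δ s.index s.simplex := hf
          rw [← hf]
          exact supp_app_map_subset (d := t.dim + 1) (e := s.dim) f t.simplex
        -- Ranks are only compared in equal dimensions, so the type (II) simplex of `s` omits
        -- exactly one vertex `u` of the type (I) simplex of `t`.
        have hd' : s.dim = t.dim := hd
        have hcs := ncard_supp (strictMono_of_nonDegenerate (j := j)
          (SSet.nonDegenerate_δ s.nonDegenerate s.index))
        have hct := ncard_supp (strictMono_of_nonDegenerate (j := j) t.nonDegenerate)
        have hcd := Set.ncard_sdiff_add_ncard_of_subset hsub (finite_supp _)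
        obtain ⟨u, hu⟩ := Set.ncard_eq_one.1 (show (supp (j.app _ t.simplex) \
          supp (j.app _ (X.δ s.index s.simplex))).ncard = 1 by omega)
        have hs : supp (j.app _ (X.δ s.index s.simplex)) = supp (j.app _ t.simplex) \ {u} := by
          rw [← hu, Set.sdiff_sdiff_cancel_left hsub]
        have hu' : u ∈ supp (j.app _ t.simplex) := (hu.ge rfl).1
        -- Omitting the toggled element of `t` would give the type (II) simplex of `t` itself, and
        -- then `s = t`.
        have hue : u ≠ M.e (supp (j.app _ (X.δ t.index t.simplex))) := by
          rintro rfl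
          apply hne
          apply Index.ext_of_supp_eq
          rw [s.supp_simplex M hX hA, t.supp_simplex M hX hA]
          have : supp (j.app _ (X.δ s.index s.simplex)) =
              supp (j.app _ (X.δ t.index t.simplex)) := by
            rw [hs, t.e_supp_δ M hX hA, ← t.supp_δ]
          rw [this]
        rw [t.supp_simplex M hX hA] at hs hu'
        have h1 := isMissing (j := j) hX hA s.notMem
        have h2 := s.e_supp_δ_notMem M hX hA
        rw [hs] at h1 h2 ⊢
        exact M.r_lt (isMissing hX hA t.notMem) (t.e_supp_δ_notMem M hX hA) u
          (hu'.resolve_left hue) h1 h2 }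
  exact p.pairing.innerAnodyneExtensions

end

end NervePairing

/-! ### Saturated subcomplexes of nerves of finite meet-semilattices -/

namespace NervePairing

lemma exists_isLeast_of_isChain {P : Type} [PartialOrder P] {s : Set P} (hf : s.Finite)
    (hn : s.Nonempty) (hc : IsChain (· ≤ ·) s) : ∃ v, IsLeast s v := by
  obtain ⟨v, hv⟩ := hf.exists_minimal hn
  refine ⟨v, hv.1, fun x hx ↦ ?_⟩
  rcases hc.total hv.1 hx with h | h
  · exact h
  · exact hv.2 hx h

lemma exists_isGreatest_of_isChain {P : Type} [PartialOrder P] {s : Set P} (hf : s.Finite)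
    (hn : s.Nonempty) (hc : IsChain (· ≤ ·) s) : ∃ v, IsGreatest s v := by
  obtain ⟨v, hv⟩ := hf.exists_maximal hn
  refine ⟨v, hv.1, fun x hx ↦ ?_⟩
  rcases hc.total hv.1 hx with h | h
  · exact hv.2 hx h
  · exact h

section

variable {P : Type} [SemilatticeInf P] [Finite P] [Nonempty P] (R : P → P → Prop) (c : P → P → P)

/-- The least element of a set (if it exists). -/
noncomputable def least (s : Set P) : P := Classical.epsilon (IsLeast s)

/-- The greatest element of a set (if it exists). -/
noncomputable def greatest (s : Set P) : P := Classical.epsilon (IsGreatest s)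

omit [Finite P] in
lemma least_eq {s : Set P} {v : P} (h : IsLeast s v) : least s = v :=
  (Classical.epsilon_spec ⟨v, h⟩ : IsLeast s (least s)).unique h

omit [Finite P] in
lemma greatest_eq {s : Set P} {v : P} (h : IsGreatest s v) : greatest s = v :=
  (Classical.epsilon_spec ⟨v, h⟩ : IsGreatest s (greatest s)).unique h

/-- The element `c v w` attached to a set with least element `v` and greatest element `w`. -/
noncomputable def cut (s : Set P) : P := c (least s) (greatest s)

/-- The elements of a set that are not below the cut. -/
def above (s : Set P) : Set P := {x | x ∈ s ∧ ¬ x ≤ cut c s}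

/-- The meet of the cut with the first element of a set that is not below the cut. -/
noncomputable def meetCut (s : Set P) : P := least (above c s) ⊓ cut c s

variable {R c}

/-- The relation `R` between the least and the greatest elements. -/
def EndsRel (R : P → P → Prop) (s : Set P) : Prop := R (least s) (greatest s)

variable (hc : ∀ v w, v ≤ w → ¬ R v w → v < c v w ∧ ¬ w ≤ c v w ∧
  ∀ x, v < x → x ≤ w → v < x ⊓ c v w)

-- The elements of a chain that are not below the cut form a final segment, with least element `m`.
-- All earlier elements are below both `m` and the cut, so `m ⊓ c v w` fits just before `m`. The
-- last condition in `hc` keeps it strictly above `v`.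
include hc in
omit [Finite P] in
lemma meetCut_spec {s : Set P} (hs : IsMissing (fun _ ↦ True) (EndsRel R) s) :
    ∃ v w m, IsLeast s v ∧ IsGreatest s w ∧ IsLeast (above c s) m ∧ ¬ R v w ∧
      cut c s = c v w ∧ meetCut c s = m ⊓ c v w ∧ v < meetCut c s ∧ meetCut c s < m ∧
      (∀ u ∈ s, u ≤ meetCut c s ∨ m ≤ u) := by
  obtain ⟨v, hv⟩ := exists_isLeast_of_isChain hs.finite hs.nonempty hs.isChain
  obtain ⟨w, hw⟩ := exists_isGreatest_of_isChain hs.finite hs.nonempty hs.isChain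
  have hR : ¬ R v w := by simpa only [EndsRel, least_eq hv, greatest_eq hw] using hs.notMem
  have hcut : cut c s = c v w := by rw [cut, least_eq hv, greatest_eq hw]
  obtain ⟨h1, h2, h3⟩ := hc v w (hv.2 hw.1) hR
  obtain ⟨m, hm⟩ := exists_isLeast_of_isChain (s := above c s) (hs.finite.subset fun _ h ↦ h.1)
    ⟨w, hw.1, by rwa [hcut]⟩ (hs.isChain.mono fun _ h ↦ h.1)
  have hm' : ¬ m ≤ c v w := by rw [← hcut]; exact hm.1.2
  have he : meetCut c s = m ⊓ c v w := by rw [meetCut, least_eq hm, hcut]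
  refine ⟨v, w, m, hv, hw, hm, hR, hcut, he, ?_, ?_, fun u hu ↦ ?_⟩
  · rw [he]
    refine h3 m (lt_of_le_of_ne (hv.2 hm.1.1) ?_) (hw.2 hm.1.1)
    rintro rfl
    exact hm' h1.le
  · rw [he]
    exact lt_of_le_of_ne inf_le_left fun h ↦ hm' (inf_eq_left.1 h)
  · by_cases hu' : u ≤ c v w
    · left
      rw [he]
      refine le_inf ?_ hu'
      rcases hs.isChain.total hu hm.1.1 with h | h
      · exact h
      · exact absurd (h.trans hu') hm'
    · exact Or.inr (hm.2 ⟨hu, by rwa [hcut]⟩)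

omit [Finite P] in
lemma meetCut_congr {s t : Set P} {v w : P} (hv : IsLeast s v) (hw : IsGreatest s w)
    (hv' : IsLeast t v) (hw' : IsGreatest t w) (h : above c s = above c t) :
    meetCut c s = meetCut c t := by
  rw [meetCut, meetCut, h, cut, cut, least_eq hv, least_eq hv', greatest_eq hw, greatest_eq hw']

omit [Finite P] in
lemma above_eq {s t : Set P} {v w : P} (hv : IsLeast s v) (hw : IsGreatest s w)
    (hv' : IsLeast t v) (hw' : IsGreatest t w) (h : ∀ x, ¬ x ≤ c v w → (x ∈ s ↔ x ∈ t)) :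
    above c s = above c t := by
  ext x
  simp only [above, cut, least_eq hv, least_eq hv', greatest_eq hw, greatest_eq hw',
    Set.mem_ofPred_eq]
  exact ⟨fun hx ↦ ⟨(h x hx.2).1 hx.1, hx.2⟩, fun hx ↦ ⟨(h x hx.2).2 hx.1, hx.2⟩⟩

/-- The matching which inserts or removes the elements `meetCut c s`. -/
noncomputable def meetMatching : Matching (P := P) (fun _ ↦ True) (EndsRel R) where
  e := meetCut c
  -- Lexicographic order: the size of the interval between the ends comes first, then the number of
  -- elements not below the cut. That number is at most `Nat.card P`, which explains the factor.
  r s := (Set.Icc (least s) (greatest s)).ncard * (Nat.card P + 1) + (above c s).ncard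
  comparable {s} hs u hu := by
    obtain ⟨v, w, m, hv, hw, hm, hR, hcut, he, h1, h2, h3⟩ := meetCut_spec hc hs
    exact (h3 u hu).imp_right h2.le.trans
  exists_lt {s} hs := by
    obtain ⟨v, w, m, hv, hw, hm, hR, hcut, he, h1, h2, h3⟩ := meetCut_spec hc hs
    exact ⟨v, hv.1, h1⟩
  exists_gt {s} hs := by
    obtain ⟨v, w, m, hv, hw, hm, hR, hcut, he, h1, h2, h3⟩ := meetCut_spec hc hs
    exact ⟨m, hm.1.1, h2⟩
  insert_mem _ _ := trivial
  e_insert {s} hs _ := by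
    obtain ⟨v, w, m, hv, hw, hm, hR, hcut, he, h1, h2, h3⟩ := meetCut_spec hc hs
    have hv' : IsLeast (insert (meetCut c s) s) v :=
      ⟨Or.inr hv.1, by rintro x (rfl | hx); exacts [h1.le, hv.2 hx]⟩
    have hw' : IsGreatest (insert (meetCut c s) s) w :=
      ⟨Or.inr hw.1, by rintro x (rfl | hx); exacts [h2.le.trans (hw.2 hm.1.1), hw.2 hx]⟩
    refine meetCut_congr hv' hw' hv hw (above_eq hv' hw' hv hw fun x hx ↦ ?_)
    refine ⟨?_, Or.inr⟩
    rintro (rfl | h)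
    · exact absurd (he.le.trans inf_le_right) hx
    · exact h
  diff_notMem {s} hs _ := by
    obtain ⟨v, w, m, hv, hw, hm, hR, hcut, he, h1, h2, h3⟩ := meetCut_spec hc hs
    have hv' : IsLeast (s \ {meetCut c s}) v := ⟨⟨hv.1, h1.ne⟩, fun x hx ↦ hv.2 hx.1⟩
    have hw' : IsGreatest (s \ {meetCut c s}) w :=
      ⟨⟨hw.1, (h2.trans_le (hw.2 hm.1.1)).ne'⟩, fun x hx ↦ hw.2 hx.1⟩
    rwa [EndsRel, least_eq hv', greatest_eq hw']
  e_diff {s} hs _ := by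
    obtain ⟨v, w, m, hv, hw, hm, hR, hcut, he, h1, h2, h3⟩ := meetCut_spec hc hs
    have hv' : IsLeast (s \ {meetCut c s}) v := ⟨⟨hv.1, h1.ne⟩, fun x hx ↦ hv.2 hx.1⟩
    have hw' : IsGreatest (s \ {meetCut c s}) w :=
      ⟨⟨hw.1, (h2.trans_le (hw.2 hm.1.1)).ne'⟩, fun x hx ↦ hw.2 hx.1⟩
    refine meetCut_congr hv' hw' hv hw (above_eq hv' hw' hv hw fun x hx ↦ ?_)
    refine ⟨fun h ↦ h.1, fun h ↦ ⟨h, ?_⟩⟩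
    rintro rfl
    exact hx (he.le.trans inf_le_right)
  r_lt {s} hs hes u hu hs' hes' := by
    obtain ⟨v, w, m, hv, hw, hm, hR, hcut, he, h1, h2, h3⟩ := meetCut_spec hc hs
    obtain ⟨v', w', m', hv', hw', -⟩ := meetCut_spec hc hs'
    have hvv : v ≤ v' := by
      rcases hv'.1.1 with rfl | h
      · exact h1.le
      · exact hv.2 h
    have hww : w' ≤ w := by
      rcases hw'.1.1 with rfl | h
      · exact h2.le.trans (hw.2 hm.1.1)
      · exact hw.2 h
    have hsub : Set.Icc v' w' ⊆ Set.Icc v w := Set.Icc_subset_Icc hvv hww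
    by_cases heq : v' = v ∧ w' = w
    · obtain ⟨rfl, rfl⟩ := heq
      rw [least_eq hv, greatest_eq hw, least_eq hv', greatest_eq hw']
      -- With unchanged ends, deleting an element below the cut would leave the toggled element
      -- unchanged, and hence still present.
      have hu' : ¬ u ≤ c v' w' := by
        intro hu'
        apply hes'
        rw [meetCut_congr (t := s) hv' hw' hv hw (above_eq hv' hw' hv hw fun x hx ↦ ?_)]
        · exact ⟨Or.inl rfl, fun h ↦ hes (by rw [h]; exact hu)⟩
        · constructor
          · rintro ⟨rfl | h, -⟩
            · exact absurd (he.le.trans inf_le_right) hx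
            · exact h
          · exact fun h ↦ ⟨Or.inr h, fun h' ↦ hx (by rw [h']; exact hu')⟩
      refine Nat.add_lt_add_left (Set.ncard_lt_ncard (Set.ssubset_iff_of_subset ?_ |>.2 ?_)
        (hs.finite.subset fun _ h ↦ h.1)) _
      · rintro x ⟨⟨rfl | hx, hxu⟩, hx'⟩
        · rw [cut, least_eq hv', greatest_eq hw'] at hx'
          exact absurd (he.le.trans inf_le_right) hx'
        · refine ⟨hx, ?_⟩
          rwa [hcut, ← least_eq hv', ← greatest_eq hw']
      · exact ⟨u, ⟨hu, by rwa [hcut]⟩, fun h ↦ h.1.2 rfl⟩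
    · rw [least_eq hv, greatest_eq hw, least_eq hv', greatest_eq hw']
      have hlt : (Set.Icc v' w').ncard < (Set.Icc v w).ncard := by
        refine Set.ncard_lt_ncard (hsub.ssubset_of_ne fun h ↦ heq ?_) (Set.toFinite _)
        have hle := hv.2 hw.1
        have h4 : v ∈ Set.Icc v' w' := h.ge ⟨le_rfl, hle⟩
        have h5 : w ∈ Set.Icc v' w' := h.ge ⟨hle, le_rfl⟩
        exact ⟨le_antisymm h4.1 hvv, le_antisymm hww h5.2⟩
      have hab : (above c (insert (meetCut c s) s \ {u})).ncard ≤ Nat.card P := by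
        rw [← Set.ncard_univ]
        exact Set.ncard_le_ncard (Set.subset_univ _) (Set.toFinite _)
      have := Nat.mul_le_mul_right (Nat.card P + 1) hlt
      rw [Nat.succ_mul] at this
      omega

omit [Finite P] [Nonempty P] in
lemma isLeast_supp {d : ℕ} (x : (nerve P) _⦋d⦌) : IsLeast (supp x) (x.obj 0) :=
  ⟨⟨0, rfl⟩, by rintro _ ⟨i, rfl⟩; exact x.monotone (Fin.zero_le i)⟩

omit [Finite P] [Nonempty P] in
lemma isGreatest_supp {d : ℕ} (x : (nerve P) _⦋d⦌) : IsGreatest (supp x) (x.obj (Fin.last d)) :=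
  ⟨⟨Fin.last d, rfl⟩, by rintro _ ⟨i, rfl⟩; exact x.monotone (Fin.le_last i)⟩

include hc in
/-- A subcomplex `A` of the nerve of a finite meet-semilattice which consists of the simplices
whose first vertex `v` and last vertex `w` satisfy the relation `R v w` is an inner anodyne
extension when, for `v ≤ w` such that `¬ R v w`, there is an element `c v w` which is not above `w`
and whose meets with the elements `x` such that `v < x ≤ w` are not `v`. -/
theorem innerAnodyneExtensions_of_endsRel (A : (nerve P).Subcomplex)
    (hA : ∀ {d : ℕ} (x : (nerve P) _⦋d⦌), x ∈ A.obj _ ↔ R (x.obj 0) (x.obj (Fin.last d))) :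
    SSet.innerAnodyneExtensions A.ι :=
  (meetMatching hc).innerAnodyneExtensions (j := 𝟙 (nerve P))
    (fun z ↦ ⟨fun _ ↦ ⟨z, rfl⟩, fun _ ↦ trivial⟩)
    (fun x ↦ by
      rw [hA]
      change _ ↔ R (least (supp x)) (greatest (supp x))
      rw [least_eq (isLeast_supp x), greatest_eq (isGreatest_supp x)])

end

end NervePairing

/-! ### Saturated simplicial subsets of `Ar(Δ^n)` -/

namespace Ar

/-- The square `Δ^k × Δ^l ⟶ Ar(Δ^n)`, `(i, j) ↦ (a + i; b + j)`. -/
def square (n a b k l : ℕ) (hbl : b + l ≤ n) (hab : a + k ≤ b) :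
    Δ[k] ⊗ Δ[l] ⟶ Ar.obj ⦋n⦌ where
  app d := ↾fun (z : (Δ[k] ⊗ Δ[l] : SSet.{0}).obj d) ↦
    Ar.mk (n := ⦋n⦌)
      { toFun r := ⟨(⟨a + ((SSet.stdSimplex.objEquiv z.1).toOrderHom r).val, by
            have := ((SSet.stdSimplex.objEquiv z.1).toOrderHom r).isLt
            simp only [SimplexCategory.len_mk] at this ⊢; omega⟩,
          ⟨b + ((SSet.stdSimplex.objEquiv z.2).toOrderHom r).val, by
            have := ((SSet.stdSimplex.objEquiv z.2).toOrderHom r).isLt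
            simp only [SimplexCategory.len_mk] at this ⊢; omega⟩), by
            have := ((SSet.stdSimplex.objEquiv z.1).toOrderHom r).isLt
            simp only [SimplexCategory.len_mk] at this
            exact Fin.le_def.2 (by dsimp only; omega)⟩
        monotone' r s h := ⟨
          Fin.le_def.2 (Nat.add_le_add_left
            ((SSet.stdSimplex.objEquiv z.1).toOrderHom.monotone h) _),
          Fin.le_def.2 (Nat.add_le_add_left
            ((SSet.stdSimplex.objEquiv z.2).toOrderHom.monotone h) _)⟩ }
  naturality _ _ _ := rfl

lemma isSquare_square (n a b k l : ℕ) (hbl : b + l ≤ n) (hab : a + k ≤ b) :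
    IsSquare (square n a b k l hbl hab) :=
  ⟨a, b, fun _ _ ↦ ⟨rfl, rfl⟩⟩

lemma exists_mem_of_smallSquare {n : ℕ} {X : (Ar.obj ⦋n⦌).Subcomplex}
    (hX : ContainsSmallSquares X) (v w : ArObj n) (hvw : v ≤ w)
    (h1 : w.1.1.val ≤ v.1.1.val + 1) (h2 : w.1.2.val ≤ v.1.2.val + 1) (h3 : w.1.1 ≤ v.1.2) :
    ∃ φ : (Ar.obj ⦋n⦌) _⦋1⦌, φ ∈ X.obj _ ∧ Ar.vertex φ 0 = v ∧ Ar.vertex φ (Fin.last 1) = w := by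
  obtain ⟨⟨⟨a, ha⟩, ⟨b, hb⟩⟩, hab⟩ := v
  obtain ⟨⟨⟨c, hc⟩, ⟨d, hd⟩⟩, hcd⟩ := w
  obtain ⟨hac, hbd⟩ := hvw
  simp only [Fin.mk_le_mk] at *
  obtain ⟨k, rfl⟩ := Nat.exists_eq_add_of_le hac
  obtain ⟨l, rfl⟩ := Nat.exists_eq_add_of_le hbd
  have := hX (square n a b k l (by omega) h3) (by omega) (by omega)
    (isSquare_square ..)
  let z : (Δ[k] ⊗ Δ[l] : SSet.{0}) _⦋1⦌ :=
    (SSet.stdSimplex.objEquiv.symm (SimplexCategory.mkOfLe 0 (Fin.last k) (Fin.zero_le _)),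
      SSet.stdSimplex.objEquiv.symm (SimplexCategory.mkOfLe 0 (Fin.last l) (Fin.zero_le _)))
  exact ⟨(square n a b k l (by omega) h3).app _ z, this _ ⟨z, rfl⟩, rfl, rfl⟩

/-- The element used to subdivide the interval between `v` and `w`. -/
def cutPoint {n : ℕ} (v w : ArObj n) : ArObj n :=
  if h : v.1.2 ≤ w.1.2 ∧ v.1.1 ≤ w.1.1 then
    -- Here the pair `(w.1.1; v.1.2)` is not an object of `Ar`, so the rectangle between `v` and `w`
    -- lacks a corner.
    if v.1.2 < w.1.1 then ⟨(v.1.2, w.1.2), h.1⟩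
    -- In this case and the next, one coordinate grows by at least two. The cut stops it after one
    -- step and keeps the other coordinate of `w`.
    else if h2 : v.1.1.val + 1 < w.1.1.val then
      ⟨(⟨v.1.1.val + 1, h2.trans w.1.1.isLt⟩, w.1.2), h2.le.trans w.2⟩
    else if h3 : v.1.2.val + 1 < w.1.2.val ∧ w.1.1 ≤ v.1.2 then
      ⟨(w.1.1, ⟨v.1.2.val + 1, h3.1.trans w.1.2.isLt⟩), Fin.le_def.2 (Nat.le_succ_of_le h3.2)⟩
    -- Junk value: reaching this branch means that `v` and `w` are opposite corners of a small
    -- square.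
    else v
  else v

end Ar

-- Saturation turns membership in `X` into a relation between the end vertices. The small squares
-- ensure that unrelated ends are far enough apart, or badly enough placed, for `cutPoint` to
-- subdivide the interval.
open Ar in
theorem innerAnodyneExtensions_of_isSaturated {n : ℕ} (X : (Ar.obj ⦋n⦌).Subcomplex)
    (hs : Ar.IsSaturated X) (hX : Ar.ContainsSmallSquares X) :
    SSet.innerAnodyneExtensions X.ι := by
  let : SemilatticeInf (ArObj n) := Subtype.semilatticeInf (fun {x y} hx hy ↦
    le_inf (inf_le_left.trans hx) (inf_le_right.trans hy))
  have : Nonempty (ArObj n) := ⟨⟨(0, 0), le_rfl⟩⟩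
  refine NervePairing.innerAnodyneExtensions_of_endsRel (P := ArObj n) (c := cutPoint)
    (R := fun v w ↦ ∃ (d : ℕ) (φ : (Ar.obj ⦋n⦌) _⦋d⦌), φ ∈ X.obj _ ∧ Ar.vertex φ 0 = v ∧
      Ar.vertex φ (Fin.last d) = w) (hc := ?_) (A := X) ?_
  · intro v w hvw hR
    have hsq : ¬ (w.1.1.val ≤ v.1.1.val + 1 ∧ w.1.2.val ≤ v.1.2.val + 1 ∧ w.1.1 ≤ v.1.2) :=
      fun h ↦ hR ⟨1, exists_mem_of_smallSquare hX v w hvw h.1 h.2.1 h.2.2⟩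
    clear hR
    suffices h : v < cutPoint v w ∧ ¬ w ≤ cutPoint v w ∧
        ∀ x, v < x → x ≤ w → ¬ (x ⊓ cutPoint v w ≤ v) by
      refine ⟨h.1, h.2.1, fun x hx hxw ↦ ?_⟩
      exact lt_of_le_of_ne (le_inf hx.le h.1.le) (fun e ↦ h.2.2 x hx hxw e.ge)
    have key : ∀ x y : ArObj n, x ⊓ y ≤ v ↔ (min x.1.1 y.1.1 ≤ v.1.1 ∧ min x.1.2 y.1.2 ≤ v.1.2) :=
      fun x y ↦ Iff.rfl
    have kle : ∀ x y : ArObj n, x ≤ y ↔ (x.1.1.val ≤ y.1.1.val ∧ x.1.2.val ≤ y.1.2.val) :=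
      fun x y ↦ Iff.rfl
    simp only [key, lt_iff_le_not_ge, kle, Fin.le_def, Fin.coe_min] at *
    obtain ⟨⟨⟨a, ha⟩, ⟨b, hb⟩⟩, hab⟩ := v
    obtain ⟨⟨⟨c, hc⟩, ⟨d, hd⟩⟩, hcd⟩ := w
    replace hab : a ≤ b := hab
    replace hcd : c ≤ d := hcd
    dsimp only at hsq hvw
    dsimp only [cutPoint]
    simp only [Fin.mk_le_mk, Fin.mk_lt_mk]
    rw [dif_pos ⟨hvw.2, hvw.1⟩]
    split_ifs with h1 h2 h3
    · refine ⟨by dsimp only; omega, by dsimp only; omega, ?_⟩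
      rintro ⟨⟨⟨e, he⟩, ⟨f, hf⟩⟩, hef⟩
      replace hef : e ≤ f := hef
      dsimp only
      omega
    · refine ⟨by dsimp only; omega, by dsimp only; omega, ?_⟩
      rintro ⟨⟨⟨e, he⟩, ⟨f, hf⟩⟩, hef⟩
      replace hef : e ≤ f := hef
      dsimp only
      omega
    · refine ⟨by dsimp only; omega, by dsimp only; omega, ?_⟩
      rintro ⟨⟨⟨e, he⟩, ⟨f, hf⟩⟩, hef⟩
      replace hef : e ≤ f := hef
      dsimp only
      omega
    · omega
  · intro d x
    exact ⟨fun h ↦ ⟨d, x, h, rfl, rfl⟩, fun ⟨e, φ, hφ, h0, h1⟩ ↦ hs φ x h0 h1 hφ⟩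

/-! ### Subcomplexes of nerves of partial orders -/

namespace SSet.Subcomplex

lemma exists_glue {X C : SSet.{0}} (A B : X.Subcomplex) (a : A.toSSet ⟶ C) (b : B.toSSet ⟶ C)
    (h : ∀ ⦃d : ℕ⦄ (x : X _⦋d⦌) (hA : x ∈ A.obj _) (hB : x ∈ B.obj _),
      a.app (op ⦋d⦌) ⟨x, hA⟩ = b.app (op ⦋d⦌) ⟨x, hB⟩) :
    ∃ c : (A ⊔ B).toSSet ⟶ C,
      (∀ ⦃d : ℕ⦄ (x : X _⦋d⦌) (hA : x ∈ A.obj _),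
        c.app (op ⦋d⦌) ⟨x, Or.inl hA⟩ = a.app (op ⦋d⦌) ⟨x, hA⟩) ∧
      (∀ ⦃d : ℕ⦄ (x : X _⦋d⦌) (hB : x ∈ B.obj _),
        c.app (op ⦋d⦌) ⟨x, Or.inr hB⟩ = b.app (op ⦋d⦌) ⟨x, hB⟩) := by
  have sq : BicartSq (A ⊓ B) A B (A ⊔ B) := { sup_eq := rfl, inf_eq := rfl }
  have w : homOfLE sq.le₁₂ ≫ a = homOfLE sq.le₁₃ ≫ b := by
    ext ⟨⟨d⟩⟩ ⟨x, hx⟩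
    exact h x hx.1 hx.2
  refine ⟨sq.isPushout.desc a b w, fun d x hx ↦ ?_, fun d x hx ↦ ?_⟩
  · exact ConcreteCategory.congr_hom (NatTrans.congr_app (sq.isPushout.inl_desc a b w) (op ⦋d⦌))
      ⟨x, hx⟩
  · exact ConcreteCategory.congr_hom (NatTrans.congr_app (sq.isPushout.inr_desc a b w) (op ⦋d⦌))
      ⟨x, hx⟩

end SSet.Subcomplex

namespace NervePairing

section

variable {P P' : Type} [PartialOrder P] [PartialOrder P']

/-- The simplex of the nerve of a partial order with given vertices. -/
def simplexMk {d : ℕ} (u : Fin (d + 1) → P) (hu : Monotone u) : (nerve P) _⦋d⦌ := hu.functor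

/-- A family of sets which is stable by passing to smaller sets. -/
def IsLower (Q : Set P → Prop) : Prop := ∀ ⦃s t : Set P⦄, s ⊆ t → Q t → Q s

/-- The subcomplex of the nerve of a partial order given by the simplices whose set of vertices
satisfies a condition `Q`. -/
def ofSupp (Q : Set P → Prop) (hQ : IsLower Q) : (nerve P).Subcomplex where
  obj d := {x | Q (supp (d := d.unop.len) x)}
  map {_ e} f x hx := hQ (supp_map_subset (e := e.unop.len) f.unop x) hx

/-- The map between subcomplexes of nerves induced by a map which is monotone on the relevant
sets. -/
def mapOfMonotoneOn {Q : Set P → Prop} {Q' : Set P' → Prop} {hQ : IsLower Q} {hQ' : IsLower Q'}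
    (r : P → P') (hr : ∀ s, Q s → MonotoneOn r s) (h : ∀ s, Q s → Q' (r '' s)) :
    (ofSupp Q hQ).toSSet ⟶ (ofSupp Q' hQ').toSSet where
  app d := ↾fun x ↦ ⟨simplexMk (d := d.unop.len) (fun i ↦ r (x.1.obj i)) (fun i j hij ↦
      hr _ x.2 ⟨i, rfl⟩ ⟨j, rfl⟩ (x.1.monotone hij)), by
    have := h _ x.2
    change Q' (Set.range _)
    rw [supp, ← Set.range_comp] at this
    exact this⟩
  naturality _ _ _ := rfl

/-- The morphism in the simplex category corresponding to a simplex of the nerve of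
`Fin (k + 1)`. -/
def toHom {k : ℕ} {d : SimplexCategoryᵒᵖ} (x : (nerve (Fin (k + 1))).obj d) : d.unop ⟶ ⦋k⦌ :=
  SimplexCategory.Hom.mk ⟨x.obj, x.monotone⟩

/-- The map from the nerve of `Fin (k + 1)` corresponding to a `k`-simplex. -/
def ofSimplex {C : SSet.{0}} {k : ℕ} (τ : C _⦋k⦌) : nerve (Fin (k + 1)) ⟶ C where
  app d := ↾fun x ↦ C.map (toHom x).op τ
  naturality d e f := by
    ext x
    exact ConcreteCategory.congr_hom (C.map_comp (toHom x).op f) τ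

/-- Extension of maps to a quasi-category along the inclusion of a subcomplex for which there is
a matching of the missing chains. -/
lemma Matching.exists_extension {QB QA : Set P → Prop} (M : Matching QB QA)
    (hB : IsLower QB) (hA : IsLower QA) (hAB : ∀ s, QA s → QB s) {C : SSet.{0}}
    [SSet.Quasicategory C] (a : (ofSupp QA hA).toSSet ⟶ C) :
    ∃ b : (ofSupp QB hB).toSSet ⟶ C, ∀ ⦃d : ℕ⦄ (x : (nerve P) _⦋d⦌) (hx : QA (supp x)),
      b.app (op ⦋d⦌) ⟨x, hAB _ hx⟩ = a.app (op ⦋d⦌) ⟨x, hx⟩ := by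
  let B := ofSupp QB hB
  let A : B.toSSet.Subcomplex := (ofSupp QA hA).preimage B.ι
  have hι : SSet.innerAnodyneExtensions A.ι :=
    M.innerAnodyneExtensions (j := B.ι) (fun z ↦ ⟨fun h ↦ ⟨⟨z, h⟩, rfl⟩, by rintro ⟨x, rfl⟩; exact x.2⟩)
      (fun x ↦ Iff.rfl)
  let a' : A.toSSet ⟶ C := SSet.Subcomplex.fromPreimage _ B.ι ≫ a
  have := hι (terminal.from C) (SSet.mem_innerFibrations _)
  have sq : CommSq a' A.ι (terminal.from C) (terminal.from _) := ⟨Subsingleton.elim _ _⟩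
  refine ⟨sq.lift, fun d x hx ↦ ?_⟩
  exact ConcreteCategory.congr_hom (NatTrans.congr_app sq.fac_left (op ⦋d⦌)) ⟨⟨x, hAB _ hx⟩, hx⟩

end

end NervePairing

/-! ### Invertible edges and special outer horns -/

namespace SSet

/-- The edges which admit an inverse (up to homotopy). -/
def IsInvertible {C : SSet.{0}} (e : C _⦋1⦌) : Prop := Nonempty (Edge.mk' e).InvStruct

/-- If `f` is an invertible edge `x ⟶ y` of a quasi-category, there is a `3`-simplex with
vertices `x`, `y`, `x`, `y` and edges `f`, its inverse and `f`. -/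
lemma IsInvertible.exists_tetrahedron {C : SSet.{0}} [Quasicategory C] {f : C _⦋1⦌}
    (hf : IsInvertible f) : ∃ τ : C _⦋3⦌, C.δ 1 τ = C.σ 0 f ∧
      C.δ 1 (C.δ 0 τ) = C.σ 0 (C.δ 0 f) := by
  obtain ⟨I⟩ := hf
  have hδ {k : ℕ} (i : Fin (k + 2)) (x : C _⦋k + 1⦌) :
      stdSimplex.δ i ≫ yonedaEquiv.symm x = yonedaEquiv.symm (C.δ i x) :=
    yonedaEquiv_symm_naturality_left (SimplexCategory.δ i) x
  have hδ' {k : ℕ} (i : Fin (k + 2)) (g : Δ[k + 1] ⟶ C) :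
      C.δ i (yonedaEquiv g) = yonedaEquiv (stdSimplex.δ i ≫ g) :=
    yonedaEquiv_naturality (SimplexCategory.δ i) g
  -- Faces `0` and `3` are the two inverse relations, and face `1` is degenerate on `f`. The inner
  -- face `2` is the one left open.
  obtain ⟨φ, h0, h1, h3⟩ := horn₃₂.exists_desc (X := C) (yonedaEquiv.symm I.invHomId.simplex)
    (yonedaEquiv.symm (C.σ 0 f)) (yonedaEquiv.symm I.homInvId.simplex)
    (by
      rw [hδ, hδ, I.homInvId.d₁]
      exact congrArg _ (δ_comp_σ_of_gt_apply (S := C) (i := 1) (j := 0) (by decide) f))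
    (by rw [hδ, hδ, I.homInvId.d₀, I.invHomId.d₂])
    (by
      rw [hδ, hδ, I.invHomId.d₀]
      exact congrArg _ (δ_comp_σ_self_apply (S := C) 0 f).symm)
  obtain ⟨τ, hτ⟩ := Quasicategory.hornFilling (i := 2) (by decide) (by decide) φ
  have h (i : Fin 4) (hi : i ≠ 2) : stdSimplex.δ i ≫ τ = horn.ι 2 i hi ≫ φ := by
    rw [hτ, ← Category.assoc, horn.ι_ι]
  refine ⟨yonedaEquiv τ, ?_, ?_⟩
  · rw [hδ', h 1 (by decide), h1, Equiv.apply_symm_apply]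
  · rw [hδ', h 0 (by decide), h0, Equiv.apply_symm_apply]
    exact I.invHomId.d₁

end SSet

namespace NervePairing

/-- The sets which do not contain all the nonzero elements: these correspond to the simplices of the
horn `Λ[k, 0]`. -/
def ZeroHorn {k : ℕ} (s : Set (Fin (k + 1))) : Prop := ¬ ∀ i, i ≠ 0 → i ∈ s

lemma isLower_zeroHorn {k : ℕ} : IsLower (ZeroHorn (k := k)) :=
  fun _ _ h ht hs ↦ ht fun i hi ↦ h (hs i hi)

lemma zeroHorn_of_notMem {k : ℕ} {s : Set (Fin (k + 1))} {i : Fin (k + 1)} (hi : i ≠ 0)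
    (h : i ∉ s) : ZeroHorn s := fun h' ↦ h (h' i hi)

/-- The edge between the first two vertices. -/
def edge01 (k : ℕ) : (nerve (Fin (k + 2))) _⦋1⦌ :=
  simplexMk (d := 1) (fun i ↦ i.castLE (by omega)) (fun _ _ h ↦ h)

lemma zeroHorn_edge01 (m : ℕ) : ZeroHorn (supp (edge01 (m + 1))) :=
  zeroHorn_of_notMem (i := 2) (Fin.ne_of_val_ne (Nat.succ_ne_zero 1)) (by
    rintro ⟨i, hi⟩
    have := congrArg Fin.val hi
    have h2 : ((edge01 (m + 1)).obj i).val = i.val := rfl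
    have h3 : ((2 : Fin (m + 3)) : ℕ) = 2 := rfl
    have h4 : i.val < 2 := i.isLt
    omega)

/-! ### Special outer horns: combinatorics of the unfolded simplex `[m + 4]`. -/

section SpecialHorn

variable {m : ℕ}

/-- The sets which contain all the elements that are at least `4`. -/
def Full (s : Set (Fin (m + 5))) : Prop := ∀ i : Fin (m + 5), 4 ≤ i.val → i ∈ s

lemma Full.mono {s t : Set (Fin (m + 5))} (h : s ⊆ t) (hs : Full s) : Full t :=
  fun i hi ↦ h (hs i hi)

/-- The sets of elements that are smaller than `4`. -/
def Small (s : Set (Fin (m + 5))) : Prop := ∀ i ∈ s, i.val < 4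

/-- the first family on which `foldMap` is monotone -/
def FoldA (s : Set (Fin (m + 5))) : Prop := 1 ∉ s ∧ (¬ Full s ∨ 3 ∉ s)

/-- the second family on which `foldMap` is monotone -/
def FoldB (s : Set (Fin (m + 5))) : Prop := 0 ∉ s ∧ 2 ∉ s ∧ ¬ Full s

lemma isLower_small : IsLower (Small (m := m)) := fun _ _ h ht i hi ↦ ht i (h hi)

lemma isLower_foldA : IsLower (FoldA (m := m)) :=
  fun _ _ h ht ↦ ⟨fun h' ↦ ht.1 (h h'), ht.2.imp (fun h1 h2 ↦ h1 (h2.mono h)) (fun h1 h2 ↦ h1 (h h2))⟩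

lemma isLower_foldB : IsLower (FoldB (m := m)) :=
  fun _ _ h ht ↦ ⟨fun h' ↦ ht.1 (h h'), fun h' ↦ ht.2.1 (h h'), fun h' ↦ ht.2.2 (h'.mono h)⟩

/-- The map which folds `0`, `1`, `2`, `3` to `0`, `1`, `0`, `1`. -/
def foldMap (i : Fin (m + 5)) : Fin (m + 3) :=
  ⟨if i.val < 2 then i.val else i.val - 2, by split_ifs <;> omega⟩

/-- The folding descends only from `1` to `2`, so omitting either of them is enough. The two forms
of the hypothesis are those available in `FoldA` and `FoldB`. -/
lemma foldMap_monotoneOn {s : Set (Fin (m + 5))} (hs : 1 ∉ s ∨ (0 ∉ s ∧ 2 ∉ s)) :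
    MonotoneOn foldMap s := by
  intro i hi j hj hij
  have h (k : Fin (m + 5)) (hk : k ∉ s) : i.val ≠ k.val ∧ j.val ≠ k.val :=
    ⟨fun h ↦ hk (by rwa [← Fin.ext h]), fun h ↦ hk (by rwa [← Fin.ext h])⟩
  have e0 : ((0 : Fin (m + 5)) : ℕ) = 0 := rfl
  have e1 : ((1 : Fin (m + 5)) : ℕ) = 1 := rfl
  have e2 : ((2 : Fin (m + 5)) : ℕ) = 2 := rfl
  rw [Fin.le_def] at hij ⊢
  dsimp only [foldMap]
  rcases hs with h1 | ⟨h0, h2⟩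
  · have := h 1 h1
    split_ifs <;> omega
  · have := h 0 h0
    have := h 2 h2
    split_ifs <;> omega

lemma zeroHorn_foldMap {s : Set (Fin (m + 5))} (hs : ¬ Full s ∨ (1 ∉ s ∧ 3 ∉ s)) :
    ZeroHorn (foldMap '' s) := by
  rcases hs with h | ⟨h1, h3⟩
  · simp only [Full, not_forall] at h
    obtain ⟨i, hi, his⟩ := h
    refine zeroHorn_of_notMem (i := ⟨i.val - 2, by omega⟩) (by simp [Fin.ext_iff]; omega) ?_
    rintro ⟨j, hj, hji⟩
    have := congrArg Fin.val hji
    dsimp [foldMap] at this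
    exact his (by rwa [show i = j from Fin.ext (by split_ifs at this <;> omega)])
  · refine zeroHorn_of_notMem (i := 1) (by simp) ?_
    rintro ⟨j, hj, hji⟩
    have := congrArg Fin.val hji
    have e1 : ((1 : Fin (m + 3)) : ℕ) = 1 := rfl
    dsimp only [foldMap] at this
    have : j.val = 1 ∨ j.val = 3 := by split_ifs at this <;> omega
    rcases this with h | h
    · exact h1 (by rwa [show (1 : Fin (m + 5)) = j from Fin.ext h.symm])
    · exact h3 (by rwa [show (3 : Fin (m + 5)) = j from Fin.ext h.symm])

/-- The sets that are missing `3`, or an element that is at least `4`. -/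
def Spread (s : Set (Fin (m + 5))) : Prop := ¬ Full s ∨ 3 ∉ s

lemma isLower_spread : IsLower (Spread (m := m)) :=
  fun _ _ h ht ↦ ht.imp (fun h1 h2 ↦ h1 (h2.mono h)) (fun h1 h2 ↦ h1 (h h2))

/-- The sets on which a map is given at the beginning. -/
def Start (s : Set (Fin (m + 5))) : Prop := Small s ∨ FoldA s ∨ FoldB s

lemma isLower_start : IsLower (Start (m := m)) :=
  fun _ _ h ht ↦ ht.imp (isLower_small h) (Or.imp (isLower_foldA h) (isLower_foldB h))

lemma not_start_iff {s : Set (Fin (m + 5))} (hs : Spread s) : ¬ Start s ↔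
    (∃ i ∈ s, 4 ≤ i.val) ∧ 1 ∈ s ∧ (0 ∈ s ∨ 2 ∈ s ∨ Full s) := by
  simp only [Spread] at hs
  simp only [Start, Small, FoldA, FoldB, not_or, not_forall, not_lt, exists_prop]
  tauto

lemma start_le_spread {s : Set (Fin (m + 5))} (hs : Start s) : Spread s := by
  rcases hs with h | h | h
  · exact Or.inl fun h' ↦ by simpa using h ⟨4, by omega⟩ (h' ⟨4, by omega⟩ le_rfl)
  · exact h.2
  · exact Or.inl h.2.2

lemma full_insert_iff {s : Set (Fin (m + 5))} {i : Fin (m + 5)} (hi : i.val < 4) :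
    Full (insert i s) ↔ Full s := by
  refine ⟨fun h j hj ↦ (h j hj).resolve_left ?_, Full.mono (Set.subset_insert _ _)⟩
  rintro rfl
  omega

lemma full_diff_iff {s : Set (Fin (m + 5))} {i : Fin (m + 5)} (hi : i.val < 4) :
    Full (s \ {i}) ↔ Full s := by
  refine ⟨Full.mono Set.sdiff_subset, fun h j hj ↦ ⟨h j hj, ?_⟩⟩
  rintro rfl
  omega

open Classical in
/-- The element `2` or `3` that is inserted or removed in order to extend maps from the simplices
satisfying `Start` to those satisfying `Spread`. -/
noncomputable def startToggle (s : Set (Fin (m + 5))) : Fin (m + 5) :=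
  if Full s ∨ 0 ∈ s then 2 else 3

lemma startToggle_congr {s t : Set (Fin (m + 5))} (h : Full s ↔ Full t) (h' : 0 ∈ s ↔ 0 ∈ t) :
    startToggle s = startToggle t := by
  unfold startToggle
  split_ifs <;> tauto

lemma startToggle_cases (s : Set (Fin (m + 5))) :
    ((Full s ∨ 0 ∈ s) ∧ startToggle s = 2) ∨ ((¬ Full s ∧ 0 ∉ s) ∧ startToggle s = 3) := by
  by_cases h : Full s ∨ 0 ∈ s
  · exact Or.inl ⟨h, if_pos h⟩
  · exact Or.inr ⟨not_or.1 h, if_neg h⟩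

lemma val_startToggle (s : Set (Fin (m + 5))) :
    (startToggle s).val = 2 ∨ (startToggle s).val = 3 := by
  rcases startToggle_cases s with ⟨-, h⟩ | ⟨-, h⟩
  · exact Or.inl (by rw [h]; rfl)
  · exact Or.inr (by rw [h]; rfl)

lemma startToggle_ne_zero (s : Set (Fin (m + 5))) : 0 ≠ startToggle s := by
  intro h
  have := val_startToggle s
  rw [← h] at this
  simp at this

lemma startToggle_ne_one (s : Set (Fin (m + 5))) : 1 ≠ startToggle s := by
  intro h
  have := val_startToggle s
  rw [← h] at this
  simp at this

lemma two_ne_three : (2 : Fin (m + 5)) ≠ 3 := Fin.ne_of_val_ne (by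
  change 2 ≠ 3; omega)

open Classical in
/-- The matching which allows to extend maps from the simplices satisfying `Start` to those
satisfying `Spread`. -/
noncomputable def startMatching : Matching (Spread (m := m)) Start where
  e := startToggle
  -- The toggled element depends only on fullness and on the presence of `0`. A facet with another
  -- toggled element has lost one of these, and its rank drops.
  r s := if Full s then 2 else if 0 ∈ s then 1 else 0
  comparable _ _ _ := le_total _ _
  exists_lt {s} hs := by
    refine ⟨1, ((not_start_iff hs.mem).1 hs.notMem).2.1, ?_⟩
    rw [Fin.lt_def]
    have := val_startToggle s
    have e1 : ((1 : Fin (m + 5)) : ℕ) = 1 := rfl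
    omega
  exists_gt {s} hs := by
    obtain ⟨i, his, hi⟩ := ((not_start_iff hs.mem).1 hs.notMem).1
    refine ⟨i, his, ?_⟩
    rw [Fin.lt_def]
    have := val_startToggle s
    omega
  insert_mem {s} hs _ := by
    have := val_startToggle s
    have h := hs.mem
    rw [Spread, full_insert_iff (by omega)]
    rcases startToggle_cases s with ⟨-, h'⟩ | ⟨h', -⟩
    · rw [h']
      refine h.imp id fun h1 h2 ↦ h1 (h2.resolve_left two_ne_three.symm)
    · exact Or.inl h'.1
  e_insert {s} _ _ := by
    have := val_startToggle s
    exact startToggle_congr (full_insert_iff (by omega))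
      ⟨fun h ↦ h.resolve_left (startToggle_ne_zero s), Or.inr⟩
  diff_notMem {s} hs _ := by
    have h1 := val_startToggle s
    obtain ⟨⟨i, his, hi⟩, h2, h3⟩ := (not_start_iff hs.mem).1 hs.notMem
    refine (not_start_iff (isLower_spread Set.sdiff_subset hs.mem)).2 ⟨⟨i, ⟨his, ?_⟩, hi⟩,
      ⟨h2, startToggle_ne_one s⟩, ?_⟩
    · rintro rfl
      omega
    · rw [full_diff_iff (by omega)]
      rcases startToggle_cases s with ⟨h | h, h'⟩ | ⟨h, h'⟩
      · exact Or.inr (Or.inr h)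
      · exact Or.inl ⟨h, startToggle_ne_zero s⟩
      · rw [h']
        exact h3.elim (fun h4 ↦ absurd h4 h.2)
          (Or.elim · (fun h4 ↦ Or.inr (Or.inl ⟨h4, two_ne_three⟩)) fun h4 ↦ absurd h4 h.1)
  e_diff {s} _ _ := by
    have := val_startToggle s
    exact startToggle_congr (full_diff_iff (by omega))
      ⟨fun h ↦ h.1, fun h ↦ ⟨h, startToggle_ne_zero s⟩⟩
  r_lt {s} hs hes u hu hs' hes' := by
    have h1 := val_startToggle s
    set t := insert (startToggle s) s \ {u} with ht
    have het : startToggle s ∈ t := ⟨Or.inl rfl, fun h ↦ hes (by rw [h]; exact hu)⟩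
    have hne : startToggle t ≠ startToggle s := fun h ↦ hes' (by rw [h]; exact het)
    have hft : Full t → Full s := fun h ↦ (full_insert_iff (by omega)).1 (h.mono Set.sdiff_subset)
    have h0t : 0 ∈ t → 0 ∈ s := fun h ↦ h.1.resolve_left (startToggle_ne_zero s)
    by_cases hf : Full s
    · rw [if_pos hf]
      by_cases hf' : Full t
      · exact (hne ((if_pos (Or.inl hf')).trans (if_pos (Or.inl hf)).symm)).elim
      · rw [if_neg hf']
        split_ifs <;> omega
    · have hf' : ¬ Full t := fun h ↦ hf (hft h)
      rw [if_neg hf, if_neg hf']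
      by_cases h0 : 0 ∈ s
      · have h0' : 0 ∉ t := fun h ↦
          hne ((if_pos (Or.inr h)).trans (if_pos (Or.inr h0)).symm)
        rw [if_pos h0, if_neg h0']
        omega
      · have h0' : 0 ∉ t := fun h ↦ h0 (h0t h)
        exact (hne ((if_neg (not_or.2 ⟨hf', h0'⟩)).trans (if_neg (not_or.2 ⟨hf, h0⟩)).symm)).elim

/-- The sets which do not contain `2`. -/
def AvoidsTwo (s : Set (Fin (m + 5))) : Prop := 2 ∉ s

/-- The sets on which a map is given at the end. -/
def Finish (s : Set (Fin (m + 5))) : Prop := 2 ∉ s ∧ (Spread s ∨ (0 ∉ s ∧ 2 ∉ s))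

lemma isLower_avoidsTwo : IsLower (AvoidsTwo (m := m)) := fun _ _ h ht hs ↦ ht (h hs)

lemma isLower_finish : IsLower (Finish (m := m)) :=
  fun _ _ h ht ↦ ⟨fun hs ↦ ht.1 (h hs), ht.2.imp (isLower_spread h)
    fun h' ↦ ⟨fun hs ↦ h'.1 (h hs), fun hs ↦ h'.2 (h hs)⟩⟩

lemma not_finish_iff {s : Set (Fin (m + 5))} (hs : AvoidsTwo s) : ¬ Finish s ↔
    Full s ∧ 3 ∈ s ∧ 0 ∈ s := by
  simp only [AvoidsTwo] at hs
  simp only [Finish, Spread]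
  tauto

/-- The matching which allows to extend maps from the simplices satisfying `Finish` to those
satisfying `AvoidsTwo`. -/
def finishMatching : Matching (AvoidsTwo (m := m)) Finish where
  e _ := 1
  r _ := 0
  comparable _ _ _ := le_total _ _
  exists_lt hs := ⟨0, ((not_finish_iff hs.mem).1 hs.notMem).2.2, by simp⟩
  exists_gt hs := ⟨3, ((not_finish_iff hs.mem).1 hs.notMem).2.1, by
    rw [Fin.lt_def]; exact Nat.lt_of_sub_eq_succ (n := 1) (m := 3) rfl⟩
  insert_mem hs _ := fun h ↦ hs.mem (h.resolve_left (Fin.ne_of_val_ne (by change 2 ≠ 1; omega)))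
  e_insert _ _ := rfl
  diff_notMem {s} hs _ := by
    have h := (not_finish_iff hs.mem).1 hs.notMem
    refine (not_finish_iff (isLower_avoidsTwo Set.sdiff_subset hs.mem)).2
      ⟨(full_diff_iff (by simp)).2 h.1, ⟨h.2.1, Fin.ne_of_val_ne (by change 3 ≠ 1; omega)⟩,
        ⟨h.2.2, by simp⟩⟩
  e_diff _ _ := rfl
  r_lt hs hes u hu hs' hes' := (hes' ⟨Or.inl rfl, fun h ↦ hes (by rw [h]; exact hu)⟩).elim

end SpecialHorn

end NervePairing

namespace NervePairing

lemma app_congr {P : Type} [PartialOrder P] {C : SSet.{0}} {A : (nerve P).Subcomplex}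
    (a : A.toSSet ⟶ C) {d : ℕ} {x y : (nerve P) _⦋d⦌} (hx : x ∈ A.obj _) (hy : y ∈ A.obj _)
    (h : ∀ i, x.obj i = y.obj i) : a.app (op ⦋d⦌) ⟨x, hx⟩ = a.app (op ⦋d⦌) ⟨y, hy⟩ := by
  obtain rfl : x = y := nerve_ext h
  rfl

/-! ### Special outer horns: construction of the filler. -/

section SpecialHorn

variable {m : ℕ} {C : SSet.{0}}

/-- The map on the simplices satisfying `Small` that is induced by a `3`-simplex. -/
def smallMap (τ : C _⦋3⦌) : (ofSupp (Small (m := m)) isLower_small).toSSet ⟶ C :=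
  mapOfMonotoneOn (Q' := fun _ ↦ True) (hQ' := fun _ _ _ _ ↦ trivial)
    (fun i ↦ (⟨min i.val 3, by omega⟩ : Fin 4))
    (fun _ _ i _ j _ hij ↦ Fin.le_def.2 (min_le_min_right 3 hij)) (fun _ _ ↦ trivial) ≫
  (ofSupp _ _).ι ≫ ofSimplex τ

/-- Away from `1`, only the face of `τ` on `0, 2, 3` is involved. It is `σ 0` of the first edge, and
folding `0, 2, 3` to `0, 0, 1` is the same degeneracy. -/
lemma smallMap_app_of_avoids_one (h : (ofSupp (ZeroHorn (k := m + 2)) isLower_zeroHorn).toSSet ⟶ C)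
    (τ : C _⦋3⦌)
    (hτ : C.δ 1 τ = C.σ 0 (h.app (op ⦋1⦌) ⟨edge01 (m + 1), zeroHorn_edge01 m⟩)) {d : ℕ}
    (x : (nerve (Fin (m + 5))) _⦋d⦌) (hx : Small (supp x)) (hx1 : 1 ∉ supp x)
    (hm : Monotone fun i ↦ foldMap (x.obj i)) (hx' : ZeroHorn (supp (simplexMk _ hm))) :
    (smallMap τ).app (op ⦋d⦌) ⟨x, hx⟩ = h.app (op ⦋d⦌) ⟨simplexMk _ hm, hx'⟩ := by
  let z : ⦋d⦌ ⟶ ⦋3⦌ := SimplexCategory.Hom.mk ⟨fun i ↦ (⟨min (x.obj i).val 3, by omega⟩ : Fin 4),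
    fun i j hij ↦ Fin.le_def.2 (min_le_min_right 3 (x.monotone hij))⟩
  have hz : SimplexCategory.factor_δ z 1 ≫ SimplexCategory.δ 1 = z := by
    refine SimplexCategory.factor_δ_spec z 1 (fun i hi ↦ hx1 ⟨i, ?_⟩)
    have h1 := congrArg Fin.val hi
    have h2 : min (x.obj i).val 3 = 1 := h1
    exact Fin.ext (show (x.obj i).val = 1 by omega)
  change C.map z.op τ = _
  have h1 : C.map z.op τ = C.map (SimplexCategory.factor_δ z 1).op (C.δ 1 τ) := by
    conv_lhs => rw [← hz]
    rw [op_comp, C.map_comp]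
    rfl
  have h2 (e : C _⦋1⦌) : C.map (SimplexCategory.factor_δ z 1).op (C.σ 0 e) =
      C.map (SimplexCategory.factor_δ z 1 ≫ SimplexCategory.σ 0).op e := by
    rw [op_comp, C.map_comp]
    rfl
  rw [h1, hτ, h2]
  refine (NatTrans.naturality_apply h _ _).symm.trans ?_
  refine app_congr h _ hx' (fun i ↦ Fin.ext ?_)
  have hv : (((SimplexCategory.factor_δ z 1).toOrderHom i : Fin 3) : ℕ) =
      if (x.obj i).val = 0 then 0 else (x.obj i).val - 1 := by
    have h3 := congrArg (fun f : ⦋d⦌ ⟶ ⦋3⦌ ↦ (f.toOrderHom i).val) hz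
    change (Fin.succAbove (1 : Fin 4) _ : Fin 4).val = min (x.obj i).val 3 at h3
    have h4 := hx (x.obj i) ⟨i, rfl⟩
    have h5 : (x.obj i).val ≠ 1 := fun h ↦ hx1 ⟨i, Fin.ext h⟩
    have h6 : ∀ y : Fin 3, (Fin.succAbove (1 : Fin 4) y).val =
      if y.val = 0 then 0 else y.val + 1 := by decide
    rw [h6] at h3
    change (if ((SimplexCategory.factor_δ z 1).toOrderHom i).val = 0 then 0 else
      ((SimplexCategory.factor_δ z 1).toOrderHom i).val + 1) = _ at h3
    split_ifs at h3 ⊢ <;> omega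
  change ((Fin.predAbove (0 : Fin 2) ((SimplexCategory.factor_δ z 1).toOrderHom i : Fin 3) : Fin 2) : ℕ) =
    (foldMap (x.obj i)).val
  dsimp only [foldMap]
  have h4 := hx (x.obj i) ⟨i, rfl⟩
  have h5 : (x.obj i).val ≠ 1 := fun h ↦ hx1 ⟨i, Fin.ext h⟩
  have h6 : ∀ y : Fin 3, (Fin.predAbove (0 : Fin 2) y).val = y.val - 1 := by decide
  rw [h6, hv]
  split_ifs <;> omega

/-- Only the edge of `τ` from `1` to `3` is involved. It is degenerate, and the folding sends both
`1` and `3` to `1`. -/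
lemma smallMap_app_of_avoids_zero_two
    (h : (ofSupp (ZeroHorn (k := m + 2)) isLower_zeroHorn).toSSet ⟶ C) (τ : C _⦋3⦌)
    (hτ : C.δ 1 (C.δ 0 τ) =
      C.σ 0 (C.δ 0 (h.app (op ⦋1⦌) ⟨edge01 (m + 1), zeroHorn_edge01 m⟩))) {d : ℕ}
    (x : (nerve (Fin (m + 5))) _⦋d⦌) (hx : Small (supp x)) (hx0 : 0 ∉ supp x) (hx2 : 2 ∉ supp x)
    (hm : Monotone fun i ↦ foldMap (x.obj i)) (hx' : ZeroHorn (supp (simplexMk _ hm))) :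
    (smallMap τ).app (op ⦋d⦌) ⟨x, hx⟩ = h.app (op ⦋d⦌) ⟨simplexMk _ hm, hx'⟩ := by
  let w : ⦋d⦌ ⟶ ⦋1⦌ := SimplexCategory.Hom.mk ⟨fun i ↦ (⟨min ((x.obj i).val / 3) 1, by omega⟩ : Fin 2),
    fun i j hij ↦ Fin.le_def.2 (min_le_min_right 1 (Nat.div_le_div_right (x.monotone hij)))⟩
  let z : ⦋d⦌ ⟶ ⦋3⦌ := SimplexCategory.Hom.mk ⟨fun i ↦ (⟨min (x.obj i).val 3, by omega⟩ : Fin 4),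
    fun i j hij ↦ Fin.le_def.2 (min_le_min_right 3 (x.monotone hij))⟩
  have hv (i : Fin (d + 1)) : (x.obj i).val = 1 ∨ (x.obj i).val = 3 := by
    have h4 := hx (x.obj i) ⟨i, rfl⟩
    have h5 : (x.obj i).val ≠ 0 := fun h ↦ hx0 ⟨i, Fin.ext h⟩
    have h6 : (x.obj i).val ≠ 2 := fun h ↦ hx2 ⟨i, Fin.ext h⟩
    omega
  have hz : w ≫ SimplexCategory.δ 1 ≫ SimplexCategory.δ 0 = z := by
    ext i
    change (Fin.succAbove (0 : Fin 4) (Fin.succAbove (1 : Fin 3) (⟨min ((x.obj i).val / 3) 1, _⟩ : Fin 2))).val =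
      min (x.obj i).val 3
    rcases hv i with h | h <;> simp [h, Fin.succAbove]
  change C.map z.op τ = _
  have h1 : C.map z.op τ = C.map w.op (C.δ 1 (C.δ 0 τ)) := by
    rw [← hz, op_comp, op_comp, C.map_comp, C.map_comp]
    rfl
  have h2 (e : C _⦋1⦌) : C.map w.op (C.σ 0 (C.δ 0 e)) =
      C.map (w ≫ SimplexCategory.σ 0 ≫ SimplexCategory.δ 0).op e := by
    rw [op_comp, op_comp, C.map_comp, C.map_comp]
    rfl
  rw [h1, hτ, h2]
  refine (NatTrans.naturality_apply h _ _).symm.trans ?_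
  refine app_congr h _ hx' (fun i ↦ Fin.ext ?_)
  change (Fin.succAbove (0 : Fin 2) (Fin.predAbove (0 : Fin 1) (⟨min ((x.obj i).val / 3) 1, _⟩ : Fin 2)) : Fin 2).val =
    (foldMap (x.obj i)).val
  dsimp only [foldMap]
  rcases hv i with h | h <;> simp [h]

/-- The map which sends `3` to `1`. -/
def collapse (i : Fin (m + 5)) : Fin (m + 5) := if i.val = 3 then 1 else i

lemma val_collapse (i : Fin (m + 5)) : (collapse i).val = if i.val = 3 then 1 else i.val := by
  dsimp [collapse]
  split_ifs <;> rfl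

lemma foldMap_collapse (i : Fin (m + 5)) : foldMap (collapse i) = foldMap i := by
  apply Fin.ext
  dsimp only [foldMap]
  rw [val_collapse]
  split_ifs <;> omega

/-- The condition for sets that they do not contain `0` and `2`. -/
def AvoidsZeroTwo (s : Set (Fin (m + 5))) : Prop := 0 ∉ s ∧ 2 ∉ s

lemma isLower_avoidsZeroTwo : IsLower (AvoidsZeroTwo (m := m)) :=
  fun _ _ h ht ↦ ⟨fun hs ↦ ht.1 (h hs), fun hs ↦ ht.2 (h hs)⟩

lemma notMem_of_forall_val_ne {s : Set (Fin (m + 5))} (k : Fin (m + 5))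
    (h : ∀ i ∈ s, i.val ≠ k.val) : k ∉ s := fun hk ↦ h k hk rfl

lemma monotoneOn_collapse {s : Set (Fin (m + 5))} (hs : AvoidsZeroTwo s) :
    MonotoneOn collapse s := by
  intro i hi j hj hij
  have h2 : i.val ≠ 2 := fun h ↦ hs.2 (by rwa [show (2 : Fin (m + 5)) = i from Fin.ext h.symm])
  have h0 : i.val ≠ 0 := fun h ↦ hs.1 (by rwa [show (0 : Fin (m + 5)) = i from Fin.ext h.symm])
  rw [Fin.le_def] at hij ⊢
  rw [val_collapse, val_collapse]
  split_ifs <;> omega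

lemma spread_collapse (s : Set (Fin (m + 5))) : Spread (collapse '' s) := by
  refine Or.inr (notMem_of_forall_val_ne _ ?_)
  rintro _ ⟨i, hi, rfl⟩
  rw [val_collapse]
  change _ ≠ 3
  split_ifs <;> omega

lemma foldB_collapse {s : Set (Fin (m + 5))} (hs : FoldB s) : FoldB (collapse '' s) := by
  have h2 (i) (hi : i ∈ s) : i.val ≠ 2 :=
    fun h ↦ hs.2.1 (by rwa [show (2 : Fin (m + 5)) = i from Fin.ext h.symm])
  have h0 (i) (hi : i ∈ s) : i.val ≠ 0 :=
    fun h ↦ hs.1 (by rwa [show (0 : Fin (m + 5)) = i from Fin.ext h.symm])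
  refine ⟨notMem_of_forall_val_ne _ ?_, notMem_of_forall_val_ne _ ?_, fun h ↦ hs.2.2 fun i hi ↦ ?_⟩
  · rintro _ ⟨i, hi, rfl⟩
    rw [val_collapse]
    change _ ≠ 0
    have := h0 i hi
    split_ifs <;> omega
  · rintro _ ⟨i, hi, rfl⟩
    rw [val_collapse]
    change _ ≠ 2
    have := h2 i hi
    split_ifs <;> omega
  · obtain ⟨j, hj, hji⟩ := h i hi
    have := congrArg Fin.val hji
    rw [val_collapse] at this
    rwa [show i = j from Fin.ext (by split_ifs at this <;> omega)]

/-- The section of `foldMap` which avoids `1` and `2`. -/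
def unfoldMap (i : Fin (m + 3)) : Fin (m + 5) :=
  ⟨if i.val = 0 then 0 else i.val + 2, by split_ifs <;> omega⟩

lemma foldMap_unfoldMap (i : Fin (m + 3)) : foldMap (unfoldMap i) = i := by
  apply Fin.ext
  dsimp only [foldMap, unfoldMap]
  split_ifs <;> omega

lemma monotone_unfoldMap : Monotone (unfoldMap (m := m)) := by
  intro i j hij
  rw [Fin.le_def] at hij ⊢
  dsimp only [unfoldMap]
  split_ifs <;> omega

lemma avoids_unfoldMap {s : Set (Fin (m + 3))} : 1 ∉ unfoldMap '' s ∧ 2 ∉ unfoldMap '' s := by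
  constructor <;> refine notMem_of_forall_val_ne _ ?_
  · rintro _ ⟨i, hi, rfl⟩
    dsimp only [unfoldMap]
    change _ ≠ 1
    split_ifs <;> omega
  · rintro _ ⟨i, hi, rfl⟩
    dsimp only [unfoldMap]
    change _ ≠ 2
    split_ifs <;> omega

lemma spread_unfoldMap {s : Set (Fin (m + 3))} (hs : ZeroHorn s) : Spread (unfoldMap '' s) := by
  simp only [ZeroHorn, not_forall] at hs
  obtain ⟨i, hi, his⟩ := hs
  have hi' : i.val ≠ 0 := fun h ↦ hi (Fin.ext h)
  have key : unfoldMap i ∉ unfoldMap '' s := by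
    rintro ⟨j, hj, hji⟩
    have := congrArg foldMap hji
    rw [foldMap_unfoldMap, foldMap_unfoldMap] at this
    exact his (this ▸ hj)
  have hv : (unfoldMap i).val = i.val + 2 := if_neg hi'
  by_cases h : i.val = 1
  · right
    rwa [show (3 : Fin (m + 5)) = unfoldMap i from Fin.ext (by rw [hv, h]; rfl)]
  · left
    exact fun h' ↦ key (h' _ (by omega))

/-- A map to a quasi-category from the horn `Λ[m + 2, 0]` which sends the first edge to
an invertible edge extends to the simplex. -/
theorem exists_extension_zeroHorn [SSet.Quasicategory C]
    (h : (ofSupp (ZeroHorn (k := m + 2)) isLower_zeroHorn).toSSet ⟶ C)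
    (hinv : SSet.IsInvertible (h.app (op ⦋1⦌) ⟨edge01 (m + 1), zeroHorn_edge01 m⟩)) :
    ∃ g : nerve (Fin (m + 3)) ⟶ C, ∀ ⦃d : ℕ⦄ (x : (nerve (Fin (m + 3))) _⦋d⦌)
      (hx : ZeroHorn (supp x)), g.app _ x = h.app (op ⦋d⦌) ⟨x, hx⟩ := by
  -- The first edge is unfolded into the tetrahedron `τ`, so that the vertices `0, 1, 2, 3` carry
  -- its source, target, source and target. The given horn will be found on the vertices `0, 3, 4,
  -- …`.
  obtain ⟨τ, hτ1, hτ0⟩ := hinv.exists_tetrahedron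
  let aA : (ofSupp (FoldA (m := m)) isLower_foldA).toSSet ⟶ C :=
    mapOfMonotoneOn foldMap (fun s hs ↦ foldMap_monotoneOn (Or.inl hs.1))
      (fun s hs ↦ zeroHorn_foldMap (hs.2.imp id fun h3 ↦ ⟨hs.1, h3⟩)) ≫ h
  let aB : (ofSupp (FoldB (m := m)) isLower_foldB).toSSet ⟶ C :=
    mapOfMonotoneOn foldMap (fun s hs ↦ foldMap_monotoneOn (Or.inr ⟨hs.1, hs.2.1⟩))
      (fun s hs ↦ zeroHorn_foldMap (Or.inl hs.2.2)) ≫ h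
  obtain ⟨c₁, hA, hB⟩ := SSet.Subcomplex.exists_glue _ _ aA aB (fun d x _ _ ↦ rfl)
  obtain ⟨c₂, hτ, hc₂⟩ := SSet.Subcomplex.exists_glue _ _ (smallMap (m := m) τ) c₁ (by
    rintro d x hx (hx' | hx')
    · refine Eq.trans ?_ (hA x hx').symm
      exact smallMap_app_of_avoids_one h τ hτ1 x hx hx'.1 _ _
    · refine Eq.trans ?_ (hB x hx').symm
      exact smallMap_app_of_avoids_zero_two h τ hτ0 x hx hx'.1 hx'.2.1 _ _)
  -- Among the new simplices, `{1, 2, 4, …}` composes the inverse edge with a face of the horn, and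
  -- its face `{1, 4, …}` plays the role of the missing face opposite to `0`.
  obtain ⟨b, hb⟩ := (startMatching (m := m)).exists_extension isLower_spread isLower_start
    (fun s ↦ start_le_spread) (SSet.Subcomplex.homOfLE (fun d x hx ↦ hx) ≫ c₂)
  have hbA {d : ℕ} (x : (nerve (Fin (m + 5))) _⦋d⦌) (hx : FoldA (supp x)) (hx') :
      b.app (op ⦋d⦌) ⟨x, hx'⟩ = aA.app _ ⟨x, hx⟩ :=
    (hb x (Or.inr (Or.inl hx))).trans ((hc₂ x (Or.inl hx)).trans (hA x hx))
  have hbB {d : ℕ} (x : (nerve (Fin (m + 5))) _⦋d⦌) (hx : FoldB (supp x)) (hx') :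
      b.app (op ⦋d⦌) ⟨x, hx'⟩ = aB.app _ ⟨x, hx⟩ :=
    (hb x (Or.inr (Or.inr hx))).trans ((hc₂ x (Or.inr hx)).trans (hB x hx))
  -- Reading `3` as `1` transports this missing face to `{3, 4, …}` and, degenerately, to `{1, 3, 4,
  -- …}`.
  let aD : (ofSupp (AvoidsZeroTwo (m := m)) isLower_avoidsZeroTwo).toSSet ⟶ C :=
    mapOfMonotoneOn collapse (fun s hs ↦ monotoneOn_collapse hs) (fun s _ ↦ spread_collapse s) ≫ b
  obtain ⟨c₃, hb₃, hD₃⟩ := SSet.Subcomplex.exists_glue _ _ b aD (by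
    intro d x hx hx'
    by_cases h3 : 3 ∈ supp x
    · have hB : FoldB (supp x) := ⟨hx'.1, hx'.2, hx.resolve_right (fun h ↦ h h3)⟩
      rw [hbB x hB]
      refine Eq.trans ?_ (hbB _ ?_ _).symm
      · exact app_congr h _ _ (fun i ↦ (foldMap_collapse _).symm)
      · have := foldB_collapse hB
        rw [supp, ← Set.range_comp] at this
        exact this
    · refine app_congr b _ _ (fun i ↦ Fin.ext ?_)
      refine Eq.trans ?_ (val_collapse _).symm
      rw [if_neg]
      exact fun h ↦ h3 ⟨i, Fin.ext h⟩)
  -- What remains are the simplices containing `0`, `3` and all of `4, …`. They are filled by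
  -- toggling `1`, which is an inner vertex.
  obtain ⟨b', hb'⟩ := (finishMatching (m := m)).exists_extension isLower_avoidsTwo isLower_finish
    (fun s hs ↦ hs.1) (SSet.Subcomplex.homOfLE (S₁ := ofSupp Finish isLower_finish)
      (S₂ := ofSupp Spread isLower_spread ⊔ ofSupp AvoidsZeroTwo isLower_avoidsZeroTwo)
      (fun d x hx ↦ hx.2) ≫ c₃)
  -- The vertices `0, 3, 4, …` now span the desired filler.
  let u : nerve (Fin (m + 3)) ⟶ (ofSupp (AvoidsTwo (m := m)) isLower_avoidsTwo).toSSet :=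
    SSet.Subcomplex.lift (nerveMap monotone_unfoldMap.functor) (by
      rintro ⟨⟨d⟩⟩ _ ⟨x, rfl⟩
      have := (avoids_unfoldMap (s := supp x)).2
      rw [supp, ← Set.range_comp] at this
      exact this)
  refine ⟨u ≫ b', fun d x hx ↦ ?_⟩
  have e : supp ((nerveMap monotone_unfoldMap.functor).app (op ⦋d⦌) x) = unfoldMap '' supp x := by
    conv_rhs => rw [supp, ← Set.range_comp]
    rfl
  have hav := avoids_unfoldMap (s := supp x)
  have hsp := spread_unfoldMap hx
  rw [← e] at hav hsp
  refine (hb' _ ⟨hav.2, Or.inl hsp⟩).trans ?_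
  refine (hb₃ _ hsp).trans ?_
  refine (hbA _ ⟨hav.1, hsp⟩ _).trans ?_
  exact app_congr h _ _ (fun i ↦ foldMap_unfoldMap _)

end SpecialHorn

end NervePairing

/-! ### Extension of natural transformations along the boundary of a simplex -/

namespace NervePairing

section Prism

variable {m : ℕ}

/-- The poset `[1] × [m + 1]`. -/
def Prism (m : ℕ) : Type := Fin 2 × Fin (m + 2)

instance : PartialOrder (Prism m) := inferInstanceAs (PartialOrder (Fin 2 × Fin (m + 2)))

/-- The simplices of `Δ^1 × ∂Δ^{m+1}` and of `{0} × Δ^{m+1}`. -/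
def PrismStart (s : Set (Prism m)) : Prop := (∃ j, ∀ p ∈ s, p.2 ≠ j) ∨ ∀ p ∈ s, p.1 = 0

/-- The simplices which do not contain `{1} × Δ^{m+1}`. -/
def PrismOpen (s : Set (Prism m)) : Prop := ∃ j, (1, j) ∉ s

/-- The simplices of the prism whose vertices different from `(0, 0)` are in `{1} × Δ^{m+1}`. -/
def PrismTop (s : Set (Prism m)) : Prop := ∀ p ∈ s, p.1 = 0 → p.2 = 0

lemma isLower_prismStart : IsLower (PrismStart (m := m)) := fun _ _ h ht ↦
  ht.imp (fun ⟨j, hj⟩ ↦ ⟨j, fun p hp ↦ hj p (h hp)⟩) fun h' p hp ↦ h' p (h hp)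

lemma isLower_prismOpen : IsLower (PrismOpen (m := m)) := fun _ _ h ⟨j, hj⟩ ↦ ⟨j, fun hs ↦ hj (h hs)⟩

lemma isLower_prismTop : IsLower (PrismTop (m := m)) := fun _ _ h ht p hp ↦ ht p (h hp)

lemma prismOpen_of_prismStart {s : Set (Prism m)} (hs : PrismStart s) : PrismOpen s := by
  rcases hs with ⟨j, hj⟩ | h
  · exact ⟨j, fun h ↦ hj _ h rfl⟩
  · exact ⟨0, fun h' ↦ by simpa using h _ h'⟩

/-- Such a chain contains `(1, 0)`, and `(0, 0)` is the only element of the bottom row comparable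
with it. -/
lemma prismTop_of_not_prismOpen {s : Set (Prism m)} (hc : IsChain (· ≤ ·) s)
    (hs : ¬ PrismOpen s) : PrismTop s := by
  intro p hp hp0
  simp only [PrismOpen, not_exists, not_not] at hs
  rcases hc.total hp (hs 0) with h | h
  · exact le_antisymm h.2 (Fin.zero_le _)
  · have := h.1
    rw [hp0] at this
    simp at this

open Classical in
/-- The smallest `i` such that `(1, i)` belongs to a set. -/
noncomputable def firstTop (s : Set (Prism m)) : Fin (m + 2) :=
  if h : ∃ i, IsLeast {j | (1, j) ∈ s} i then h.choose else 0

lemma firstTop_eq {s : Set (Prism m)} {i : Fin (m + 2)} (hi : IsLeast {j | (1, j) ∈ s} i) :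
    firstTop s = i := by
  have h : ∃ i, IsLeast {j | (1, j) ∈ s} i := ⟨i, hi⟩
  rw [firstTop, dif_pos h]
  exact h.choose_spec.unique hi

/-- A missing chain meets every column and reaches the top row, so it follows the bottom row up to
some column `i` and the top row from there on. If `i = 0`, the whole top row would be present,
against `PrismOpen`. -/
lemma firstTop_spec {s : Set (Prism m)} (hs : IsMissing PrismOpen PrismStart s) :
    ∃ i : Fin (m + 2), IsLeast {j | (1, j) ∈ s} i ∧ i ≠ 0 ∧ (∀ j < i, (0, j) ∈ s) ∧
      (∀ j > i, (0, j) ∉ s ∧ (1, j) ∈ s) := by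
  have hn := hs.notMem
  simp only [PrismStart, not_or, not_exists, not_forall, not_not, exists_prop] at hn
  obtain ⟨h1, p, hp, hp1⟩ := hn
  have hp' : (1, p.2) ∈ s := by
    rwa [show ((1 : Fin 2), p.2) = p from Prod.ext (Fin.eq_one_of_ne_zero _ hp1).symm rfl]
  obtain ⟨i, hi⟩ : ∃ i, IsLeast {j | (1, j) ∈ s} i := by
    obtain ⟨i, hi⟩ := (Set.toFinite {j | (1, j) ∈ s}).exists_minimal ⟨_, hp'⟩
    exact ⟨i, hi.1, fun j hj ↦ (le_total i j).elim id fun h ↦ hi.2 hj h⟩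
  have hlow (j) (hj : j < i) : (0, j) ∈ s := by
    obtain ⟨q, hq, rfl⟩ := h1 j
    by_cases h : q.1 = 0
    · rwa [← h]
    · exact absurd (hi.2 (show (1, q.2) ∈ s by rwa [← Fin.eq_one_of_ne_zero _ h])) (not_le.2 hj)
  have hhigh (j) (hj : i < j) : (0, j) ∉ s := by
    intro h
    rcases hs.isChain.total h hi.1 with h | h
    · exact absurd h.2 (not_le.2 hj)
    · simpa using h.1
  have hhigh' (j) (hj : i < j) : (1, j) ∈ s := by
    obtain ⟨q, hq, rfl⟩ := h1 j
    by_cases h : q.1 = 0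
    · exact absurd (by rwa [← h]) (hhigh _ hj)
    · rwa [← Fin.eq_one_of_ne_zero _ h]
  refine ⟨i, hi, ?_, hlow, fun j hj ↦ ⟨hhigh j hj, hhigh' j hj⟩⟩
  rintro rfl
  obtain ⟨j, hj⟩ := hs.mem
  by_cases h : j = 0
  · subst h
    exact hj hi.1
  · exact hj (hhigh' j (Fin.pos_of_ne_zero h))

lemma isLeast_top_congr {s t : Set (Prism m)} {i : Fin (m + 2)}
    (hi : IsLeast {j | (1, j) ∈ s} i) (h : ∀ j, (1, j) ∈ t ↔ (1, j) ∈ s) :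
    IsLeast {j | (1, j) ∈ t} i := by
  simpa only [h] using hi

/-- The matching which inserts or removes the elements `(0, i)` where `i` is the smallest element
such that `(1, i)` is a vertex. -/
noncomputable def prismMatching : Matching (PrismOpen (m := m)) PrismStart where
  e s := (0, firstTop s)
  -- Deleting a vertex can only move the crossing column to the right, and if it does not move, the
  -- toggled element is still there.
  r s := m + 1 - (firstTop s).val
  comparable {s} hs u hu := by
    obtain ⟨i, hi, h0, hlow, hhigh⟩ := firstTop_spec hs
    rw [firstTop_eq hi]
    by_cases h : u.1 = 0
    · rcases le_total u.2 i with h' | h'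
      · exact Or.inl ⟨h.le, h'⟩
      · exact Or.inr ⟨Fin.zero_le _, h'⟩
    · exact Or.inr ⟨Fin.zero_le _, hi.2 (show (1, u.2) ∈ s by
        rwa [← Fin.eq_one_of_ne_zero _ h])⟩
  exists_lt {s} hs := by
    obtain ⟨i, hi, h0, hlow, hhigh⟩ := firstTop_spec hs
    rw [firstTop_eq hi]
    exact ⟨(0, 0), hlow 0 (Fin.pos_of_ne_zero h0), Prod.mk_lt_mk_iff_right.2 (Fin.pos_of_ne_zero h0)⟩
  exists_gt {s} hs := by
    obtain ⟨i, hi, h0, hlow, hhigh⟩ := firstTop_spec hs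
    rw [firstTop_eq hi]
    exact ⟨(1, i), hi.1, Prod.mk_lt_mk_iff_left.2 (by simp)⟩
  insert_mem {s} hs _ := by
    obtain ⟨j, hj⟩ := hs.mem
    exact ⟨j, fun h ↦ h.elim (fun h ↦ by simpa using congrArg Prod.fst h) hj⟩
  e_insert {s} hs _ := by
    obtain ⟨i, hi, h0, hlow, hhigh⟩ := firstTop_spec hs
    rw [firstTop_eq hi, firstTop_eq (isLeast_top_congr hi fun j ↦
      ⟨fun h ↦ h.elim (fun h ↦ by simpa using congrArg Prod.fst h) id, Or.inr⟩)]
  diff_notMem {s} hs _ := by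
    obtain ⟨i, hi, h0, hlow, hhigh⟩ := firstTop_spec hs
    rw [firstTop_eq hi]
    have hi1 : (1, i) ∈ s := hi.1
    rintro (⟨j, hj⟩ | h)
    · rcases lt_trichotomy j i with h | rfl | h
      · exact hj (0, j) ⟨hlow j h, fun h' ↦ h.ne (congrArg Prod.snd h')⟩ rfl
      · exact hj (1, j) ⟨hi1, fun h' ↦ by simpa using congrArg Prod.fst h'⟩ rfl
      · exact hj (1, j) ⟨(hhigh j h).2, fun h' ↦ by simpa using congrArg Prod.fst h'⟩ rfl
    · simpa using h (1, i) ⟨hi1, fun h' ↦ by simpa using congrArg Prod.fst h'⟩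
  e_diff {s} hs _ := by
    obtain ⟨i, hi, h0, hlow, hhigh⟩ := firstTop_spec hs
    have : IsLeast {j | (1, j) ∈ s \ {(0, i)}} i := isLeast_top_congr hi fun j ↦
      ⟨fun h ↦ h.1, fun h ↦ ⟨h, fun h' ↦ by simpa using congrArg Prod.fst h'⟩⟩
    rw [firstTop_eq hi]
    exact congrArg (fun t ↦ ((0, t) : Prism m)) (firstTop_eq this)
  r_lt {s} hs hes u hu hs' hes' := by
    obtain ⟨i, hi, h0, hlow, hhigh⟩ := firstTop_spec hs
    obtain ⟨i', hi', h0', hlow', hhigh'⟩ := firstTop_spec hs'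
    rw [firstTop_eq hi'] at hes' ⊢
    rw [firstTop_eq hi] at hes hes' ⊢
    have h1 : (1, i') ∈ s :=
      hi'.1.1.resolve_left (fun h ↦ by simpa using congrArg Prod.fst h)
    have h2 : i ≤ i' := hi.2 h1
    have h3 : i ≠ i' := by
      rintro rfl
      exact hes' ⟨Or.inl rfl, fun h ↦ hes (by rw [h]; exact hu)⟩
    have := lt_of_le_of_ne h2 h3
    rw [Fin.lt_def] at this
    omega

/-- The inclusion in the prism of the simplex with vertices `(0, 0)`, `(1, 0)`, …,
`(1, m + 1)`. -/
def topIncl (i : Fin (m + 3)) : Prism m :=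
  (⟨min i.val 1, by omega⟩, ⟨i.val - 1, by omega⟩)

/-- The retraction of `topIncl`. -/
def topRetr (p : Prism m) : Fin (m + 3) := ⟨if p.1 = 0 then 0 else p.2.val + 1, by
  split_ifs <;> omega⟩

lemma monotone_topIncl : Monotone (topIncl (m := m)) := fun _ _ h ↦
  ⟨Fin.le_def.2 (min_le_min_right 1 h), Fin.le_def.2 (Nat.sub_le_sub_right h 1)⟩

lemma monotone_topRetr : Monotone (topRetr (m := m)) := fun p q h ↦ by
  rw [Fin.le_def]
  dsimp only [topRetr]
  have h1 := Fin.le_def.1 h.1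
  have h2 := Fin.le_def.1 h.2
  simp only [Fin.ext_iff, Fin.val_zero]
  split_ifs <;> omega

lemma topIncl_topRetr {p : Prism m} (hp : p.1 = 0 → p.2 = 0) : topIncl (topRetr p) = p := by
  obtain ⟨a, b⟩ := p
  by_cases h : a = 0
  · obtain rfl : b = 0 := hp h
    subst h
    rfl
  · obtain rfl := Fin.eq_one_of_ne_zero _ h
    refine Prod.ext (Fin.ext ?_) (Fin.ext ?_)
    · change min (b.val + 1) 1 = 1
      omega
    · rfl

lemma prismOpen_topIncl {s : Set (Fin (m + 3))} (hs : ZeroHorn s) : PrismOpen (topIncl '' s) := by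
  simp only [ZeroHorn, not_forall] at hs
  obtain ⟨i, hi, his⟩ := hs
  have hi' : i.val ≠ 0 := fun h ↦ hi (Fin.ext h)
  refine ⟨⟨i.val - 1, by omega⟩, ?_⟩
  rintro ⟨j, hj, hji⟩
  have h1 := congrArg (Fin.val ∘ Prod.fst) hji
  have h2 := congrArg (Fin.val ∘ Prod.snd) hji
  simp only [topIncl, Function.comp_apply, Fin.val_one] at h1 h2
  exact his (by rwa [show i = j from Fin.ext (by omega)])

lemma zeroHorn_topRetr {s : Set (Prism m)} (hs : PrismOpen s) : ZeroHorn (topRetr '' s) := by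
  obtain ⟨j, hj⟩ := hs
  refine zeroHorn_of_notMem (i := j.succ) (Fin.succ_ne_zero _) ?_
  rintro ⟨p, hp, hpj⟩
  have h1 : (if p.1 = 0 then 0 else p.2.val + 1) = j.val + 1 := congrArg Fin.val hpj
  by_cases h : p.1 = 0
  · rw [if_pos h] at h1
    omega
  · rw [if_neg h] at h1
    exact hj (by rwa [show (1, j) = p from
      Prod.ext (Fin.eq_one_of_ne_zero _ h).symm (Fin.ext (by change j.val = p.2.val; omega))])

/-- The edge from `(0, 0)` to `(1, 0)`. -/
def prismEdge (m : ℕ) : (nerve (Prism m)) _⦋1⦌ :=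
  simplexMk (d := 1) (fun i ↦ (i, 0)) (fun _ _ h ↦ ⟨h, le_rfl⟩)

lemma prismStart_prismEdge : PrismStart (supp (prismEdge m)) := by
  refine Or.inl ⟨1, ?_⟩
  rintro _ ⟨i, rfl⟩
  change (0 : Fin (m + 2)) ≠ 1
  simp

lemma image_supp {P P' : Type} [PartialOrder P] [PartialOrder P'] {u : P → P'} (hu : Monotone u)
    {d : ℕ} (x : (nerve P) _⦋d⦌) :
    supp ((nerveMap hu.functor).app (op ⦋d⦌) x) = u '' supp x := by
  conv_rhs => rw [supp, ← Set.range_comp]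
  rfl

/-- Inner anodyne extensions reach all nondegenerate simplices except the one on `(0, 0), (1, 0), …,
(1, m + 1)` and its face opposite to `(0, 0)`. These two fill a horn `Λ[m + 2, 0]` whose first edge
is the invertible one. -/
theorem exists_extension_prism {C : SSet.{0}} [SSet.Quasicategory C]
    (a : (ofSupp (PrismStart (m := m)) isLower_prismStart).toSSet ⟶ C)
    (ha : SSet.IsInvertible (a.app (op ⦋1⦌) ⟨prismEdge m, prismStart_prismEdge⟩)) :
    ∃ g : nerve (Prism m) ⟶ C, ∀ ⦃d : ℕ⦄ (x : (nerve (Prism m)) _⦋d⦌)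
      (hx : PrismStart (supp x)), g.app _ x = a.app (op ⦋d⦌) ⟨x, hx⟩ := by
  obtain ⟨b, hb⟩ := (prismMatching (m := m)).exists_extension isLower_prismOpen
    isLower_prismStart (fun _ ↦ prismOpen_of_prismStart) a
  let h : (ofSupp (ZeroHorn (k := m + 2)) isLower_zeroHorn).toSSet ⟶ C :=
    mapOfMonotoneOn topIncl (fun _ _ ↦ monotone_topIncl.monotoneOn _)
      (fun _ ↦ prismOpen_topIncl) ≫ b
  obtain ⟨g, hg⟩ := exists_extension_zeroHorn h (by
    convert ha using 1
    refine Eq.trans ?_ (hb (prismEdge m) prismStart_prismEdge)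
    refine app_congr b _ _ (fun i ↦ ?_)
    change Fin 2 at i
    fin_cases i <;> rfl)
  let aR : (ofSupp (PrismTop (m := m)) isLower_prismTop).toSSet ⟶ C :=
    (ofSupp _ _).ι ≫ nerveMap monotone_topRetr.functor ≫ g
  obtain ⟨c, hcb, -⟩ := SSet.Subcomplex.exists_glue _ _ b aR (by
    intro d x hx hx'
    have hz : ZeroHorn (supp ((nerveMap monotone_topRetr.functor).app (op ⦋d⦌) x)) := by
      rw [image_supp]
      exact zeroHorn_topRetr hx
    refine Eq.trans ?_ (hg _ hz).symm
    exact app_congr b _ _ (fun i ↦ (topIncl_topRetr (hx' _ ⟨i, rfl⟩)).symm))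
  let u : nerve (Prism m) ⟶ (ofSupp (PrismOpen (m := m)) isLower_prismOpen ⊔
      ofSupp (PrismTop (m := m)) isLower_prismTop).toSSet :=
    SSet.Subcomplex.lift (𝟙 _) (by
      rintro ⟨⟨d⟩⟩ _ ⟨x, rfl⟩
      by_cases h : PrismOpen (supp x)
      · exact Or.inl h
      · exact Or.inr (prismTop_of_not_prismOpen (isChain_supp x) h))
  refine ⟨u ≫ c, fun d x hx ↦ ?_⟩
  exact (hcb x (prismOpen_of_prismStart hx)).trans (hb x hx)

end Prism

end NervePairing

/-! ### Pointwise invertible homotopies -/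

namespace SSet

/-- The edge of `C` given by a homotopy and a vertex of its source. -/
def homotopyEdge {X C : SSet.{0}} (H : X ⊗ Δ[1] ⟶ C) (x : X _⦋0⦌) : C _⦋1⦌ :=
  H.app (op ⦋1⦌) (X.σ 0 x, yonedaEquiv (𝟙 Δ[1]))

/-- A homotopy is pointwise invertible if it sends the vertices to invertible edges. -/
def IsPointwiseInvertible {X C : SSet.{0}} (H : X ⊗ Δ[1] ⟶ C) : Prop :=
  ∀ x, IsInvertible (homotopyEdge H x)

lemma homotopyEdge_whiskerRight {X Y C : SSet.{0}} (f : X ⟶ Y) (H : Y ⊗ Δ[1] ⟶ C) (x : X _⦋0⦌) :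
    homotopyEdge (f ▷ Δ[1] ≫ H) x = homotopyEdge H (f.app _ x) := by
  dsimp only [homotopyEdge]
  rw [← σ_naturality_apply]
  rfl

lemma IsInvertible.map {C D : SSet.{0}} {e : C _⦋1⦌} (he : IsInvertible e) (f : C ⟶ D) :
    IsInvertible (f.app _ e) := ⟨(he.some.map f).ofEq rfl⟩

lemma isInvertible_σ {C : SSet.{0}} (x : C _⦋0⦌) : IsInvertible (C.σ 0 x) :=
  ⟨(Edge.InvStruct.invStructId x).ofEq rfl⟩

lemma IsPointwiseInvertible.whiskerRight {X Y C : SSet.{0}} {H : Y ⊗ Δ[1] ⟶ C}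
    (hH : IsPointwiseInvertible H) (f : X ⟶ Y) : IsPointwiseInvertible (f ▷ Δ[1] ≫ H) := by
  intro x
  rw [homotopyEdge_whiskerRight]
  exact hH _

lemma IsPointwiseInvertible.comp {X C D : SSet.{0}} {H : X ⊗ Δ[1] ⟶ C}
    (hH : IsPointwiseInvertible H) (f : C ⟶ D) : IsPointwiseInvertible (H ≫ f) :=
  fun x ↦ (hH x).map f

lemma isPointwiseInvertible_const {X C : SSet.{0}} (f : X ⟶ C) :
    IsPointwiseInvertible (CartesianMonoidalCategory.fst X Δ[1] ≫ f) := by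
  intro x
  have : homotopyEdge (CartesianMonoidalCategory.fst X Δ[1] ≫ f) x = C.σ 0 (f.app _ x) :=
    (σ_naturality_apply f 0 x)
  rw [this]
  exact isInvertible_σ _

/-- The object of paths in `C`. -/
noncomputable abbrev pathObj (C : SSet.{0}) : SSet.{0} := (ihom Δ[1]).obj C

/-- The universal homotopy. -/
noncomputable def pathEv (C : SSet.{0}) : pathObj C ⊗ Δ[1] ⟶ C :=
  (β_ _ _).hom ≫ (ihom.ev Δ[1]).app C

/-- The map to the object of paths corresponding to a homotopy. -/
noncomputable def toPathObj {X C : SSet.{0}} (H : X ⊗ Δ[1] ⟶ C) : X ⟶ pathObj C :=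
  MonoidalClosed.curry ((β_ _ _).hom ≫ H)

lemma toPathObj_pathEv {X C : SSet.{0}} (H : X ⊗ Δ[1] ⟶ C) :
    toPathObj H ▷ Δ[1] ≫ pathEv C = H := by
  rw [pathEv, BraidedCategory.braiding_naturality_left_assoc, toPathObj,
    ← MonoidalClosed.uncurry_eq, MonoidalClosed.uncurry_curry, SymmetricCategory.symmetry_assoc]

lemma pathObj_hom_ext {X C : SSet.{0}} {f g : X ⟶ pathObj C}
    (h : f ▷ Δ[1] ≫ pathEv C = g ▷ Δ[1] ≫ pathEv C) : f = g := by
  rw [pathEv, BraidedCategory.braiding_naturality_left_assoc,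
    BraidedCategory.braiding_naturality_left_assoc, cancel_epi,
    ← MonoidalClosed.uncurry_eq, ← MonoidalClosed.uncurry_eq] at h
  exact MonoidalClosed.uncurry_injective h

/-- The object of invertible paths in `C`. -/
noncomputable def invPathObj (C : SSet.{0}) : (pathObj C).Subcomplex where
  obj d := {x | ∀ i : ⦋0⦌ ⟶ d.unop, IsInvertible (homotopyEdge (pathEv C) ((pathObj C).map i.op x))}
  map {d e} f x hx i := by
    have := hx (i ≫ f.unop)
    rw [op_comp, Functor.map_comp] at this
    exact this

/-- The map to the object of invertible paths corresponding to a pointwise invertible homotopy. -/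
noncomputable def toInvPathObj {X C : SSet.{0}} (H : X ⊗ Δ[1] ⟶ C)
    (hH : IsPointwiseInvertible H) : X ⟶ (invPathObj C).toSSet :=
  Subcomplex.lift (toPathObj H) (by
    rintro d _ ⟨x, rfl⟩ i
    rw [← NatTrans.naturality_apply, ← homotopyEdge_whiskerRight, toPathObj_pathEv]
    exact hH _)

lemma toInvPathObj_ι {X C : SSet.{0}} (H : X ⊗ Δ[1] ⟶ C) (hH : IsPointwiseInvertible H) :
    toInvPathObj H hH ≫ (invPathObj C).ι = toPathObj H := rfl

lemma isPointwiseInvertible_invPathObj (C : SSet.{0}) :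
    IsPointwiseInvertible ((invPathObj C).ι ▷ Δ[1] ≫ pathEv C) := by
  intro x
  rw [homotopyEdge_whiskerRight]
  have := x.2 (𝟙 _)
  simpa using this

/-- The source of an invertible path. -/
noncomputable def invPathSrc (C : SSet.{0}) : (invPathObj C).toSSet ⟶ C :=
  (invPathObj C).ι ≫ ι₀ ≫ pathEv C

lemma comp_invPathSrc {X C : SSet.{0}} (f : X ⟶ (invPathObj C).toSSet) :
    f ≫ invPathSrc C = ι₀ ≫ (f ≫ (invPathObj C).ι) ▷ Δ[1] ≫ pathEv C := rfl

end SSet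

/-! ### Comparison of the prism with the product of `Δ[m + 1]` and `Δ[1]`. -/

namespace NervePairing

open SSet

variable {m : ℕ}

/-- The second projection of the prism. -/
def prismSnd (m : ℕ) : nerve (Prism m) ⟶ Δ[m + 1] where
  app _ := ↾fun x ↦ stdSimplex.objEquiv.symm (SimplexCategory.Hom.mk (b := ⦋m + 1⦌)
    ⟨fun i ↦ (x.obj i).2, fun _ _ h ↦ (x.monotone h).2⟩)
  naturality _ _ _ := rfl

/-- The first projection of the prism. -/
def prismFst (m : ℕ) : nerve (Prism m) ⟶ Δ[1] where
  app _ := ↾fun x ↦ stdSimplex.objEquiv.symm (SimplexCategory.Hom.mk (b := ⦋1⦌)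
    ⟨fun i ↦ (x.obj i).1, fun _ _ h ↦ (x.monotone h).1⟩)
  naturality _ _ _ := rfl

/-- The map from the product of simplices to the nerve of the prism. -/
def toPrism (m : ℕ) : Δ[m + 1] ⊗ Δ[1] ⟶ nerve (Prism m) where
  app d := ↾fun (z : (Δ[m + 1] ⊗ Δ[1] : SSet.{0}).obj d) ↦ simplexMk (d := d.unop.len) (P := Prism m)
    (fun i ↦ ((stdSimplex.objEquiv z.2).toOrderHom i, (stdSimplex.objEquiv z.1).toOrderHom i))
    (fun _ _ h ↦ ⟨(stdSimplex.objEquiv z.2).toOrderHom.monotone h,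
      (stdSimplex.objEquiv z.1).toOrderHom.monotone h⟩)
  naturality _ _ _ := rfl

/-- The simplices of the prism whose second projections are in the boundary. -/
def PrismSide (s : Set (Prism m)) : Prop := ∃ j, ∀ p ∈ s, p.2 ≠ j

/-- The simplices of the prism whose first projections are constant with value `0`. -/
def PrismBottom (s : Set (Prism m)) : Prop := ∀ p ∈ s, p.1 = 0

lemma isLower_prismSide : IsLower (PrismSide (m := m)) :=
  fun _ _ h ⟨j, hj⟩ ↦ ⟨j, fun p hp ↦ hj p (h hp)⟩

lemma isLower_prismBottom : IsLower (PrismBottom (m := m)) := fun _ _ h h' p hp ↦ h' p (h hp)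

/-- The map to the boundary induced by the second projection of the prism. -/
def prismSideSnd (m : ℕ) :
    (ofSupp (PrismSide (m := m)) isLower_prismSide).toSSet ⟶ (∂Δ[m + 1] : SSet.{0}) :=
  Subcomplex.lift ((ofSupp _ _).ι ≫ prismSnd m) (by
    rintro ⟨⟨d⟩⟩ _ ⟨⟨x, j, hj⟩, rfl⟩
    rw [mem_boundary_iff_notMem_range]
    refine ⟨j, ?_⟩
    rintro ⟨i, hi⟩
    exact hj _ ⟨i, rfl⟩ hi)

end NervePairing

namespace SSet

open NervePairing in
lemma exists_extension_boundary {C : SSet.{0}} [Quasicategory C] (m : ℕ)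
    (H : (∂Δ[m + 1] : SSet.{0}) ⊗ Δ[1] ⟶ C) (hH : IsPointwiseInvertible H) (f : Δ[m + 1] ⟶ C)
    (hf : ι₀ ≫ H = ∂Δ[m + 1].ι ≫ f) :
    ∃ H' : Δ[m + 1] ⊗ Δ[1] ⟶ C, ∂Δ[m + 1].ι ▷ Δ[1] ≫ H' = H ∧ ι₀ ≫ H' = f := by
  let a : (ofSupp (PrismSide (m := m)) isLower_prismSide).toSSet ⟶ C :=
    CartesianMonoidalCategory.lift (prismSideSnd m) ((ofSupp _ _).ι ≫ prismFst m) ≫ H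
  let b : (ofSupp (PrismBottom (m := m)) isLower_prismBottom).toSSet ⟶ C :=
    (ofSupp _ _).ι ≫ prismSnd m ≫ f
  obtain ⟨c, hc₁, hc₀⟩ := Subcomplex.exists_glue _ _ a b (by
    intro d x hx hx'
    refine Eq.trans ?_ (ConcreteCategory.congr_hom (NatTrans.congr_app hf (op ⦋d⦌))
      ((prismSideSnd m).app (op ⦋d⦌) ⟨x, hx⟩))
    refine congrArg (H.app (op ⦋d⦌)) (Prod.ext rfl ?_)
    apply stdSimplex.objEquiv.injective
    ext i
    exact congrArg Fin.val (hx' _ ⟨i, rfl⟩))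
  -- The edge that has to be invertible lies over the vertex `0`, which belongs to the boundary
  -- because the dimension `m + 1` is positive.
  have hedge : c.app (op ⦋1⦌) ⟨prismEdge m, prismStart_prismEdge⟩ =
      homotopyEdge H ⟨stdSimplex.obj₀Equiv.symm 0, by
        rw [boundary_obj_eq_univ _ _ (by omega)]; trivial⟩ := by
    refine (hc₁ (prismEdge m) (prismStart_prismEdge.resolve_right ?_)).trans ?_
    · intro h
      simpa using h (1, 0) ⟨1, rfl⟩
    · refine congrArg (H.app (op ⦋1⦌)) (Prod.ext ?_ ?_)
      · apply Subtype.ext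
        apply stdSimplex.objEquiv.injective
        ext i
        rfl
      · apply stdSimplex.objEquiv.injective
        ext i
        rfl
  obtain ⟨g, hg⟩ := exists_extension_prism (m := m)
    (Subcomplex.homOfLE (S₁ := ofSupp PrismStart isLower_prismStart)
      (S₂ := ofSupp PrismSide isLower_prismSide ⊔ ofSupp PrismBottom isLower_prismBottom)
      (fun d x hx ↦ hx) ≫ c) (by
      change IsInvertible (c.app (op ⦋1⦌) ⟨prismEdge m, prismStart_prismEdge⟩)
      rw [hedge]
      exact hH _)
  refine ⟨toPrism m ≫ g, ?_, ?_⟩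
  · ext ⟨⟨d⟩⟩ ⟨x, y⟩
    have hx : PrismSide (supp ((toPrism m).app (op ⦋d⦌) (x.1, y))) := by
      obtain ⟨j, hj⟩ := (mem_boundary_iff_notMem_range _).1 x.2
      refine ⟨j, ?_⟩
      rintro _ ⟨i, rfl⟩ h
      exact hj ⟨i, h⟩
    refine (hg _ (Or.inl hx)).trans ((hc₁ _ hx).trans
      (congrArg (H.app (op ⦋d⦌)) (Prod.ext (Subtype.ext ?_) ?_)))
    all_goals
      apply stdSimplex.objEquiv.injective
      ext i
      rfl
  · ext ⟨⟨d⟩⟩ x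
    have hx : PrismBottom (supp ((toPrism m).app (op ⦋d⦌) (ι₀.app _ x))) := by
      rintro _ ⟨i, rfl⟩
      rfl
    refine (hg _ (Or.inr hx)).trans ((hc₀ _ hx).trans (congrArg (f.app (op ⦋d⦌)) ?_))
    apply stdSimplex.objEquiv.injective
    ext i
    rfl

/-- Lifting against a boundary inclusion amounts to extending an invertible homotopy from the
boundary to a simplex on which its source is already defined. -/
theorem rlp_invPathSrc (C : SSet.{0}) [Quasicategory C] :
    (MorphismProperty.monomorphisms SSet.{0}).rlp (invPathSrc C) := by
  rw [rlp_monomorphisms]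
  rintro _ _ _ ⟨n⟩
  refine ⟨fun {t b} sq ↦ ?_⟩
  obtain _ | m := n
  -- The boundary of `Δ[0]` is empty, so the constant homotopy is a lift.
  · refine ⟨⟨⟨toInvPathObj _ (isPointwiseInvertible_const b), ?_, ?_⟩⟩⟩
    · ext
    · rw [comp_invPathSrc, toInvPathObj_ι, toPathObj_pathEv]
      rfl
  · let H := (t ≫ (invPathObj C).ι) ▷ Δ[1] ≫ pathEv C
    have hH : IsPointwiseInvertible H := by
      have := (isPointwiseInvertible_invPathObj C).whiskerRight t
      rwa [← comp_whiskerRight_assoc] at this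
    obtain ⟨H', h1, h0⟩ := exists_extension_boundary m H hH b (by rw [← sq.w, comp_invPathSrc])
    -- All vertices are in the boundary, so pointwise invertibility is inherited from `H`.
    have hH' : IsPointwiseInvertible H' := by
      intro x
      have hx : x ∈ (boundary (m + 1)).obj (op ⦋0⦌) := by
        rw [boundary_obj_eq_univ _ _ (by omega)]; trivial
      have h2 := hH ⟨x, hx⟩
      rw [← h1] at h2
      exact (homotopyEdge_whiskerRight (boundary (m + 1)).ι H' ⟨x, hx⟩) ▸ h2
    refine ⟨⟨⟨toInvPathObj H' hH', ?_, ?_⟩⟩⟩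
    · rw [← cancel_mono (invPathObj C).ι, Category.assoc, toInvPathObj_ι]
      apply pathObj_hom_ext
      rw [comp_whiskerRight_assoc, toPathObj_pathEv, h1]
    · rw [comp_invPathSrc, toInvPathObj_ι, toPathObj_pathEv, h0]

/-- Extension of pointwise invertible homotopies along monomorphisms. -/
theorem exists_extension_homotopy {C A B : SSet.{0}} [Quasicategory C] (i : A ⟶ B) [Mono i]
    (H : A ⊗ Δ[1] ⟶ C) (hH : IsPointwiseInvertible H) (f : B ⟶ C) (hf : ι₀ ≫ H = i ≫ f) :
    ∃ H' : B ⊗ Δ[1] ⟶ C, IsPointwiseInvertible H' ∧ i ▷ Δ[1] ≫ H' = H ∧ ι₀ ≫ H' = f := by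
  have := rlp_invPathSrc C i (inferInstanceAs (Mono i))
  have sq : CommSq (toInvPathObj H hH) i (invPathSrc C) f := ⟨by
    rw [comp_invPathSrc, toInvPathObj_ι, toPathObj_pathEv, hf]⟩
  have h1 := sq.fac_left
  have h2 := sq.fac_right
  refine ⟨(sq.lift ≫ (invPathObj C).ι) ▷ Δ[1] ≫ pathEv C, ?_, ?_, ?_⟩
  · rw [comp_whiskerRight_assoc]
    exact (isPointwiseInvertible_invPathObj C).whiskerRight _
  · rw [← comp_whiskerRight_assoc, ← Category.assoc, h1, toInvPathObj_ι, toPathObj_pathEv]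
  · rw [← comp_invPathSrc, h2]

end SSet

/-! ### The homotopy category of a quasi-category -/

namespace SSet

section

variable {C : SSet.{0}}

lemma δ_comp_yonedaEquiv_symm {k : ℕ} (i : Fin (k + 2)) (x : C _⦋k + 1⦌) :
    stdSimplex.δ i ≫ yonedaEquiv.symm x = yonedaEquiv.symm (C.δ i x) :=
  yonedaEquiv_symm_naturality_left (SimplexCategory.δ i) x

lemma δ_yonedaEquiv {k : ℕ} (i : Fin (k + 2)) (g : Δ[k + 1] ⟶ C) :
    C.δ i (yonedaEquiv g) = yonedaEquiv (stdSimplex.δ i ≫ g) :=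
  yonedaEquiv_naturality (SimplexCategory.δ i) g

end

section

variable {C : SSet.{0}} [Quasicategory C] {x₀ x₁ x₂ x₃ : C _⦋0⦌}

lemma Edge.exists_compStruct (e₀₁ : Edge x₀ x₁) (e₁₂ : Edge x₁ x₂) :
    ∃ e₀₂ : Edge x₀ x₂, Nonempty (CompStruct e₀₁ e₁₂ e₀₂) := by
  have w : stdSimplex.δ (0 : Fin 2) ≫ yonedaEquiv.symm e₀₁.edge =
      stdSimplex.δ (1 : Fin 2) ≫ yonedaEquiv.symm e₁₂.edge := by
    rw [δ_comp_yonedaEquiv_symm, δ_comp_yonedaEquiv_symm, e₀₁.tgt_eq, e₁₂.src_eq]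
  obtain ⟨τ, hτ⟩ := Quasicategory.hornFilling (i := 1) (by decide) (by decide)
    (horn₂₁.isPushout.desc _ _ w)
  have h (i : Fin 3) (hi : i ≠ 1) :
      C.δ i (yonedaEquiv τ) = yonedaEquiv (horn.ι 1 i hi ≫ horn₂₁.isPushout.desc _ _ w) := by
    rw [δ_yonedaEquiv, hτ, ← Category.assoc, horn.ι_ι]
  have h0 := h 0 (by decide)
  have h2 := h 2 (by decide)
  rw [horn₂₁.isPushout.inr_desc, Equiv.apply_symm_apply] at h0
  rw [horn₂₁.isPushout.inl_desc, Equiv.apply_symm_apply] at h2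
  refine ⟨Edge.mk (C.δ 1 (yonedaEquiv τ)) ?_ ?_, ⟨CompStruct.mk (yonedaEquiv τ) h2 h0 rfl⟩⟩
  · rw [← e₀₁.src_eq, ← h2]
    exact (δ_comp_δ_apply (S := C) (i := 1) (j := 1) le_rfl _).symm
  · rw [← e₁₂.tgt_eq, ← h0]
    exact (δ_comp_δ_apply (S := C) (i := 0) (j := 0) le_rfl _)

variable {e₀₁ : Edge x₀ x₁} {e₁₂ : Edge x₁ x₂} {e₂₃ : Edge x₂ x₃}
      {e₀₂ : Edge x₀ x₂} {e₁₃ : Edge x₁ x₃} {e₀₃ : Edge x₀ x₃}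

lemma Edge.CompStruct.nonempty_of_horn₃₁ (f₃ : CompStruct e₀₁ e₁₂ e₀₂)
    (f₀ : CompStruct e₁₂ e₂₃ e₁₃) (f₂ : CompStruct e₀₁ e₁₃ e₀₃) :
    Nonempty (CompStruct e₀₂ e₂₃ e₀₃) := by
  obtain ⟨φ, h0, h2, h3⟩ := horn₃₁.exists_desc (X := C) (yonedaEquiv.symm f₀.simplex)
    (yonedaEquiv.symm f₂.simplex) (yonedaEquiv.symm f₃.simplex)
    (by rw [δ_comp_yonedaEquiv_symm, δ_comp_yonedaEquiv_symm, f₀.d₂, f₃.d₀])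
    (by rw [δ_comp_yonedaEquiv_symm, δ_comp_yonedaEquiv_symm, f₀.d₁, f₂.d₀])
    (by rw [δ_comp_yonedaEquiv_symm, δ_comp_yonedaEquiv_symm, f₂.d₂, f₃.d₂])
  obtain ⟨τ, hτ⟩ := Quasicategory.hornFilling (i := 1) (by decide) (by decide) φ
  have h (i : Fin 4) (hi : i ≠ 1) : C.δ i (yonedaEquiv τ) = yonedaEquiv (horn.ι 1 i hi ≫ φ) := by
    rw [δ_yonedaEquiv, hτ, ← Category.assoc, horn.ι_ι]
  have h0 := (h 0 (by decide)).trans ((congrArg yonedaEquiv h0).trans (Equiv.apply_symm_apply _ _))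
  have h2 := (h 2 (by decide)).trans ((congrArg yonedaEquiv h2).trans (Equiv.apply_symm_apply _ _))
  have h3 := (h 3 (by decide)).trans ((congrArg yonedaEquiv h3).trans (Equiv.apply_symm_apply _ _))
  refine ⟨CompStruct.mk (C.δ 1 (yonedaEquiv τ)) ?_ ?_ ?_⟩
  · rw [← f₃.d₁, ← h3]
    exact (δ_comp_δ_apply (S := C) (i := 1) (j := 2) (by decide) _).symm
  · rw [← f₀.d₀, ← h0]
    exact (δ_comp_δ_apply (S := C) (i := 0) (j := 0) (by decide) _)
  · rw [← f₂.d₁, ← h2]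
    exact (δ_comp_δ_apply (S := C) (i := 1) (j := 1) (by decide) _).symm

lemma Edge.CompStruct.nonempty_of_horn₃₂ (f₃ : CompStruct e₀₁ e₁₂ e₀₂)
    (f₀ : CompStruct e₁₂ e₂₃ e₁₃) (f₁ : CompStruct e₀₂ e₂₃ e₀₃) :
    Nonempty (CompStruct e₀₁ e₁₃ e₀₃) := by
  obtain ⟨φ, h0, h1, h3⟩ := horn₃₂.exists_desc (X := C) (yonedaEquiv.symm f₀.simplex)
    (yonedaEquiv.symm f₁.simplex) (yonedaEquiv.symm f₃.simplex)
    (by rw [δ_comp_yonedaEquiv_symm, δ_comp_yonedaEquiv_symm, f₁.d₂, f₃.d₁])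
    (by rw [δ_comp_yonedaEquiv_symm, δ_comp_yonedaEquiv_symm, f₀.d₂, f₃.d₀])
    (by rw [δ_comp_yonedaEquiv_symm, δ_comp_yonedaEquiv_symm, f₀.d₀, f₁.d₀])
  obtain ⟨τ, hτ⟩ := Quasicategory.hornFilling (i := 2) (by decide) (by decide) φ
  have h (i : Fin 4) (hi : i ≠ 2) : C.δ i (yonedaEquiv τ) = yonedaEquiv (horn.ι 2 i hi ≫ φ) := by
    rw [δ_yonedaEquiv, hτ, ← Category.assoc, horn.ι_ι]
  have h0 := (h 0 (by decide)).trans ((congrArg yonedaEquiv h0).trans (Equiv.apply_symm_apply _ _))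
  have h1 := (h 1 (by decide)).trans ((congrArg yonedaEquiv h1).trans (Equiv.apply_symm_apply _ _))
  have h3 := (h 3 (by decide)).trans ((congrArg yonedaEquiv h3).trans (Equiv.apply_symm_apply _ _))
  refine ⟨CompStruct.mk (C.δ 2 (yonedaEquiv τ)) ?_ ?_ ?_⟩
  · rw [← f₃.d₂, ← h3]
    exact (δ_comp_δ_apply (S := C) (i := 2) (j := 2) (by decide) _).symm
  · rw [← f₀.d₁, ← h0]
    exact (δ_comp_δ_apply (S := C) (i := 0) (j := 1) (by decide) _)
  · rw [← f₁.d₁, ← h1]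
    exact (δ_comp_δ_apply (S := C) (i := 1) (j := 1) (by decide) _)

/-- These horn conditions give access to the description of the homotopy category by homotopy
classes of edges. -/
instance : Truncated.Quasicategory₂ ((truncation 2).obj C) where
  fill21 e f := by
    obtain ⟨g, ⟨h⟩⟩ := Edge.exists_compStruct (C := C) (.ofTruncated e) (.ofTruncated f)
    exact ⟨⟨g, h⟩⟩
  fill31 f₃ f₀ f₂ := Edge.CompStruct.nonempty_of_horn₃₁ (C := C) (.ofTruncated f₃)
    (.ofTruncated f₀) (.ofTruncated f₂)
  fill32 f₃ f₀ f₁ := Edge.CompStruct.nonempty_of_horn₃₂ (C := C) (.ofTruncated f₃)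
    (.ofTruncated f₀) (.ofTruncated f₁)

end

/-- The homotopy category of a simplicial set. -/
abbrev Ho (C : SSet.{0}) : Type := ((truncation 2).obj C).HomotopyCategory

namespace Ho

/-- The object of the homotopy category given by a vertex. -/
abbrev mk {C : SSet.{0}} (x : C _⦋0⦌) : Ho C := Truncated.HomotopyCategory.mk x

/-- The morphism in the homotopy category given by an edge. -/
def hom {C : SSet.{0}} {x y : C _⦋0⦌} (e : Edge x y) : mk x ⟶ mk y :=
  Truncated.HomotopyCategory.homMk e.toTruncated

lemma hom_id {C : SSet.{0}} (x : C _⦋0⦌) : hom (Edge.id x) = 𝟙 (mk x) :=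
  Truncated.HomotopyCategory.homMk_id _

lemma hom_comp_hom {C : SSet.{0}} {x y z : C _⦋0⦌} {e : Edge x y} {f : Edge y z} {g : Edge x z}
    (h : Edge.CompStruct e f g) : hom e ≫ hom f = hom g :=
  Truncated.HomotopyCategory.homMk_comp_homMk h.toTruncated

/-- The functor between homotopy categories induced by a map of simplicial sets. -/
abbrev map {C D : SSet.{0}} (f : C ⟶ D) : Ho C ⥤ Ho D := (hoFunctor.map f).toFunctor

section

variable {C : SSet.{0}} [Quasicategory C]

/-- The comparison with the homotopy category defined by homotopy classes of edges. -/
noncomputable def toHo₂ (C : SSet.{0}) [Quasicategory C] :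
    Ho C ⥤ Truncated.HomotopyCategory₂ ((truncation 2).obj C) :=
  Truncated.HomotopyCategory.lift (fun x ↦ .mk x)
    (fun e ↦ Truncated.HomotopyCategory₂.homMk e)
    (fun _ ↦ rfl) (fun h ↦ h.homotopyCategory₂_fac)

lemma toHo₂_map_hom {x y : C _⦋0⦌} (e : Edge x y) :
    (toHo₂ C).map (hom e) = Truncated.HomotopyCategory₂.homMk e.toTruncated :=
  Truncated.HomotopyCategory.lift_map_homMk _ _ _
    (fun h ↦ h.homotopyCategory₂_fac) e.toTruncated

/-- When morphisms are homotopy classes of edges, an equality of classes is witnessed by an actual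
`2`-simplex. This is what the comparison `toHo₂` is for. -/
lemma nonempty_compStruct {x y z : C _⦋0⦌} {e : Edge x y} {f : Edge y z} {g : Edge x z}
    (h : hom e ≫ hom f = hom g) : Nonempty (Edge.CompStruct e f g) := by
  have := congrArg (toHo₂ C).map h
  rw [Functor.map_comp, toHo₂_map_hom, toHo₂_map_hom, toHo₂_map_hom] at this
  exact ⟨.ofTruncated (.ofHomotopyCategory₂Fac this)⟩

/-- Edges generate all morphisms, and horn filling makes the classes of single edges stable under
composition. -/
lemma exists_hom_eq {x y : C _⦋0⦌} (φ : mk x ⟶ mk y) : ∃ e : Edge x y, hom e = φ := by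
  let W : MorphismProperty (Ho C) := fun X Y f ↦
    ∃ e : Edge (X := C) X.as.as Y.as.as, hom e = f
  have : W.IsMultiplicative :=
    { id_mem X := ⟨Edge.id _, hom_id (C := C) X.as.as⟩
      comp_mem := by
        rintro X Y Z _ _ ⟨e, rfl⟩ ⟨f, rfl⟩
        obtain ⟨g, ⟨h⟩⟩ := Edge.exists_compStruct e f
        exact ⟨g, (hom_comp_hom h).symm⟩ }
  have h : W φ := by
    rw [Truncated.HomotopyCategory.morphismProperty_eq_top (W := W) (fun e ↦ ⟨e, rfl⟩)]
    trivial
  exact h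

lemma nonempty_compStruct_of_hom_eq {x y : C _⦋0⦌} {e f : Edge x y} (h : hom e = hom f) :
    Nonempty (Edge.CompStruct e (Edge.id y) f) :=
  nonempty_compStruct (by rw [hom_id, Category.comp_id, h])

end

lemma isIso_of_invStruct {C : SSet.{0}} {x y : C _⦋0⦌} {e : Edge x y} (I : e.InvStruct) :
    IsIso (hom e) :=
  ⟨hom I.inv, by rw [hom_comp_hom I.homInvId, hom_id], by rw [hom_comp_hom I.invHomId, hom_id]⟩

lemma isIso_hom_of_isInvertible {C : SSet.{0}} {x y : C _⦋0⦌} {e : Edge x y}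
    (he : IsInvertible e.edge) : IsIso (hom e) := by
  obtain ⟨I⟩ := he
  exact isIso_of_invStruct (I.ofEq rfl)

lemma isInvertible_of_isIso_hom {C : SSet.{0}} [Quasicategory C] {x y : C _⦋0⦌} {e : Edge x y}
    [IsIso (hom e)] : IsInvertible e.edge := by
  obtain ⟨f, hf⟩ := exists_hom_eq (inv (hom e))
  obtain ⟨h1⟩ := nonempty_compStruct (e := e) (f := f) (g := Edge.id x) (by rw [hf, hom_id]; simp)
  obtain ⟨h2⟩ := nonempty_compStruct (e := f) (f := e) (g := Edge.id y) (by rw [hf, hom_id]; simp)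
  exact ⟨Edge.InvStruct.ofEq (hom := e) ⟨f, h1, h2⟩ rfl⟩

end Ho

end SSet

/-! ### Homotopies as edges in the simplicial sets of functors -/

namespace SSet

open CartesianMonoidalCategory (fst snd lift)

section

variable {X Y C D : SSet.{0}}

/-- The simplices of the simplicial set of functors. -/
noncomputable def funSimplex {n : ℕ} : (X ⊗ Δ[n] ⟶ C) ≃ ((ihom X).obj C) _⦋n⦌ :=
  ((ihom.adjunction X).homEquiv _ _).trans yonedaEquiv

lemma map_funSimplex {m n : ℕ} (f : ⦋m⦌ ⟶ ⦋n⦌) (u : X ⊗ Δ[n] ⟶ C) :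
    ((ihom X).obj C).map f.op (funSimplex u) = funSimplex (X ◁ SSet.stdSimplex.map f ≫ u) := by
  change _ = yonedaEquiv (MonoidalClosed.curry _)
  rw [MonoidalClosed.curry_natural_left, ← yonedaEquiv_naturality]
  rfl

lemma pre_app_funSimplex (i : Y ⟶ X) {n : ℕ} (u : X ⊗ Δ[n] ⟶ C) :
    ((MonoidalClosed.pre i).app C).app _ (funSimplex u) = funSimplex (i ▷ Δ[n] ≫ u) := by
  change _ = yonedaEquiv (MonoidalClosed.curry _)
  rw [← MonoidalClosed.curry_pre_app]
  rfl

lemma ihom_map_app_funSimplex (q : C ⟶ D) {n : ℕ} (u : X ⊗ Δ[n] ⟶ C) :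
    ((ihom X).map q).app _ (funSimplex u) = funSimplex (u ≫ q) := by
  change _ = yonedaEquiv (MonoidalClosed.curry _)
  rw [MonoidalClosed.curry_natural_right]
  rfl

/-- The vertex of the simplicial set of functors given by a map. -/
noncomputable def funVertex (f : X ⟶ C) : ((ihom X).obj C) _⦋0⦌ := funSimplex (fst X Δ[0] ≫ f)

lemma exists_funVertex_eq (x : ((ihom X).obj C) _⦋0⦌) : ∃ f : X ⟶ C, funVertex f = x := by
  obtain ⟨u, rfl⟩ := funSimplex.surjective x
  refine ⟨lift (𝟙 X) (const (stdSimplex.obj₀Equiv.symm 0)) ≫ u, congrArg funSimplex ?_⟩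
  rw [← Category.assoc]
  convert Category.id_comp u
  ext1
  · simp
  · exact stdSimplex.isTerminalObj₀.hom_ext _ _

lemma pre_app_funVertex (i : Y ⟶ X) (f : X ⟶ C) :
    ((MonoidalClosed.pre i).app C).app _ (funVertex f) = funVertex (i ≫ f) :=
  pre_app_funSimplex _ _

lemma funVertex_injective : Function.Injective (funVertex (X := X) (C := C)) := by
  intro f g h
  have := congrArg (lift (𝟙 X) (const (stdSimplex.obj₀Equiv.symm 0)) ≫ ·) (funSimplex.injective h)
  exact this

lemma δ_one_funSimplex (H : X ⊗ Δ[1] ⟶ C) :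
    ((ihom X).obj C).δ 1 (funSimplex H) = funVertex (ι₀ ≫ H) := by
  refine (map_funSimplex (SimplexCategory.δ 1) _).trans (congrArg funSimplex ?_)
  rw [← Category.assoc]
  congr 1
  ext1
  · simp
  · rw [CartesianMonoidalCategory.whiskerLeft_snd, Category.assoc, ι₀_snd]
    have : (SSet.stdSimplex.{0}.δ 1 : Δ[0] ⟶ Δ[1]) =
      const (stdSimplex.obj₀Equiv.symm 0) := by decide
    exact congrArg (snd X Δ[0] ≫ ·) this

lemma δ_zero_funSimplex (H : X ⊗ Δ[1] ⟶ C) :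
    ((ihom X).obj C).δ 0 (funSimplex H) = funVertex (ι₁ ≫ H) := by
  refine (map_funSimplex (SimplexCategory.δ 0) _).trans (congrArg funSimplex ?_)
  rw [← Category.assoc]
  congr 1
  ext1
  · simp
  · rw [CartesianMonoidalCategory.whiskerLeft_snd, Category.assoc, ι₁_snd]
    have : (SSet.stdSimplex.{0}.δ 0 : Δ[0] ⟶ Δ[1]) =
      const (stdSimplex.obj₀Equiv.symm 1) := by decide
    exact congrArg (snd X Δ[0] ≫ ·) this

/-- The edge of the simplicial set of functors given by a homotopy. -/
noncomputable def funEdge {f g : X ⟶ C} (H : X ⊗ Δ[1] ⟶ C) (h₀ : ι₀ ≫ H = f) (h₁ : ι₁ ≫ H = g) :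
    Edge (funVertex f) (funVertex g) :=
  Edge.mk (funSimplex H) (by rw [δ_one_funSimplex, h₀]) (by rw [δ_zero_funSimplex, h₁])

lemma exists_funEdge_eq {f g : X ⟶ C} (e : Edge (funVertex f) (funVertex g)) :
    ∃ (H : X ⊗ Δ[1] ⟶ C) (h₀ : ι₀ ≫ H = f) (h₁ : ι₁ ≫ H = g), funEdge H h₀ h₁ = e := by
  obtain ⟨H, hH⟩ := funSimplex.surjective e.edge
  refine ⟨H, funVertex_injective ?_, funVertex_injective ?_, Edge.ext hH⟩
  · rw [← δ_one_funSimplex, hH, e.src_eq]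
  · rw [← δ_zero_funSimplex, hH, e.tgt_eq]

/-- The evaluation at a vertex. -/
noncomputable def evalAt (C : SSet.{0}) (x : X _⦋0⦌) : (ihom X).obj C ⟶ C :=
  lift (const x) (𝟙 _) ≫ (ihom.ev X).app C

lemma evalAt_app_funSimplex_one (x : X _⦋0⦌) (H : X ⊗ Δ[1] ⟶ C) :
    (evalAt C x).app _ (funSimplex H) = homotopyEdge H x := by
  have h : X ◁ MonoidalClosed.curry H ≫ (ihom.ev X).app C = H := by
    rw [← MonoidalClosed.uncurry_eq, MonoidalClosed.uncurry_curry]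
  have h' := ConcreteCategory.congr_hom (NatTrans.congr_app h (op ⦋1⦌))
    ((X.σ 0 x, yonedaEquiv (𝟙 Δ[1])) : (X ⊗ Δ[1] : SSet.{0}) _⦋1⦌)
  refine Eq.trans ?_ h'
  change ((ihom.ev X).app C).app (op ⦋1⦌) ((const x).app _ (funSimplex H), funSimplex H) =
    ((ihom.ev X).app C).app (op ⦋1⦌) (X.σ 0 x, funSimplex H)
  congr 2
  exact ConcreteCategory.congr_hom (congrArg X.map (Subsingleton.elim (α := op ⦋0⦌ ⟶ op ⦋1⦌) _ _)) x

/-- The two nondegenerate `2`-simplices of the square. -/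
noncomputable def squareSimplex (X : SSet.{0}) (i j : Fin 2) : X ⊗ Δ[2] ⟶ (X ⊗ Δ[1]) ⊗ Δ[1] :=
  lift (X ◁ SSet.stdSimplex.σ i) (snd _ _ ≫ SSet.stdSimplex.σ j)

lemma whiskerLeft_squareSimplex (X : SSet.{0}) (i j : Fin 2) (k : Fin 3) :
    X ◁ SSet.stdSimplex.δ k ≫ squareSimplex X i j =
      lift (X ◁ (SSet.stdSimplex.δ k ≫ SSet.stdSimplex.σ i))
        (snd _ _ ≫ SSet.stdSimplex.δ k ≫ SSet.stdSimplex.σ j) := by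
  rw [squareSimplex, CartesianMonoidalCategory.comp_lift, ← MonoidalCategory.whiskerLeft_comp,
    CartesianMonoidalCategory.whiskerLeft_snd_assoc]

/-- Both composites are the class of the diagonal, through the two triangles of the square. -/
lemma hom_comp_hom_of_square (S : (X ⊗ Δ[1]) ⊗ Δ[1] ⟶ C) {a b c d : X ⟶ C}
    {top bot left right : X ⊗ Δ[1] ⟶ C} (ht : ι₀ ≫ S = top) (hb : ι₁ ≫ S = bot)
    (hl : ι₀ ▷ Δ[1] ≫ S = left) (hr : ι₁ ▷ Δ[1] ≫ S = right)
    (ht₀ : ι₀ ≫ top = a) (ht₁ : ι₁ ≫ top = b) (hb₀ : ι₀ ≫ bot = c) (hb₁ : ι₁ ≫ bot = d)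
    (hl₀ : ι₀ ≫ left = a) (hl₁ : ι₁ ≫ left = c) (hr₀ : ι₀ ≫ right = b) (hr₁ : ι₁ ≫ right = d) :
    Ho.hom (funEdge top ht₀ ht₁) ≫ Ho.hom (funEdge right hr₀ hr₁) =
      Ho.hom (funEdge left hl₀ hl₁) ≫ Ho.hom (funEdge bot hb₀ hb₁) := by
  let diag : X ⊗ Δ[1] ⟶ (X ⊗ Δ[1]) ⊗ Δ[1] := lift (𝟙 _) (snd _ _)
  have hd₀ : ι₀ ≫ diag ≫ S = a := by
    rw [← ht₀, ← ht, ← Category.assoc, ← Category.assoc]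
    refine congrArg (· ≫ S) ?_
    ext1 <;> simp [diag]
  have hd₁ : ι₁ ≫ diag ≫ S = d := by
    rw [← hb₁, ← hb, ← Category.assoc, ← Category.assoc]
    refine congrArg (· ≫ S) ?_
    ext1 <;> simp [diag]
  have e₁ : (SSet.stdSimplex.{0}.δ 2 ≫ SSet.stdSimplex.σ 1 : Δ[1] ⟶ Δ[1]) = 𝟙 _ := by decide
  have e₂ : (SSet.stdSimplex.{0}.δ 2 ≫ SSet.stdSimplex.σ 0 : Δ[1] ⟶ Δ[1]) =
    const (stdSimplex.obj₀Equiv.symm 0) := by decide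
  have e₃ : (SSet.stdSimplex.{0}.δ 0 ≫ SSet.stdSimplex.σ 1 : Δ[1] ⟶ Δ[1]) =
    const (stdSimplex.obj₀Equiv.symm 1) := by decide
  have e₄ : (SSet.stdSimplex.{0}.δ 0 ≫ SSet.stdSimplex.σ 0 : Δ[1] ⟶ Δ[1]) = 𝟙 _ := by decide
  have e₅ : (SSet.stdSimplex.{0}.δ 1 ≫ SSet.stdSimplex.σ 0 : Δ[1] ⟶ Δ[1]) = 𝟙 _ := by decide
  have e₆ : (SSet.stdSimplex.{0}.δ 1 ≫ SSet.stdSimplex.σ 1 : Δ[1] ⟶ Δ[1]) = 𝟙 _ := by decide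
  have c₁ : Edge.CompStruct (funEdge top ht₀ ht₁) (funEdge right hr₀ hr₁)
      (funEdge (diag ≫ S) hd₀ hd₁) := by
    refine Edge.CompStruct.mk (funSimplex (squareSimplex X 1 0 ≫ S)) ?_ ?_ ?_
    · refine (map_funSimplex (SimplexCategory.δ 2) _).trans (congrArg funSimplex ?_)
      refine (Category.assoc _ _ _).symm.trans ((congrArg (· ≫ S) ?_).trans ht)
      refine (whiskerLeft_squareSimplex X 1 0 2).trans ?_
      rw [e₁, e₂, MonoidalCategory.whiskerLeft_id]
      rfl
    · refine (map_funSimplex (SimplexCategory.δ 0) _).trans (congrArg funSimplex ?_)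
      refine (Category.assoc _ _ _).symm.trans ((congrArg (· ≫ S) ?_).trans hr)
      refine (whiskerLeft_squareSimplex X 1 0 0).trans ?_
      rw [e₃, e₄]
      rfl
    · refine (map_funSimplex (SimplexCategory.δ 1) _).trans (congrArg funSimplex ?_)
      refine (Category.assoc _ _ _).symm.trans (congrArg (· ≫ S) ?_)
      refine (whiskerLeft_squareSimplex X 1 0 1).trans ?_
      rw [e₅, e₆, MonoidalCategory.whiskerLeft_id]
      rfl
  have c₂ : Edge.CompStruct (funEdge left hl₀ hl₁) (funEdge bot hb₀ hb₁)
      (funEdge (diag ≫ S) hd₀ hd₁) := by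
    refine Edge.CompStruct.mk (funSimplex (squareSimplex X 0 1 ≫ S)) ?_ ?_ ?_
    · refine (map_funSimplex (SimplexCategory.δ 2) _).trans (congrArg funSimplex ?_)
      refine (Category.assoc _ _ _).symm.trans ((congrArg (· ≫ S) ?_).trans hl)
      refine (whiskerLeft_squareSimplex X 0 1 2).trans ?_
      rw [e₁, e₂]
      rfl
    · refine (map_funSimplex (SimplexCategory.δ 0) _).trans (congrArg funSimplex ?_)
      refine (Category.assoc _ _ _).symm.trans ((congrArg (· ≫ S) ?_).trans hb)
      refine (whiskerLeft_squareSimplex X 0 1 0).trans ?_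
      rw [e₃, e₄, MonoidalCategory.whiskerLeft_id]
      rfl
    · refine (map_funSimplex (SimplexCategory.δ 1) _).trans (congrArg funSimplex ?_)
      refine (Category.assoc _ _ _).symm.trans (congrArg (· ≫ S) ?_)
      refine (whiskerLeft_squareSimplex X 0 1 1).trans ?_
      rw [e₅, e₆, MonoidalCategory.whiskerLeft_id]
      rfl
  rw [Ho.hom_comp_hom c₁, Ho.hom_comp_hom c₂]

end

end SSet

/-! ### Invertible homotopies -/

namespace SSet

open CartesianMonoidalCategory (fst snd lift)

section

variable {X Y C D : SSet.{0}}

lemma const_app_one (x : X _⦋0⦌) (y : Y _⦋1⦌) : (const x : Y ⟶ X).app (op ⦋1⦌) y = X.σ 0 x :=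
  ConcreteCategory.congr_hom (congrArg X.map (Subsingleton.elim (α := op ⦋0⦌ ⟶ op ⦋1⦌) _ _)) x

lemma IsPointwiseInvertible.of_isInvertible_funSimplex {H : X ⊗ Δ[1] ⟶ C}
    (hH : IsInvertible (funSimplex H)) : IsPointwiseInvertible H := by
  intro x
  rw [← evalAt_app_funSimplex_one]
  exact hH.map _

lemma isInvertible_funSimplex_const (f : X ⟶ C) : IsInvertible (funSimplex (fst X Δ[1] ≫ f)) := by
  convert isInvertible_σ (funVertex f) using 1
  refine ((map_funSimplex (SimplexCategory.σ 0) _).trans (congrArg funSimplex ?_)).symm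
  rw [CartesianMonoidalCategory.whiskerLeft_fst_assoc]

/-- The edge `Δ[1] ⟶ J` where `J` is the nerve of the walking isomorphism. -/
noncomputable def coherentIsoEdge : Δ[1] ⟶ (coherentIso.{0} : SSet.{0}) :=
  yonedaEquiv.symm coherentIso.hom.edge

lemma isInvertible_funSimplex_coherentIso (K : X ⊗ (coherentIso.{0} : SSet.{0}) ⟶ C) :
    IsInvertible (funSimplex (X ◁ coherentIsoEdge ≫ K)) := by
  have h : IsInvertible (coherentIso.hom.{0}.edge) :=
    ⟨coherentIso.invStructHom.{0}.ofEq rfl⟩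
  convert h.map (MonoidalClosed.curry K) using 1
  change yonedaEquiv (MonoidalClosed.curry _) = _
  rw [MonoidalClosed.curry_natural_left, yonedaEquiv_comp, coherentIsoEdge,
    Equiv.apply_symm_apply]

lemma coherentIso_x₀_ne (d : SimplexCategoryᵒᵖ) :
    (coherentIso.{0} : SSet.{0}).map (SimplexCategory.const d.unop ⦋0⦌ 0).op coherentIso.x₀ ≠
      (coherentIso.{0} : SSet.{0}).map (SimplexCategory.const d.unop ⦋0⦌ 0).op coherentIso.x₁ := by
  intro h
  have := Functor.congr_obj h 0
  have := congrArg WalkingIso.equivBool this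
  exact Bool.false_ne_true this

/-- The two ends of the cylinder are disjoint, so `f` and `g` glue to a map on their union. The
constant homotopy in `D` then lifts along the trivial fibration `q`. -/
lemma exists_coherentIso_homotopy {q : C ⟶ D}
    (hq : (MorphismProperty.monomorphisms SSet.{0}).rlp q) (f g : X ⟶ C) (h : f ≫ q = g ≫ q) :
    ∃ K : X ⊗ (coherentIso.{0} : SSet.{0}) ⟶ C,
      lift (𝟙 X) (const coherentIso.x₀) ≫ K = f ∧ lift (𝟙 X) (const coherentIso.x₁) ≫ K = g := by
  let i (x : (coherentIso.{0} : SSet.{0}) _⦋0⦌) : X ⟶ X ⊗ (coherentIso.{0} : SSet.{0}) :=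
    lift (𝟙 X) (const x)
  let A (x : (coherentIso.{0} : SSet.{0}) _⦋0⦌) := Subcomplex.range (i x)
  obtain ⟨c, hc₀, hc₁⟩ := Subcomplex.exists_glue (A coherentIso.x₀) (A coherentIso.x₁)
    ((A _).ι ≫ fst _ _ ≫ f) ((A _).ι ≫ fst _ _ ≫ g) (by
      rintro d _ ⟨y, rfl⟩ ⟨z, hz⟩
      exact (coherentIso_x₀_ne _ (congrArg Prod.snd hz).symm).elim)
  have sq : CommSq c (A coherentIso.x₀ ⊔ A coherentIso.x₁).ι q (fst _ _ ≫ f ≫ q) := ⟨by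
    ext ⟨⟨d⟩⟩ ⟨x, hx | hx⟩
    · exact congrArg (q.app _) (hc₀ x hx)
    · refine (congrArg (q.app _) (hc₁ x hx)).trans ?_
      exact (ConcreteCategory.congr_hom (NatTrans.congr_app h (op ⦋d⦌)) x.1).symm⟩
  have := hq (A coherentIso.x₀ ⊔ A coherentIso.x₁).ι (inferInstanceAs (Mono _))
  refine ⟨sq.lift, ?_, ?_⟩
  · ext ⟨⟨d⟩⟩ x
    have h₁ := ConcreteCategory.congr_hom (NatTrans.congr_app sq.fac_left (op ⦋d⦌))
      ⟨(i coherentIso.x₀).app _ x, Or.inl ⟨x, rfl⟩⟩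
    exact h₁.trans (hc₀ _ ⟨x, rfl⟩)
  · ext ⟨⟨d⟩⟩ x
    have h₁ := ConcreteCategory.congr_hom (NatTrans.congr_app sq.fac_left (op ⦋d⦌))
      ⟨(i coherentIso.x₁).app _ x, Or.inr ⟨x, rfl⟩⟩
    exact h₁.trans (hc₁ _ ⟨x, rfl⟩)

lemma exists_isInvertible_homotopy {q : C ⟶ D}
    (hq : (MorphismProperty.monomorphisms SSet.{0}).rlp q) (f g : X ⟶ C) (h : f ≫ q = g ≫ q) :
    ∃ H : X ⊗ Δ[1] ⟶ C, IsInvertible (funSimplex H) ∧ ι₀ ≫ H = f ∧ ι₁ ≫ H = g := by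
  obtain ⟨K, h₀, h₁⟩ := exists_coherentIso_homotopy hq f g h
  refine ⟨X ◁ coherentIsoEdge ≫ K, isInvertible_funSimplex_coherentIso K, ?_, ?_⟩
  · rw [← h₀, ← Category.assoc]
    refine congrArg (· ≫ K) ?_
    ext1
    · simp
    · rw [Category.assoc, CartesianMonoidalCategory.whiskerLeft_snd, ι₀_snd_assoc, CartesianMonoidalCategory.lift_snd]
      rw [const_comp, coherentIsoEdge]
      refine congrArg const (Eq.trans ?_ coherentIso.hom.src_eq)
      exact congrArg (fun f : ⦋0⦌ ⟶ ⦋1⦌ ↦ (coherentIso.{0} : SSet.{0}).map f.op coherentIso.hom.edge)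
        (show stdSimplex.objEquiv (stdSimplex.obj₀Equiv.{0}.symm 0) = SimplexCategory.δ 1 by
          decide)
  · rw [← h₁, ← Category.assoc]
    refine congrArg (· ≫ K) ?_
    ext1
    · simp
    · rw [Category.assoc, CartesianMonoidalCategory.whiskerLeft_snd, ι₁_snd_assoc, CartesianMonoidalCategory.lift_snd]
      rw [const_comp, coherentIsoEdge]
      refine congrArg const (Eq.trans ?_ coherentIso.hom.tgt_eq)
      exact congrArg (fun f : ⦋0⦌ ⟶ ⦋1⦌ ↦ (coherentIso.{0} : SSet.{0}).map f.op coherentIso.hom.edge)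
        (show stdSimplex.objEquiv (stdSimplex.obj₀Equiv.{0}.symm 1) = SimplexCategory.δ 0 by
          decide)

/-- `H` and the constant homotopy at its source are two lifts of the same map along the trivial
fibration `invPathSrc C`, so an invertible homotopy joins them. It yields a square with `H` and a
constant homotopy as opposite sides. The other two sides are invertible in the simplicial set of
functors, and hence so is `H`. -/
theorem IsPointwiseInvertible.isInvertible_funSimplex [Quasicategory C] {H : X ⊗ Δ[1] ⟶ C}
    (hH : IsPointwiseInvertible H) : IsInvertible (funSimplex H) := by
  obtain ⟨K, hK, h₀, h₁⟩ := exists_isInvertible_homotopy (rlp_invPathSrc C)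
    (toInvPathObj _ (isPointwiseInvertible_const (ι₀ ≫ H))) (toInvPathObj H hH) (by
      simp only [comp_invPathSrc, toInvPathObj_ι, toPathObj_pathEv, ι₀_fst_assoc])
  obtain ⟨S, hS⟩ : ∃ S, S = (K ≫ (invPathObj C).ι) ▷ Δ[1] ≫ pathEv C := ⟨_, rfl⟩
  have hl : ι₀ ▷ Δ[1] ≫ S = fst _ _ ≫ ι₀ ≫ H := by
    rw [hS, ← comp_whiskerRight_assoc, ← Category.assoc, h₀, toInvPathObj_ι, toPathObj_pathEv]
  have hr : ι₁ ▷ Δ[1] ≫ S = H := by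
    rw [hS, ← comp_whiskerRight_assoc, ← Category.assoc, h₁, toInvPathObj_ι, toPathObj_pathEv]
  have ht : ι₀ ≫ S = K ≫ (invPathObj C).ι ≫ ι₀ ≫ pathEv C := by
    rw [hS, ι₀_comp_assoc (K ≫ (invPathObj C).ι), Category.assoc]
  have hb : ι₁ ≫ S = K ≫ (invPathObj C).ι ≫ ι₁ ≫ pathEv C := by
    rw [hS, ι₁_comp_assoc (K ≫ (invPathObj C).ι), Category.assoc]
  have e₀₀ : ι₀ ≫ ι₀ ≫ S = ι₀ ≫ H := by
    rw [← ι₀_comp_assoc (ι₀ : X ⟶ X ⊗ Δ[1]), hl, ι₀_fst_assoc]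
  have e₀₁ : ι₁ ≫ ι₀ ≫ S = ι₀ ≫ H := by
    rw [← ι₀_comp_assoc (ι₁ : X ⟶ X ⊗ Δ[1]), hr]
  have e₁₀ : ι₀ ≫ ι₁ ≫ S = ι₀ ≫ H := by
    rw [← ι₁_comp_assoc (ι₀ : X ⟶ X ⊗ Δ[1]), hl, ι₁_fst_assoc]
  have e₁₁ : ι₁ ≫ ι₁ ≫ S = ι₁ ≫ H := by
    rw [← ι₁_comp_assoc (ι₁ : X ⟶ X ⊗ Δ[1]), hr]
  have key := hom_comp_hom_of_square S rfl rfl hl hr e₀₀ e₀₁ e₁₀ e₁₁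
    (by simp) (by simp) rfl rfl
  have t₁ : IsIso (Ho.hom (funEdge (ι₀ ≫ S) e₀₀ e₀₁)) := by
    refine Ho.isIso_hom_of_isInvertible ?_
    change IsInvertible (funSimplex _)
    rw [ht, ← ihom_map_app_funSimplex]
    exact hK.map _
  have t₂ : IsIso (Ho.hom (funEdge (ι₁ ≫ S) e₁₀ e₁₁)) := by
    refine Ho.isIso_hom_of_isInvertible ?_
    change IsInvertible (funSimplex _)
    rw [hb, ← ihom_map_app_funSimplex]
    exact hK.map _
  have t₃ : IsIso (Ho.hom (funEdge (fst X Δ[1] ≫ ι₀ ≫ H) (ι₀_fst_assoc _ _) (ι₁_fst_assoc _ _))) :=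
    Ho.isIso_hom_of_isInvertible (isInvertible_funSimplex_const _)
  have : IsIso (Ho.hom (funEdge H rfl rfl)) := by
    have : IsIso (Ho.hom (funEdge (ι₀ ≫ S) e₀₀ e₀₁) ≫ Ho.hom (funEdge H rfl rfl)) := by
      rw [key]
      infer_instance
    exact IsIso.of_isIso_comp_left (Ho.hom (funEdge (ι₀ ≫ S) e₀₀ e₀₁)) _
  exact Ho.isInvertible_of_isIso_hom (e := funEdge H rfl rfl)

end

end SSet

/-! ### Equivalent maps to a quasi-category and categorical equivalences -/

namespace SSet

open CartesianMonoidalCategory (fst snd lift)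

section

variable {X Y V C D : SSet.{0}}

/-- Two maps are equivalent if they are related by a pointwise invertible homotopy. -/
def Homotopic (f g : X ⟶ C) : Prop :=
  ∃ H : X ⊗ Δ[1] ⟶ C, IsPointwiseInvertible H ∧ ι₀ ≫ H = f ∧ ι₁ ≫ H = g

lemma Homotopic.refl (f : X ⟶ C) : Homotopic f f :=
  ⟨fst _ _ ≫ f, isPointwiseInvertible_const f, ι₀_fst_assoc _ _, ι₁_fst_assoc _ _⟩

lemma Homotopic.comp_right {f g : X ⟶ C} (h : Homotopic f g) (q : C ⟶ D) :
    Homotopic (f ≫ q) (g ≫ q) := by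
  obtain ⟨H, hH, rfl, rfl⟩ := h
  exact ⟨H ≫ q, hH.comp q, by simp, by simp⟩

lemma Homotopic.comp_left {f g : X ⟶ C} (h : Homotopic f g) (q : Y ⟶ X) :
    Homotopic (q ≫ f) (q ≫ g) := by
  obtain ⟨H, hH, rfl, rfl⟩ := h
  exact ⟨q ▷ Δ[1] ≫ H, hH.whiskerRight q, by rw [ι₀_comp_assoc], by rw [ι₁_comp_assoc]⟩

/-- Every morphism in the homotopy category of the functor object comes from a homotopy, and for
homotopies pointwise invertibility is the same as invertibility. Symmetry of `Homotopic` is obtained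
in this way. -/
lemma homotopic_iff [Quasicategory C] {f g : X ⟶ C} :
    Homotopic f g ↔ Nonempty (Ho.mk (funVertex f) ≅ Ho.mk (funVertex g)) := by
  constructor
  · rintro ⟨H, hH, h₀, h₁⟩
    have := Ho.isIso_hom_of_isInvertible (e := funEdge H h₀ h₁) hH.isInvertible_funSimplex
    exact ⟨asIso (Ho.hom (funEdge H h₀ h₁))⟩
  · rintro ⟨φ⟩
    obtain ⟨e, he⟩ := Ho.exists_hom_eq φ.hom
    obtain ⟨H, h₀, h₁, rfl⟩ := exists_funEdge_eq e
    have : IsIso (Ho.hom (funEdge H h₀ h₁)) := by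
      rw [he]
      infer_instance
    exact ⟨H, .of_isInvertible_funSimplex
      (Ho.isInvertible_of_isIso_hom (e := funEdge H h₀ h₁)), h₀, h₁⟩

lemma Homotopic.symm [Quasicategory C] {f g : X ⟶ C} (h : Homotopic f g) : Homotopic g f := by
  rw [homotopic_iff] at h ⊢
  exact ⟨h.some.symm⟩

lemma homotopyEdge_uncurry (H : Y ⊗ Δ[1] ⟶ (ihom V).obj C) (v : V _⦋0⦌) (y : Y _⦋0⦌) :
    homotopyEdge ((α_ V Y Δ[1]).hom ≫ MonoidalClosed.uncurry H) ((v, y) : (V ⊗ Y : SSet.{0}) _⦋0⦌) =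
      (evalAt C v).app _ (homotopyEdge H y) := by
  rw [MonoidalClosed.uncurry_eq]
  change ((ihom.ev V).app C).app (op ⦋1⦌) (V.σ 0 v, homotopyEdge H y) =
    ((ihom.ev V).app C).app (op ⦋1⦌) ((const v).app _ (homotopyEdge H y), homotopyEdge H y)
  rw [const_app_one]

lemma Homotopic.uncurry {f g : Y ⟶ (ihom V).obj C} (h : Homotopic f g) :
    Homotopic (MonoidalClosed.uncurry f) (MonoidalClosed.uncurry g) := by
  obtain ⟨H, hH, rfl, rfl⟩ := h
  refine ⟨(α_ V Y Δ[1]).hom ≫ MonoidalClosed.uncurry H, fun ⟨v, y⟩ ↦ ?_, ?_, ?_⟩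
  · rw [homotopyEdge_uncurry]
    exact (hH y).map _
  · rw [MonoidalClosed.uncurry_natural_left]
    rfl
  · rw [MonoidalClosed.uncurry_natural_left]
    rfl

/-- For fixed `y`, the homotopy is pointwise invertible on `V`, hence an invertible edge of the
functor object. -/
lemma Homotopic.curry [Quasicategory C] {f g : V ⊗ Y ⟶ C} (h : Homotopic f g) :
    Homotopic (MonoidalClosed.curry f) (MonoidalClosed.curry g) := by
  obtain ⟨H, hH, rfl, rfl⟩ := h
  refine ⟨MonoidalClosed.curry ((α_ V Y Δ[1]).inv ≫ H), fun y ↦ ?_, ?_, ?_⟩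
  · obtain ⟨G, hG⟩ := funSimplex.surjective
      (homotopyEdge (MonoidalClosed.curry ((α_ V Y Δ[1]).inv ≫ H)) y)
    rw [← hG]
    refine IsPointwiseInvertible.isInvertible_funSimplex (fun v ↦ ?_)
    rw [← evalAt_app_funSimplex_one, hG, ← homotopyEdge_uncurry, MonoidalClosed.uncurry_curry,
      Iso.hom_inv_id_assoc]
    exact hH _
  · rw [← MonoidalClosed.curry_natural_left]
    rfl
  · rw [← MonoidalClosed.curry_natural_left]
    rfl

/-- The symmetry of maps to simplicial sets of functors. -/
noncomputable def flipHom (f : X ⟶ (ihom V).obj C) : V ⟶ (ihom X).obj C :=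
  MonoidalClosed.curry ((β_ _ _).hom ≫ MonoidalClosed.uncurry f)

lemma flipHom_flipHom (f : X ⟶ (ihom V).obj C) : flipHom (flipHom f) = f := by
  rw [flipHom, flipHom, MonoidalClosed.uncurry_curry, SymmetricCategory.symmetry_assoc,
    MonoidalClosed.curry_uncurry]

lemma flipHom_comp (g : Y ⟶ X) (f : X ⟶ (ihom V).obj C) :
    flipHom (g ≫ f) = flipHom f ≫ (MonoidalClosed.pre g).app C := by
  rw [flipHom, flipHom, MonoidalClosed.curry_pre_app, MonoidalClosed.uncurry_natural_left,
    BraidedCategory.braiding_naturality_left_assoc]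

lemma comp_flipHom (g : Y ⟶ X) (f : V ⟶ (ihom X).obj C) :
    g ≫ flipHom f = flipHom (f ≫ (MonoidalClosed.pre g).app C) := by
  rw [← flipHom_flipHom (g ≫ flipHom f), flipHom_comp, flipHom_flipHom]

lemma Homotopic.flipHom [Quasicategory C] {f g : X ⟶ (ihom V).obj C} (h : Homotopic f g) :
    Homotopic (flipHom f) (flipHom g) :=
  (h.uncurry.comp_left _).curry

/-- The product of two edges. -/
def Edge.prod {x x' : X _⦋0⦌} {y y' : Y _⦋0⦌} (e : Edge x x') (e' : Edge y y') :
    Edge (X := X ⊗ Y) (x, y) (x', y') :=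
  Edge.mk (e.edge, e'.edge) (Prod.ext e.src_eq e'.src_eq) (Prod.ext e.tgt_eq e'.tgt_eq)

/-- The product of two compositions of edges. -/
def Edge.CompStruct.prod {x₀ x₁ x₂ : X _⦋0⦌} {e₀₁ : Edge x₀ x₁} {e₁₂ : Edge x₁ x₂}
    {e₀₂ : Edge x₀ x₂} (h : CompStruct e₀₁ e₁₂ e₀₂) {y₀ y₁ y₂ : Y _⦋0⦌} {f₀₁ : Edge y₀ y₁}
    {f₁₂ : Edge y₁ y₂} {f₀₂ : Edge y₀ y₂} (h' : CompStruct f₀₁ f₁₂ f₀₂) :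
    CompStruct (e₀₁.prod f₀₁) (e₁₂.prod f₁₂) (e₀₂.prod f₀₂) :=
  CompStruct.mk (h.simplex, h'.simplex) (Prod.ext h.d₂ h'.d₂) (Prod.ext h.d₀ h'.d₀)
    (Prod.ext h.d₁ h'.d₁)

/-- The nondegenerate edge of `Δ[1]`. -/
noncomputable def stdEdge : Edge (X := Δ[1]) (stdSimplex.obj₀Equiv.{0}.symm 0)
    (stdSimplex.obj₀Equiv.{0}.symm 1) :=
  Edge.mk (yonedaEquiv (𝟙 Δ[1])) (by decide) (by decide)

lemma Homotopic.nonempty_iso {f g : X ⟶ C} (h : Homotopic f g) :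
    Nonempty (Ho.map f ≅ Ho.map g) := by
  obtain ⟨H, hH, rfl, rfl⟩ := h
  let e (x : X _⦋0⦌) : Edge ((ι₀ ≫ H).app (op ⦋0⦌) x) ((ι₁ ≫ H).app (op ⦋0⦌) x) :=
    ((Edge.id x).prod stdEdge).map H
  have (x : X _⦋0⦌) : IsIso (Ho.hom (e x)) := Ho.isIso_hom_of_isInvertible (hH x)
  let φ (x : X _⦋0⦌) : (Ho.map (ι₀ ≫ H)).obj (Ho.mk x) ≅ (Ho.map (ι₁ ≫ H)).obj (Ho.mk x) :=
    @asIso _ _ _ _ (Ho.hom (e x)) (this x)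
  refine ⟨Truncated.HomotopyCategory.mkNatIso φ ?_⟩
  intro x y a
  let a' : Edge (X := X) x y := .ofTruncated a
  have c₁ := ((Edge.CompStruct.compId a').prod (Edge.CompStruct.idComp stdEdge)).map H
  have c₂ := ((Edge.CompStruct.idComp a').prod (Edge.CompStruct.compId stdEdge)).map H
  exact (Ho.hom_comp_hom c₁).trans (Ho.hom_comp_hom c₂).symm

lemma Ho.map_comp (f : X ⟶ Y) (g : Y ⟶ C) : Ho.map (f ≫ g) = Ho.map f ⋙ Ho.map g := by
  dsimp only [Ho.map]
  rw [Functor.map_comp]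
  rfl

lemma Ho.map_id : Ho.map (𝟙 X) = 𝟭 _ := by
  dsimp only [Ho.map]
  rw [CategoryTheory.Functor.map_id]
  rfl

lemma Ho.isEquivalence_map_of_homotopic {f : X ⟶ Y} {g : Y ⟶ X} (h : Homotopic (f ≫ g) (𝟙 X))
    (h' : Homotopic (g ≫ f) (𝟙 Y)) : (Ho.map f).IsEquivalence := by
  obtain ⟨e⟩ := h.nonempty_iso
  obtain ⟨e'⟩ := h'.nonempty_iso
  rw [Ho.map_comp, Ho.map_id] at e e'
  exact (CategoryTheory.Equivalence.mk (Ho.map f) (Ho.map g) e.symm e').isEquivalence_functor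

end

end SSet

/-! ### Criteria and closure properties for categorical equivalences. -/

section

open SSet

variable {X Y Z : SSet.{0}}

lemma IsCategoricalEquivalence.exists_homotopic {f : X ⟶ Y} (hf : IsCategoricalEquivalence f)
    {C : SSet.{0}} [Quasicategory C] (g : X ⟶ C) : ∃ h : Y ⟶ C, Homotopic (f ≫ h) g := by
  have : (Ho.map ((MonoidalClosed.pre f).app C)).IsEquivalence := hf C
  let T := (Ho.map ((MonoidalClosed.pre f).app C)).objPreimage (Ho.mk (funVertex g))
  obtain ⟨h, hh⟩ := exists_funVertex_eq (T.as.as)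
  refine ⟨h, homotopic_iff.2 ⟨?_⟩⟩
  rw [← pre_app_funVertex, hh]
  exact (Ho.map ((MonoidalClosed.pre f).app C)).objObjPreimageIso (Ho.mk (funVertex g))

/-- A Yoneda argument. Extending the transpose of the identity of `(ihom X).obj C` along `f`, up to
homotopy, and transposing back gives a right inverse of precomposition with `f`. The uniqueness
hypothesis, again for a functor object, shows that it is also a left inverse. -/
lemma isCategoricalEquivalence_of_homotopic {f : X ⟶ Y}
    (h₁ : ∀ (C : SSet.{0}) [Quasicategory C] (g : X ⟶ C), ∃ h : Y ⟶ C, Homotopic (f ≫ h) g)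
    (h₂ : ∀ (C : SSet.{0}) [Quasicategory C] (g h : Y ⟶ C),
      Homotopic (f ≫ g) (f ≫ h) → Homotopic g h) :
    IsCategoricalEquivalence f := by
  intro C _
  obtain ⟨h, hh⟩ := h₁ _ (flipHom (𝟙 ((ihom X).obj C)))
  have h₀ := hh.flipHom
  rw [flipHom_comp, flipHom_flipHom] at h₀
  refine Ho.isEquivalence_map_of_homotopic (g := flipHom h) ?_ h₀
  have := (h₂ _ (flipHom ((MonoidalClosed.pre f).app C ≫ flipHom h)) (flipHom (𝟙 _)) ?_).flipHom
  · rwa [flipHom_flipHom, flipHom_flipHom] at this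
  · rw [comp_flipHom f (_ ≫ _), comp_flipHom f (𝟙 _), Category.id_comp, Category.assoc]
    have := (h₀.comp_left ((MonoidalClosed.pre f).app C)).flipHom
    rwa [Category.comp_id] at this

lemma exists_section_of_rlp {f : X ⟶ Y} (hf : (MorphismProperty.monomorphisms SSet.{0}).rlp f) :
    ∃ s : Y ⟶ X, s ≫ f = 𝟙 Y ∧ Homotopic (f ≫ s) (𝟙 X) := by
  have := hf (initial.to Y) (inferInstanceAs (Mono _))
  have sq : CommSq (initial.to X) (initial.to Y) f (𝟙 Y) := ⟨Subsingleton.elim _ _⟩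
  obtain ⟨H, hH, h₀, h₁⟩ := exists_isInvertible_homotopy hf (f ≫ sq.lift) (𝟙 X) (by simp)
  exact ⟨sq.lift, sq.fac_right, H, .of_isInvertible_funSimplex hH, h₀, h₁⟩

lemma isEquivalence_ho_map_of_rlp {f : X ⟶ Y}
    (hf : (MorphismProperty.monomorphisms SSet.{0}).rlp f) : (Ho.map f).IsEquivalence := by
  obtain ⟨s, hs, h⟩ := exists_section_of_rlp hf
  exact Ho.isEquivalence_map_of_homotopic h (hs ▸ .refl _)

lemma isCategoricalEquivalence_of_rlp {f : X ⟶ Y}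
    (hf : (MorphismProperty.monomorphisms SSet.{0}).rlp f) : IsCategoricalEquivalence f := by
  obtain ⟨s, hs, h⟩ := exists_section_of_rlp hf
  refine isCategoricalEquivalence_of_homotopic (fun C _ g ↦ ⟨s ≫ g, ?_⟩) (fun C _ g k H ↦ ?_)
  · have := h.comp_right g
    rwa [Category.assoc, Category.id_comp] at this
  · have := H.comp_left s
    rwa [← Category.assoc, ← Category.assoc, hs, Category.id_comp, Category.id_comp] at this

/-- Pushout-products of inner anodyne maps with monomorphisms are inner anodyne, so precomposition
with `f` is a trivial fibration between functor objects. -/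
lemma isCategoricalEquivalence_of_innerAnodyneExtensions {f : X ⟶ Y}
    (hf : innerAnodyneExtensions f) : IsCategoricalEquivalence f := by
  intro C _
  refine isEquivalence_ho_map_of_rlp fun A B i hi ↦ ?_
  have : Mono i := hi
  let sq := Functor.PushoutObjObj.ofHasPushout (curriedTensor SSet.{0}) f i
  exact (MonoidalClosed.internalHomAdjunction₂.hasLiftingProperty_iff sq
    (Functor.PullbackObjObj.ofIsTerminal MonoidalClosed.internalHom f (terminal.from C)
      terminalIsTerminal)).1 (innerAnodyneExtensions_pushoutObjObjι' sq hf _ (mem_innerFibrations _))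

lemma isCategoricalEquivalence_of_isIso (f : X ⟶ Y) [IsIso f] : IsCategoricalEquivalence f := by
  refine isCategoricalEquivalence_of_rlp fun _ _ i _ ↦ ?_
  infer_instance

lemma pre_comp_app (f : X ⟶ Y) (g : Y ⟶ Z) (C : SSet.{0}) :
    (MonoidalClosed.pre (f ≫ g)).app C =
      (MonoidalClosed.pre g).app C ≫ (MonoidalClosed.pre f).app C := by
  rw [MonoidalClosed.pre_map]
  rfl

lemma IsCategoricalEquivalence.comp {f : X ⟶ Y} {g : Y ⟶ Z} (hf : IsCategoricalEquivalence f)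
    (hg : IsCategoricalEquivalence g) : IsCategoricalEquivalence (f ≫ g) := by
  intro C _
  have h₁ : (Ho.map ((MonoidalClosed.pre f).app C)).IsEquivalence := hf C
  have h₂ : (Ho.map ((MonoidalClosed.pre g).app C)).IsEquivalence := hg C
  change (Ho.map _).IsEquivalence
  rw [pre_comp_app, Ho.map_comp]
  infer_instance

lemma IsCategoricalEquivalence.of_comp_left {f : X ⟶ Y} {g : Y ⟶ Z}
    (hf : IsCategoricalEquivalence f) (hfg : IsCategoricalEquivalence (f ≫ g)) :
    IsCategoricalEquivalence g := by
  intro C _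
  have h₁ : (Ho.map ((MonoidalClosed.pre f).app C)).IsEquivalence := hf C
  have h₂ : (Ho.map ((MonoidalClosed.pre (f ≫ g)).app C)).IsEquivalence := hfg C
  rw [pre_comp_app, Ho.map_comp] at h₂
  exact @Functor.isEquivalence_of_comp_right _ _ _ _ _ _ (Ho.map ((MonoidalClosed.pre g).app C))
    (Ho.map ((MonoidalClosed.pre f).app C)) h₁ h₂

end

/-! ### Pushouts of categorical equivalences along monomorphisms -/

namespace SSet

/-- The equality of classes is witnessed by a `2`-simplex of `B` whose face `0` is degenerate. Its
inner horn lifts by means of `e` and the degenerate edge at `y`, and face `1` of the lifted simplex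
is the required edge. -/
lemma InnerFibration.exists_edge {E B : SSet.{0}} (q : E ⟶ B) [InnerFibration q] [Quasicategory B]
    {x y : E _⦋0⦌} (e : Edge x y) (e' : Edge (q.app _ x) (q.app _ y))
    (h : Ho.hom (e.map q) = Ho.hom e') :
    ∃ e'' : Edge x y, q.app _ e''.edge = e'.edge ∧ Ho.hom e'' = Ho.hom e := by
  obtain ⟨c⟩ := Ho.nonempty_compStruct_of_hom_eq h
  have w : stdSimplex.δ (0 : Fin 2) ≫ yonedaEquiv.symm e.edge =
      stdSimplex.δ (1 : Fin 2) ≫ yonedaEquiv.symm (Edge.id y).edge := by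
    rw [δ_comp_yonedaEquiv_symm, δ_comp_yonedaEquiv_symm, e.tgt_eq, (Edge.id y).src_eq]
  have hδ (i : Fin 3) (hi : i ≠ 1) (Z : SSet.{0}) (τ : Δ[2] ⟶ Z) :
      horn.ι 1 i hi ≫ Λ[2, 1].ι ≫ τ = yonedaEquiv.symm (Z.δ i (yonedaEquiv τ)) := by
    rw [← Category.assoc, horn.ι_ι, δ_yonedaEquiv, Equiv.symm_apply_apply]
  have hq (z : E _⦋1⦌) : yonedaEquiv.symm z ≫ q = yonedaEquiv.symm (q.app _ z) := by
    apply yonedaEquiv.injective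
    rw [yonedaEquiv_comp, Equiv.apply_symm_apply, Equiv.apply_symm_apply]
  have sq : CommSq (horn₂₁.isPushout.desc _ _ w) Λ[2, 1].ι q (yonedaEquiv.symm c.simplex) := ⟨by
    refine horn₂₁.isPushout.hom_ext ?_ ?_
    · rw [horn₂₁.isPushout.inl_desc_assoc]
      refine Eq.trans ?_ (hδ 2 (by decide) _ _).symm
      rw [hq, Equiv.apply_symm_apply, c.d₂]
      rfl
    · rw [horn₂₁.isPushout.inr_desc_assoc]
      refine Eq.trans ?_ (hδ 0 (by decide) _ _).symm
      rw [hq, Equiv.apply_symm_apply, c.d₀]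
      exact congrArg _ (σ_naturality_apply q 0 y)⟩
  have : HasLiftingProperty Λ[2, 1].ι q := mem_innerFibrations q _
    (horn_ι_mem_innerHornInclusions (by decide) (by decide))
  have h2 : E.δ 2 (yonedaEquiv sq.lift) = e.edge := by
    apply yonedaEquiv.symm.injective
    refine (hδ 2 (by decide) _ _).symm.trans ?_
    rw [sq.fac_left]
    exact horn₂₁.isPushout.inl_desc _ _ w
  have h0 : E.δ 0 (yonedaEquiv sq.lift) = (Edge.id y).edge := by
    apply yonedaEquiv.symm.injective
    refine (hδ 0 (by decide) _ _).symm.trans ?_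
    rw [sq.fac_left]
    exact horn₂₁.isPushout.inr_desc _ _ w
  let e'' : Edge x y := Edge.mk (E.δ 1 (yonedaEquiv sq.lift))
    (by
      refine Eq.trans ?_ ((congrArg (E.δ 1) h2).trans e.src_eq)
      exact (δ_comp_δ_apply (S := E) (i := 1) (j := 1) le_rfl _).symm)
    (by
      refine Eq.trans ?_ ((congrArg (E.δ 0) h0).trans (Edge.id y).tgt_eq)
      exact (δ_comp_δ_apply (S := E) (i := 0) (j := 0) le_rfl _))
  refine ⟨e'', ?_, ?_⟩
  · rw [← c.d₁]
    refine (δ_naturality_apply q 1 _).trans ?_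
    rw [← yonedaEquiv_comp, sq.fac_right, Equiv.apply_symm_apply]
  · rw [← Ho.hom_comp_hom (Edge.CompStruct.mk (e₀₁ := e) (e₁₂ := Edge.id y) (e₀₂ := e'')
      (yonedaEquiv sq.lift) h2 h0 rfl), Ho.hom_id, Category.comp_id]

lemma Ho.hom_eq_of_edge_eq {C : SSet.{0}} {x x' y y' : C _⦋0⦌} {e f : Edge x y}
    {e' f' : Edge x' y'} (h : Ho.hom e = Ho.hom f) (he : e.edge = e'.edge) (hf : f.edge = f'.edge) :
    Ho.hom e' = Ho.hom f' := by
  obtain rfl : x = x' := by rw [← e.src_eq, he, e'.src_eq]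
  obtain rfl : y = y' := by rw [← e.tgt_eq, he, e'.tgt_eq]
  obtain rfl : e = e' := Edge.ext he
  obtain rfl : f = f' := Edge.ext hf
  exact h

end SSet

open SSet

/-- Maps and homotopies out of the pushout are glued from pieces that must agree strictly on `U`.
Agreement up to homotopy is made strict by extending homotopies along `i`, or by lifting along the
inner fibration given by restriction along `i`. -/
lemma IsCategoricalEquivalence.of_isPushout {U V U' V' : SSet.{0}} {i : U ⟶ V} {u : U ⟶ U'}
    {v : V ⟶ V'} {j : U' ⟶ V'} [Mono i] (sq : IsPushout i u v j)
    (hu : IsCategoricalEquivalence u) : IsCategoricalEquivalence v := by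
  refine isCategoricalEquivalence_of_homotopic (fun C _ g ↦ ?_) (fun C _ g h hgh ↦ ?_)
  · obtain ⟨h, hh⟩ := hu.exists_homotopic (i ≫ g)
    obtain ⟨H, hH, h₀, h₁⟩ := hh.symm
    obtain ⟨H', hH', h₂, h₃⟩ := exists_extension_homotopy i H hH g h₀
    have w : i ≫ ι₁ ≫ H' = u ≫ h := by
      rw [← h₁, ← h₂, ι₁_comp_assoc]
    refine ⟨sq.desc (ι₁ ≫ H') h w, ?_⟩
    rw [sq.inl_desc]
    exact Homotopic.symm ⟨H', hH', h₃, rfl⟩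
  · obtain ⟨K, hK, k₀, k₁⟩ := hgh
    have h₀ : ι₀ ≫ i ▷ Δ[1] ≫ K = u ≫ j ≫ g := by
      rw [ι₀_comp_assoc, k₀, ← Category.assoc, sq.w, Category.assoc]
    have h₁ : ι₁ ≫ i ▷ Δ[1] ≫ K = u ≫ j ≫ h := by
      rw [ι₁_comp_assoc, k₁, ← Category.assoc, sq.w, Category.assoc]
    have : (Ho.map ((MonoidalClosed.pre u).app C)).IsEquivalence := hu C
    let a : Edge (((MonoidalClosed.pre u).app C).app _ (funVertex (j ≫ g)))
        (((MonoidalClosed.pre u).app C).app _ (funVertex (j ≫ h))) :=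
      Edge.mk (funSimplex (i ▷ Δ[1] ≫ K)) (by rw [δ_one_funSimplex, h₀, pre_app_funVertex])
        (by rw [δ_zero_funSimplex, h₁, pre_app_funVertex])
    -- Restriction along `u` is full on homotopy categories, so the restriction of `K` to `U` comes
    -- from a homotopy on `U'`, up to homotopy of edges.
    obtain ⟨ε, hε⟩ := (Ho.map ((MonoidalClosed.pre u).app C)).map_surjective
      (X := Ho.mk (funVertex (j ≫ g))) (Y := Ho.mk (funVertex (j ≫ h))) (Ho.hom a)
    obtain ⟨e, rfl⟩ := Ho.exists_hom_eq ε
    obtain ⟨E, hE₀, hE₁, rfl⟩ := exists_funEdge_eq e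
    have hE : IsPointwiseInvertible E := by
      have h₁ : IsIso ((Ho.map ((MonoidalClosed.pre u).app C)).map
          (Ho.hom (funEdge E hE₀ hE₁))) := by
        rw [hε]
        exact Ho.isIso_hom_of_isInvertible (hK.whiskerRight i).isInvertible_funSimplex
      have := isIso_of_reflects_iso (Ho.hom (funEdge E hE₀ hE₁))
        (Ho.map ((MonoidalClosed.pre u).app C))
      exact .of_isInvertible_funSimplex
        (Ho.isInvertible_of_isIso_hom (e := funEdge E hE₀ hE₁))
    let e' : Edge (((MonoidalClosed.pre i).app C).app _ (funVertex (v ≫ g)))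
        (((MonoidalClosed.pre i).app C).app _ (funVertex (v ≫ h))) :=
      Edge.mk (funSimplex (u ▷ Δ[1] ≫ E))
        (by rw [δ_one_funSimplex, ι₀_comp_assoc, hE₀, pre_app_funVertex, sq.w_assoc])
        (by rw [δ_zero_funSimplex, ι₁_comp_assoc, hE₁, pre_app_funVertex, sq.w_assoc])
    -- `K` is replaced by a homotopic edge whose restriction to `U` equals that of `E` strictly, so
    -- that the two can be glued.
    obtain ⟨e'', he'', he'''⟩ := InnerFibration.exists_edge ((MonoidalClosed.pre i).app C)
      (funEdge K k₀ k₁) e' (Ho.hom_eq_of_edge_eq hε.symm (pre_app_funSimplex i K).symm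
        (pre_app_funSimplex u E))
    obtain ⟨K', k'₀, k'₁, rfl⟩ := exists_funEdge_eq e''
    have hK' : IsPointwiseInvertible K' := by
      have : IsIso (Ho.hom (funEdge K' k'₀ k'₁)) := by
        rw [he''']
        exact Ho.isIso_hom_of_isInvertible hK.isInvertible_funSimplex
      exact .of_isInvertible_funSimplex
        (Ho.isInvertible_of_isIso_hom (e := funEdge K' k'₀ k'₁))
    have w : i ▷ Δ[1] ≫ K' = u ▷ Δ[1] ≫ E :=
      funSimplex.injective ((pre_app_funSimplex i K').symm.trans he'')
    have sq' : IsPushout (i ▷ Δ[1]) (u ▷ Δ[1]) (v ▷ Δ[1]) (j ▷ Δ[1]) := sq.map (tensorRight Δ[1])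
    refine ⟨sq'.desc K' E w, fun x ↦ ?_, sq.hom_ext ?_ ?_, sq.hom_ext ?_ ?_⟩
    · obtain ⟨x, rfl⟩ | ⟨x, rfl⟩ := Types.eq_or_eq_of_isPushout
        (sq.map ((evaluation _ _).obj (op ⦋0⦌))) x
      · have := hK' x
        rwa [← sq'.inl_desc K' E w, homotopyEdge_whiskerRight] at this
      · have := hE x
        rwa [← sq'.inr_desc K' E w, homotopyEdge_whiskerRight] at this
    · rw [← ι₀_comp_assoc v, sq'.inl_desc, k'₀]
    · rw [← ι₀_comp_assoc j, sq'.inr_desc, hE₀]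
    · rw [← ι₁_comp_assoc v, sq'.inl_desc, k'₁]
    · rw [← ι₁_comp_assoc j, sq'.inr_desc, hE₁]

/-- The map `τ` factors through the pushout `Q` of `T` along `π`. The first factor is a pushout of
`π` along the monomorphism `p`. The second is a pushout of the induced map from the pushout of `B`
and `A'` to `B'`, along `w`, which is a monomorphism because `k'` is. -/
lemma IsCategoricalEquivalence.of_isPushout_of_isPushout {A B P T A' B' P' T' : SSet.{0}}
    {i : A ⟶ B} {k : A ⟶ P} {b : B ⟶ T} {p : P ⟶ T} (sq : IsPushout i k b p)
    {i' : A' ⟶ B'} {k' : A' ⟶ P'} {b' : B' ⟶ T'} {p' : P' ⟶ T'} (sq' : IsPushout i' k' b' p')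
    [Mono i] [Mono p] [Mono k'] {α : A ⟶ A'} {β : B ⟶ B'} {π : P ⟶ P'} {τ : T ⟶ T'}
    (hi : i ≫ β = α ≫ i') (hk : k ≫ π = α ≫ k') (hb : b ≫ τ = β ≫ b') (hp : p ≫ τ = π ≫ p')
    (hα : IsCategoricalEquivalence α) (hβ : IsCategoricalEquivalence β)
    (hπ : IsCategoricalEquivalence π) : IsCategoricalEquivalence τ := by
  let Q := pushout p π
  have sqQ : IsPushout p π (pushout.inl p π) (pushout.inr p π) := IsPushout.of_hasPushout p π
  have sqB : IsPushout i α (pushout.inl i α) (pushout.inr i α) := IsPushout.of_hasPushout i α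
  have hq := IsCategoricalEquivalence.of_isPushout sqQ hπ
  have hb₁ := IsCategoricalEquivalence.of_isPushout sqB hα
  let β₁ : pushout i α ⟶ B' := sqB.desc β i' hi
  have hβ₁ : IsCategoricalEquivalence β₁ :=
    .of_comp_left hb₁ (by rwa [sqB.inl_desc])
  have sq₁ : IsPushout i (α ≫ k') (b ≫ pushout.inl p π) (pushout.inr p π) := by
    rw [← hk]
    exact sq.paste_vert sqQ
  let w : pushout i α ⟶ Q := sqB.desc (b ≫ pushout.inl p π) (k' ≫ pushout.inr p π)
    (by rw [sq₁.w, Category.assoc])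
  have sq₂ : IsPushout (pushout.inr i α) k' w (pushout.inr p π) := by
    refine IsPushout.of_top (h₁₁ := i) (v₁₁ := α) (v₁₂ := pushout.inl i α) ?_ ?_ sqB
    · rwa [sqB.inl_desc]
    · rw [sqB.inr_desc]
  let t : Q ⟶ T' := sqQ.desc τ p' hp
  have sq₃ : IsPushout β₁ w b' t := by
    refine IsPushout.of_left (h₁₁ := pushout.inr i α) (v₁₁ := k') (h₂₁ := pushout.inr p π)
      ?_ ?_ sq₂
    · rwa [sqB.inr_desc, sqQ.inr_desc]
    · refine sqB.hom_ext ?_ ?_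
      · rw [sqB.inl_desc_assoc, sqB.inl_desc_assoc, Category.assoc, sqQ.inl_desc, hb]
      · rw [sqB.inr_desc_assoc, sqB.inr_desc_assoc, Category.assoc, sqQ.inr_desc, sq'.w]
  have : Mono w := Adhesive.mono_of_isPushout_of_mono_right sq₂
  have ht := IsCategoricalEquivalence.of_isPushout sq₃.flip hβ₁
  rw [← sqQ.inl_desc τ p' hp]
  exact hq.comp ht

/-! ### Projectively cofibrant replacements -/

section

variable (D : Type) [SmallCategory D]

/-- The generating cofibrations for the projective model structure on diagrams of simplicial
sets. -/
noncomputable def projectiveGenerators : MorphismProperty (D ⥤ SSet.{0}) :=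
  .ofHoms (fun p : D × ℕ ↦ (evaluationLeftAdjoint SSet.{0} p.1).map ∂Δ[p.2].ι)

variable {D}

lemma rlp_projectiveGenerators_iff {A B : D ⥤ SSet.{0}} (π : A ⟶ B) :
    (projectiveGenerators D).rlp π ↔
      ∀ d, (MorphismProperty.monomorphisms SSet.{0}).rlp (π.app d) := by
  simp only [SSet.rlp_monomorphisms]
  constructor
  · rintro h d _ _ _ ⟨n⟩
    exact ((evaluationAdjunctionRight SSet.{0} d).hasLiftingProperty_iff _ π).1 (h _ ⟨(d, n)⟩)
  · rintro h _ _ _ ⟨d, n⟩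
    exact ((evaluationAdjunctionRight SSet.{0} d).hasLiftingProperty_iff _ π).2 (h d _ ⟨n⟩)

attribute [local instance] Cardinal.fact_isRegular_aleph0 Cardinal.orderBotAleph0OrdToType

instance : MorphismProperty.IsCardinalForSmallObjectArgument (projectiveGenerators D)
    Cardinal.aleph0.{0} where
  isSmall := MorphismProperty.isSmall_ofHoms ..
  preservesColimit {A B X Y} i hi f hf := by
    have : IsFinitelyPresentable.{0} A := by
      obtain ⟨d, n⟩ := hi
      exact (evaluationAdjunctionRight SSet.{0} d).isCardinalPresentable_leftAdjoint_obj _ _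
    infer_instance

instance : MorphismProperty.HasSmallObjectArgument.{0} (projectiveGenerators D) :=
  ⟨.aleph0, inferInstance, inferInstance, inferInstance⟩

/-- The small object argument factors the map from the initial diagram to `A`. The second factor is
an objectwise trivial fibration, hence an objectwise categorical equivalence. -/
theorem nonempty_cofibrantReplacement (A : D ⥤ SSet.{0}) :
    Nonempty (CofibrantReplacement A) := by
  let F := (MorphismProperty.factorizationData (projectiveGenerators D).rlp.llp
    (projectiveGenerators D).rlp (initial.to A))
  refine ⟨⟨F.Z, F.p, fun X Y π hπ g ↦ ?_, fun d ↦ ?_⟩⟩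
  · have := F.hi π ((rlp_projectiveGenerators_iff π).2 hπ)
    have sq : CommSq (initial.to X) F.i π g := ⟨Subsingleton.elim _ _⟩
    exact ⟨sq.lift, sq.fac_right⟩
  · exact isCategoricalEquivalence_of_rlp ((rlp_projectiveGenerators_iff _).1 F.hp d)

end

/-! ### Projectively cofibrant diagrams indexed by partially ordered sets -/

namespace SSet

/-- The simplicial set which is cofree on a type of `k`-simplices. -/
def cofree (k : ℕ) (T : Type) : SSet.{0} where
  obj j := (⦋k⦌ ⟶ j.unop) → T
  map f := ↾fun g h ↦ g (h ≫ f.unop)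
  map_id j := by
    ext g h
    exact congrArg g (Category.comp_id h)
  map_comp f f' := by
    ext g h
    exact congrArg g (Category.assoc h f'.unop f.unop).symm

/-- The functoriality of `cofree`. -/
def cofreeMap (k : ℕ) {T T' : Type} (t : T → T') : cofree k T ⟶ cofree k T' where
  app _ := ↾fun g h ↦ t (g h)
  naturality _ _ _ := rfl

/-- The map to `cofree k T` given by a function on the `k`-simplices. -/
def toCofree {k : ℕ} {T : Type} {X : SSet.{0}} (φ : X _⦋k⦌ → T) : X ⟶ cofree k T where
  app _ := ↾fun x h ↦ φ (X.map h.op x)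
  naturality _ _ f := by
    ext x
    funext h
    refine congrArg φ ?_
    rw [op_comp, Functor.map_comp]
    rfl

/-- The function on `k`-simplices given by a map to `cofree k T`. -/
def ofCofree {k : ℕ} {T : Type} {X : SSet.{0}} (u : X ⟶ cofree k T) (x : X _⦋k⦌) : T :=
  u.app (op ⦋k⦌) x (𝟙 _)

lemma ofCofree_toCofree {k : ℕ} {T : Type} {X : SSet.{0}} (φ : X _⦋k⦌ → T) (x : X _⦋k⦌) :
    ofCofree (toCofree φ) x = φ x := by
  refine congrArg φ ?_
  rw [op_id, X.map_id]
  rfl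

lemma cofree_hom_ext {k : ℕ} {T : Type} {X : SSet.{0}} {u v : X ⟶ cofree k T}
    (h : ∀ x, ofCofree u x = ofCofree v x) : u = v := by
  have key (w : X ⟶ cofree k T) (j : SimplexCategoryᵒᵖ) (x : X.obj j) (f : ⦋k⦌ ⟶ j.unop) :
      w.app j x f = ofCofree w (X.map f.op x) :=
    ((congrFun (NatTrans.naturality_apply w f.op x) (𝟙 _)).trans
      (congrArg (w.app j x) (Category.id_comp f))).symm
  ext j x
  funext f
  exact (key u j x f).trans ((h _).trans (key v j x f).symm)

/-- Maps to `cofree k T` are functions on `k`-simplices. These extend along injections, with values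
outside the image chosen in the fibers of `t`. -/
lemma rlp_cofreeMap (k : ℕ) {T T' : Type} {t : T → T'} (ht : Function.Surjective t) :
    (MorphismProperty.monomorphisms SSet.{0}).rlp (cofreeMap k t) := by
  classical
  intro A B i hi
  refine ⟨fun {a b} sq ↦ ?_⟩
  have hi' : Function.Injective (i.app (op ⦋k⦌)) := by
    have : Mono i := hi
    exact (mono_iff_injective _).1 inferInstance
  let φ (x : B _⦋k⦌) : T :=
    if h : ∃ y, i.app (op ⦋k⦌) y = x then ofCofree a h.choose else (ht (ofCofree b x)).choose
  have hφ (y : A _⦋k⦌) : φ (i.app (op ⦋k⦌) y) = ofCofree a y := by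
    have h : ∃ y', i.app (op ⦋k⦌) y' = i.app (op ⦋k⦌) y := ⟨y, rfl⟩
    dsimp only [φ]
    rw [dif_pos h, hi' h.choose_spec]
  refine ⟨⟨toCofree φ, ?_, ?_⟩⟩
  · refine cofree_hom_ext fun y ↦ ?_
    exact (ofCofree_toCofree φ (i.app _ y)).trans (hφ y)
  · refine cofree_hom_ext fun x ↦ ?_
    refine (congrArg t (ofCofree_toCofree φ x)).trans ?_
    by_cases h : ∃ y, i.app (op ⦋k⦌) y = x
    · obtain ⟨y, rfl⟩ := h
      rw [hφ]
      exact congrArg (ofCofree · y) sq.w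
    · dsimp only [φ]
      rw [dif_neg h]
      exact (ht (ofCofree b x)).choose_spec

end SSet

open SSet

section

variable {P : Type} [PartialOrder P] {Q : P ⥤ SSet.{0}} (hQ : IsProjectivelyCofibrant Q)

include hQ

/-- Compatible predicates on a lower set extend to the colimit. -/
lemma IsProjectivelyCofibrant.exists_extension {c : Cocone Q} (hc : IsColimit c) (L : LowerSet P)
    {k : ℕ} (φ : ∀ z ∈ L, (Q.obj z) _⦋k⦌ → Prop)
    (hφ : ∀ (z z' : P) (hz' : z' ∈ L) (h : z ≤ z') (x : (Q.obj z) _⦋k⦌),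
      φ z' hz' ((Q.map (homOfLE h)).app _ x) = φ z (L.lower h hz') x) :
    ∃ Φ : c.pt _⦋k⦌ → Prop, ∀ (z : P) (hz : z ∈ L) (x : (Q.obj z) _⦋k⦌),
      Φ ((c.ι.app z).app _ x) = φ z hz x := by
  let Y : P ⥤ SSet.{0} :=
    { obj z := cofree k (z ∈ L → Prop)
      map {z z'} f := cofreeMap k (fun g h ↦ g (L.lower (leOfHom f) h)) }
  let X : P ⥤ SSet.{0} := (Functor.const P).obj (cofree k Prop)
  let π : X ⟶ Y :=
    { app z := cofreeMap k (fun p _ ↦ p) }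
  let g : Q ⟶ Y :=
    { app z := toCofree (fun x hz ↦ φ z hz x)
      naturality z z' f := by
        refine cofree_hom_ext fun x ↦ ?_
        refine (ofCofree_toCofree (fun x hz ↦ φ z' hz x) ((Q.map f).app _ x)).trans ?_
        refine Eq.trans ?_ (congrArg (fun (g : z ∈ L → Prop) h ↦ g (L.lower (leOfHom f) h))
          (ofCofree_toCofree (fun x hz ↦ φ z hz x) x)).symm
        funext hz'
        exact hφ z z' hz' (leOfHom f) x }
  -- Every function `z ∈ L → Prop` comes from a proposition, so `π` is an objectwise trivial
  -- fibration and `g` lifts to the constant diagram, where a map is a cocone.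
  obtain ⟨h, hh⟩ := hQ π (fun z ↦ rlp_cofreeMap k (T' := z ∈ L → Prop) (t := fun p _ ↦ p) (fun g ↦ by
    classical
    by_cases hz : z ∈ L
    · exact ⟨g hz, rfl⟩
    · exact ⟨True, funext fun hz' ↦ (hz hz').elim⟩)) g
  refine ⟨ofCofree (hc.desc ⟨_, h⟩), fun z hz x ↦ ?_⟩
  have h₁ : c.ι.app z ≫ hc.desc ⟨_, h⟩ = h.app z := hc.fac _ z
  have h₂ := congrArg (fun u : Q ⟶ Y ↦ ofCofree (T := z ∈ L → Prop) (u.app z) x hz) hh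
  exact (congrArg (ofCofree · x) h₁).trans
    (h₂.trans (congrFun (ofCofree_toCofree (fun x hz ↦ φ z hz x) x) hz))

/-- The property of becoming `x` in `Q.obj y`, for simplices at indices below `y`, extends to the
colimit and separates `x` from the other simplices of `Q.obj y`. -/
lemma IsProjectivelyCofibrant.mono_ι {c : Cocone Q} (hc : IsColimit c) (y : P) :
    Mono (c.ι.app y) := by
  have (d : SimplexCategoryᵒᵖ) : Mono ((c.ι.app y).app d) := by
    rw [mono_iff_injective]
    intro x x' hx
    obtain ⟨⟨k⟩⟩ := d
    obtain ⟨Φ, hΦ⟩ := hQ.exists_extension hc (LowerSet.Iic y) (k := k)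
      (fun z hz u ↦ (Q.map (homOfLE hz)).app _ u = x) (fun z z' hz' h u ↦ by
        rw [← homOfLE_comp h hz', Q.map_comp]
        rfl)
    have e (u : (Q.obj y) _⦋k⦌) := hΦ y le_rfl u
    simp only [homOfLE_refl, Q.map_id] at e
    have := (e x').symm.trans ((congrArg Φ hx.symm).trans (e x))
    exact (this.symm.mp rfl).symm
  exact NatTrans.mono_of_mono_app _

end

section

variable {P : Type} [SemilatticeInf P] {Q : P ⥤ SSet.{0}} (hQ : IsProjectivelyCofibrant Q)

include hQ

/-- The property used holds identically at indices below `y'`. At the other indices below `y`, it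
says that the image in `Q.obj y` comes from `y ⊓ y'`. It extends to the colimit and holds for `x'`,
hence for `x`, which has the same image. -/
lemma IsProjectivelyCofibrant.range_ι_inf_le {c : Cocone Q} (hc : IsColimit c) (y y' : P) :
    Subcomplex.range (c.ι.app y) ⊓ Subcomplex.range (c.ι.app y') ≤
      Subcomplex.range (c.ι.app (y ⊓ y')) := by
  rintro ⟨⟨k⟩⟩ w ⟨⟨x, rfl⟩, x', hx'⟩
  obtain ⟨Φ, hΦ⟩ := hQ.exists_extension hc (LowerSet.Iic y ⊔ LowerSet.Iic y') (k := k)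
    (fun z _ u ↦ z ≤ y' ∨ ∃ (h : z ≤ y) (v : (Q.obj (y ⊓ y')) _⦋k⦌),
      (Q.map (homOfLE h)).app _ u = (Q.map (homOfLE inf_le_left)).app _ v) (by
      intro z z' hz' h u
      by_cases hy' : z' ≤ y'
      · simp only [hy', h.trans hy', true_or]
      obtain hy | hy := hz'
      · by_cases hzy' : z ≤ y'
        · simp only [hzy', true_or, hy', false_or, eq_iff_iff, iff_true]
          refine ⟨hy, (Q.map (homOfLE (le_inf (h.trans hy) hzy'))).app _ u, ?_⟩
          change ((Q.map (homOfLE h)) ≫ (Q.map (homOfLE hy))).app _ u =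
            ((Q.map (homOfLE (le_inf (h.trans hy) hzy'))) ≫ (Q.map (homOfLE inf_le_left))).app _ u
          rw [← Q.map_comp, ← Q.map_comp]
          rfl
        · replace hy : z' ≤ y := hy
          simp only [hzy', hy', false_or, hy, h.trans hy, exists_true_left]
          rw [← homOfLE_comp h hy, Q.map_comp]
          rfl
      · exact (hy' hy).elim)
  have h₁ := hΦ y (Or.inl le_rfl) x
  have h₂ := hΦ y' (Or.inr le_rfl) x'
  have h₃ := congrArg Φ hx'
  simp only [le_refl, true_or] at h₂
  rw [h₂, h₁] at h₃
  obtain h | ⟨_, v, hv⟩ := h₃.mp trivial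
  · exact ⟨(Q.map (homOfLE (le_inf le_rfl h))).app _ x,
      ConcreteCategory.congr_hom (NatTrans.congr_app (c.w (homOfLE (le_inf le_rfl h))) _) x⟩
  · refine ⟨v, ?_⟩
    have hx : (Q.map (homOfLE (le_refl y))).app (op ⦋k⦌) x = x := by
      rw [Subsingleton.elim (homOfLE (le_refl y)) (𝟙 y), Q.map_id]
      rfl
    refine (ConcreteCategory.congr_hom (NatTrans.congr_app
      (c.w (homOfLE (inf_le_left : y ⊓ y' ≤ y))) _) v).symm.trans ?_
    exact congrArg ((c.ι.app y).app _) (hv.symm.trans hx)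

end

/-! ### Unions of families of simplicial subsets -/

namespace SSet

namespace Subcomplex

variable {Z Z' : SSet.{0}}

/-- The map between simplicial subsets induced by a map. -/
def mapLE (f : Z ⟶ Z') {A : Z.Subcomplex} {B : Z'.Subcomplex} (h : A ≤ B.preimage f) :
    A.toSSet ⟶ B.toSSet :=
  Subcomplex.lift (A.ι ≫ f) (by
    rintro d _ ⟨x, rfl⟩
    exact h _ x.2)

lemma mapLE_ι (f : Z ⟶ Z') {A : Z.Subcomplex} {B : Z'.Subcomplex} (h : A ≤ B.preimage f) :
    mapLE f h ≫ B.ι = A.ι ≫ f := rfl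

variable {P : Type}

/-- The union of the members of a family of simplicial subsets indexed by a finite set. -/
def union (S : P → Z.Subcomplex) (L : Finset P) : Z.Subcomplex := ⨆ y ∈ L, S y

lemma le_union (S : P → Z.Subcomplex) {L : Finset P} {y : P} (hy : y ∈ L) : S y ≤ union S L :=
  le_biSup S hy

lemma union_le {S : P → Z.Subcomplex} {L : Finset P} {A : Z.Subcomplex}
    (h : ∀ y ∈ L, S y ≤ A) : union S L ≤ A := iSup₂_le h

lemma mem_union {S : P → Z.Subcomplex} {L : Finset P} {d : SimplexCategoryᵒᵖ} {x : Z.obj d} :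
    x ∈ (union S L).obj d ↔ ∃ y ∈ L, x ∈ (S y).obj d := by
  simp [union]

/-- A simplex of `S y` that is also in `S z`, with `z` another element of `L`, lies in `S (z ⊓ y)`,
and `z ⊓ y < y` by maximality of `y`. -/
lemma bicartSq_union [SemilatticeInf P] [DecidableEq P] [DecidableLT P] [Fintype P] {S : P → Z.Subcomplex}
    (hS : Monotone S) (hS' : ∀ y y', S y ⊓ S y' ≤ S (y ⊓ y')) {L : Finset P}
    (hL : IsLowerSet (L : Set P)) {y : P} (hy : Maximal (· ∈ L) y) :
    BicartSq (union S {z | z < y}) (union S (L.erase y)) (S y) (union S L) where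
  sup_eq := by
    apply le_antisymm
    · exact sup_le (union_le fun z hz ↦ le_union S (Finset.mem_of_mem_erase hz))
        (le_union S hy.prop)
    · refine union_le fun z hz ↦ ?_
      by_cases h : z = y
      · exact h ▸ le_sup_right
      · exact (le_union S (Finset.mem_erase.2 ⟨h, hz⟩)).trans le_sup_left
  inf_eq := by
    apply le_antisymm
    · rintro d x ⟨hx, hx'⟩
      obtain ⟨z, hz, hx⟩ := mem_union.1 hx
      rw [Finset.mem_erase] at hz
      refine mem_union.2 ⟨z ⊓ y, ?_, hS' z y _ ⟨hx, hx'⟩⟩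
      rw [Finset.mem_filter_univ]
      refine lt_of_le_of_ne inf_le_right fun h ↦ hz.1 ?_
      exact (hy.eq_of_le hz.2 (inf_eq_right.1 h)).symm
    · refine union_le fun z hz ↦ ?_
      rw [Finset.mem_filter_univ] at hz
      exact le_inf (le_union S (Finset.mem_erase.2 ⟨hz.ne, hL hz.le hy.prop⟩)) (hS hz.le)

end Subcomplex

end SSet

open SSet Subcomplex

/-- Removing a maximal index presents both unions as pushouts along monomorphisms over smaller lower
sets, so induction and the gluing lemma apply. -/
lemma isCategoricalEquivalence_union {Z Z' : SSet.{0}} {P : Type} [SemilatticeInf P] [Fintype P]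
    {S : P → Z.Subcomplex} {S' : P → Z'.Subcomplex} (hS : Monotone S)
    (hSi : ∀ y y', S y ⊓ S y' ≤ S (y ⊓ y')) (hS' : Monotone S')
    (hSi' : ∀ y y', S' y ⊓ S' y' ≤ S' (y ⊓ y')) (f : Z ⟶ Z')
    (hf : ∀ y, S y ≤ (S' y).preimage f) (hf' : ∀ y, IsCategoricalEquivalence (mapLE f (hf y)))
    (L : Finset P) (hL : IsLowerSet (L : Set P)) (h : union S L ≤ (union S' L).preimage f) :
    IsCategoricalEquivalence (mapLE f h) := by
  classical
  induction hn : L.card using Nat.strong_induction_on generalizing L with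
  | _ n ih =>
    subst hn
    obtain rfl | hne := L.eq_empty_or_nonempty
    · have hbot (Z : SSet.{0}) (S : P → Z.Subcomplex) (d : SimplexCategoryᵒᵖ) :
          IsEmpty ((union S ∅).toSSet.obj d) := ⟨fun ⟨x, hx⟩ ↦ by simp [mem_union] at hx⟩
      have (d : SimplexCategoryᵒᵖ) : IsIso ((mapLE f h).app d) := by
        rw [isIso_iff_bijective]
        exact ⟨fun x ↦ ((hbot _ _ d).false x).elim, fun x ↦ ((hbot _ _ d).false x).elim⟩
      have : IsIso (mapLE f h) := NatIso.isIso_of_isIso_app _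
      exact isCategoricalEquivalence_of_isIso _
    · obtain ⟨y, hy⟩ := L.exists_maximal hne
      have le (M : Finset P) : union S M ≤ (union S' M).preimage f :=
        union_le fun z hz ↦ (hf z).trans (fun d x hx ↦ le_union S' hz _ hx)
      have lt : ({z | z < y} : Finset P) ⊆ L.erase y := fun z hz ↦ by
        rw [Finset.mem_filter_univ] at hz
        exact Finset.mem_erase.2 ⟨hz.ne, hL hz.le hy.prop⟩
      have card := Finset.card_erase_lt_of_mem hy.prop
      refine IsCategoricalEquivalence.of_isPushout_of_isPushout
        (bicartSq_union hS hSi hL hy).isPushout (bicartSq_union hS' hSi' hL hy).isPushout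
        (α := mapLE f (le _)) (β := mapLE f (le _)) (π := mapLE f (hf y))
        rfl rfl rfl rfl ?_ ?_ (hf' y)
      · refine ih _ ((Finset.card_le_card lt).trans_lt card) _ (fun a b hab ha ↦ ?_) _ rfl
        simp only [Finset.coe_filter_univ, Set.mem_ofPred_eq] at ha ⊢
        exact hab.trans_lt ha
      · refine ih _ card _ (fun a b hab ha ↦ ?_) _ rfl
        rw [Finset.mem_coe, Finset.mem_erase] at ha ⊢
        refine ⟨fun h ↦ ha.1 ?_, hL hab ha.2⟩
        exact (hy.eq_of_le ha.2 (h ▸ hab)).symm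

/-! ### `Ar(Δ^n)` as a homotopy colimit over `Tw(Δ^n)` -/

open SSet Subcomplex

instance (n : ℕ) : SemilatticeInf (TwObj n) where
  inf x y := ⟨min x.a y.a, max x.b y.b, (min_le_left _ _).trans (x.le.trans (le_max_left _ _))⟩
  inf_le_left _ _ := ⟨min_le_left _ _, le_max_left _ _⟩
  inf_le_right _ _ := ⟨min_le_right _ _, le_max_right _ _⟩
  le_inf _ _ _ h h' := ⟨le_min h.1 h'.1, max_le h.2 h'.2⟩

instance (n : ℕ) : Finite (TwObj n) :=
  Finite.of_injective (fun x ↦ (x.a, x.b))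
    (fun _ _ h ↦ TwObj.ext (congrArg Prod.fst h) (congrArg Prod.snd h))

namespace TwObj

variable {n : ℕ}

/-- The image of the square indexed by an object of `Tw(Δ^n)`. -/
abbrev rectangle (y : TwObj n) : (Ar.obj ⦋n⦌).Subcomplex := Subcomplex.range ((twCocone n).ι.app y)

lemma mem_rectangle {y : TwObj n} {d : SimplexCategoryᵒᵖ} {x : (Ar.obj ⦋n⦌).obj d} :
    x ∈ y.rectangle.obj d ↔ ∀ r, (Ar.vertex x r).1.1 ≤ y.a ∧ y.b ≤ (Ar.vertex x r).1.2 := by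
  constructor
  · rintro ⟨z, rfl⟩ r
    exact ⟨Nat.lt_succ_iff.1 ((stdSimplex.objEquiv z.1).toOrderHom r).isLt,
      Nat.le_add_left _ _⟩
  · intro h
    refine ⟨(stdSimplex.objEquiv.symm (SimplexCategory.Hom.mk (a := d.unop) (b := ⦋y.a.val⦌)
      ⟨fun r ↦ ⟨(Ar.vertex x r).1.1, Nat.lt_succ_iff.2 (h r).1⟩,
        fun r s hrs ↦ (Ar.vertex_monotone x hrs).1⟩),
      stdSimplex.objEquiv.symm (SimplexCategory.Hom.mk (a := d.unop) (b := ⦋n - y.b.val⦌)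
      ⟨fun r ↦ ⟨(Ar.vertex x r).1.2 - y.b, Nat.lt_succ_iff.2 (Nat.sub_le_sub_right
        (Nat.lt_succ_iff.1 (Ar.vertex x r).1.2.isLt) _)⟩,
        fun r s hrs ↦ Fin.le_def.2 (Nat.sub_le_sub_right (Ar.vertex_monotone x hrs).2 _)⟩)), ?_⟩
    refine Ar.ext fun r ↦ Subtype.ext (Prod.ext rfl (Fin.ext ?_))
    exact Nat.sub_add_cancel (h r).2

lemma rectangle_mono : Monotone (rectangle (n := n)) := by
  intro y y' h d x hx
  rw [mem_rectangle] at hx ⊢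
  exact fun r ↦ ⟨(hx r).1.trans h.1, h.2.trans (hx r).2⟩

lemma rectangle_inf_le (y y' : TwObj n) :
    y.rectangle ⊓ y'.rectangle ≤ (y ⊓ y').rectangle := by
  rintro d x ⟨hx, hx'⟩
  rw [mem_rectangle] at hx hx' ⊢
  exact fun r ↦ ⟨le_min (hx r).1 (hx' r).1, max_le (hx r).2 (hx' r).2⟩

instance mono_twCocone_ι (y : TwObj n) : Mono ((twCocone n).ι.app y) := by
  have (d : SimplexCategoryᵒᵖ) : Mono (((twCocone n).ι.app y).app d) := by
    rw [mono_iff_injective]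
    rintro z z' h
    have h' (r) := congrArg (fun x ↦ Ar.vertex x r) h
    refine Prod.ext ?_ ?_
    · apply stdSimplex.objEquiv.injective
      ext r
      exact congrArg (fun v : ArObj n ↦ (v.1.1 : ℕ)) (h' r)
    · apply stdSimplex.objEquiv.injective
      ext r
      exact Nat.add_right_cancel (congrArg (fun v : ArObj n ↦ (v.1.2 : ℕ)) (h' r))
  exact NatTrans.mono_of_mono_app _

/-- Along a simplex, the first coordinate is largest at the last vertex and the second is smallest
at the first vertex, so the ends decide membership in a rectangle. -/
lemma isSaturated_union_rectangle (L : Finset (TwObj n)) :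
    Ar.IsSaturated (union (rectangle (n := n)) L) := by
  intro k l φ ψ h₀ h₁ hφ
  obtain ⟨y, hy, hφ⟩ := mem_union.1 hφ
  rw [mem_rectangle] at hφ
  refine mem_union.2 ⟨y, hy, mem_rectangle.2 fun r ↦ ⟨?_, ?_⟩⟩
  · refine le_trans ?_ (hφ (Fin.last k)).1
    rw [h₁]
    exact (Ar.vertex_monotone ψ (Fin.le_last r)).1
  · refine (hφ 0).2.trans ?_
    rw [h₀]
    exact (Ar.vertex_monotone ψ (Fin.zero_le r)).2

/-- A square lies in the rectangle indexed by its corner with largest first and smallest second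
coordinate. This corner is an object of `Ar`, hence also of `Tw`. -/
lemma containsSmallSquares_union_rectangle [Fintype (TwObj n)] :
    Ar.ContainsSmallSquares (union (rectangle (n := n)) Finset.univ) := by
  rintro k l σ - - ⟨a, b, h⟩
  have hv {d : SimplexCategoryᵒᵖ} (z : (Δ[k] ⊗ Δ[l] : SSet.{0}).obj d)
      (r : Fin (d.unop.len + 1)) : Ar.vertex (σ.app d z) r =
        Ar.vertex (σ.app (op ⦋0⦌) (stdSimplex.obj₀Equiv.symm
          ((stdSimplex.objEquiv z.1).toOrderHom r), stdSimplex.obj₀Equiv.symm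
            ((stdSimplex.objEquiv z.2).toOrderHom r))) 0 := by
    have := congrArg (fun x ↦ Ar.vertex x 0)
      (NatTrans.naturality_apply σ (SimplexCategory.const ⦋0⦌ d.unop r).op z)
    refine Eq.trans ?_ (this.symm.trans ?_)
    · rfl
    · congr 2
  have h₁ := h (Fin.last k) 0
  dsimp only at h₁
  let v := Ar.vertex (σ.app (op ⦋0⦌)
    (stdSimplex.obj₀Equiv.symm (Fin.last k), stdSimplex.obj₀Equiv.symm 0)) 0
  rintro d _ ⟨z, rfl⟩
  refine mem_union.2 ⟨⟨v.1.1, v.1.2, v.2⟩, Finset.mem_univ _, mem_rectangle.2 fun r ↦ ?_⟩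
  rw [hv]
  have h₂ := h ((stdSimplex.objEquiv z.1).toOrderHom r) ((stdSimplex.objEquiv z.2).toOrderHom r)
  dsimp only at h₂
  refine ⟨Fin.le_def.2 ?_, Fin.le_def.2 ?_⟩
  · rw [h₂.1, h₁.1]
    exact Nat.add_le_add_left (Nat.lt_succ_iff.1 (Fin.isLt _)) _
  · rw [h₂.2, h₁.2]
    exact Nat.le_add_right _ _

end TwObj

/-- The colimit is the union of the images of the `Q.obj y`, and `f` factors through the union of
the rectangles. The first factor is treated by gluing, and the second is inner anodyne because the
union of the rectangles is saturated and contains the small squares. -/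
theorem isCategoricalEquivalence_of_isColimit {n : ℕ} {Q : TwObj n ⥤ SSet.{0}}
    (hQ : IsProjectivelyCofibrant Q) (q : Q ⟶ twDiagram n)
    (hq : ∀ y, IsCategoricalEquivalence (q.app y)) {c : Cocone Q} (hc : IsColimit c)
    (f : c.pt ⟶ Ar.obj ⦋n⦌) (hf : ∀ y, c.ι.app y ≫ f = q.app y ≫ (twCocone n).ι.app y) :
    IsCategoricalEquivalence f := by
  have := Fintype.ofFinite (TwObj n)
  let S (y : TwObj n) : c.pt.Subcomplex := Subcomplex.range (c.ι.app y)
  have hS : Monotone S := by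
    rintro y y' h d _ ⟨x, rfl⟩
    exact ⟨(Q.map (homOfLE h)).app _ x,
      ConcreteCategory.congr_hom (NatTrans.congr_app (c.w (homOfLE h)) _) x⟩
  have hf₁ (y : TwObj n) : S y ≤ y.rectangle.preimage f := by
    rintro d _ ⟨x, rfl⟩
    exact ⟨(q.app y).app _ x,
      (ConcreteCategory.congr_hom (NatTrans.congr_app (hf y) _) x).symm⟩
  have hf₂ (y : TwObj n) : IsCategoricalEquivalence (mapLE f (hf₁ y)) := by
    have := hQ.mono_ι hc y
    refine .of_comp_left (isCategoricalEquivalence_of_isIso (toRange (c.ι.app y))) ?_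
    have := (hq y).comp (isCategoricalEquivalence_of_isIso (toRange ((twCocone n).ι.app y)))
    have e : toRange (c.ι.app y) ≫ mapLE f (hf₁ y) =
        q.app y ≫ toRange ((twCocone n).ι.app y) :=
      (cancel_mono y.rectangle.ι).1 (hf y)
    rw [e]
    exact this
  have htop : union S Finset.univ = ⊤ := by
    simp only [union, Finset.mem_univ, iSup_pos]
    exact iSup_range_eq_top_of_isColimit hc
  have hle : union S Finset.univ ≤ (union (TwObj.rectangle (n := n)) Finset.univ).preimage f :=
    union_le fun y hy ↦ (hf₁ y).trans (fun d x hx ↦ le_union TwObj.rectangle hy _ hx)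
  have h₁ := isCategoricalEquivalence_union hS (hQ.range_ι_inf_le hc) TwObj.rectangle_mono
    TwObj.rectangle_inf_le f hf₁ hf₂ Finset.univ (by
      rw [Finset.coe_univ]
      exact isLowerSet_univ) hle
  have h₂ : IsCategoricalEquivalence (union (TwObj.rectangle (n := n)) Finset.univ).ι :=
    isCategoricalEquivalence_of_innerAnodyneExtensions
    (innerAnodyneExtensions_of_isSaturated _ (TwObj.isSaturated_union_rectangle Finset.univ)
      TwObj.containsSmallSquares_union_rectangle)
  have : IsIso (union S Finset.univ).ι := by
    rw [htop]
    infer_instance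
  have h₃ := h₁.comp h₂
  rw [mapLE_ι] at h₃
  exact .of_comp_left (isCategoricalEquivalence_of_isIso (union S Finset.univ).ι) h₃

theorem isCategoricalEquivalence_hocolimDesc (n : ℕ) (R : CofibrantReplacement (twDiagram n)) :
    IsCategoricalEquivalence (hocolimDesc R (twCocone n)) :=
  isCategoricalEquivalence_of_isColimit R.cofibrant R.hom R.isEquivalence
    (colimit.isColimit R.obj) _ (fun _ ↦ colimit.ι_desc _ _)

/-! ### The functor `L^op` and the homotopy colimits over the fibers -/

namespace TOp

variable {n : ℕ}

/-- The image in `Tw(Δ^n)` of an object `(m, ab)` under a map `[m] ⟶ [n]`. -/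
def image (t : TOp) (φ : t.n ⟶ ⦋n⦌) : TwObj n :=
  ⟨φ.toOrderHom t.ab.a, φ.toOrderHom t.ab.b, φ.toOrderHom.monotone t.ab.le⟩

/-- The morphism from an object to its image. -/
def toImage (t : TOp) (φ : t.n ⟶ ⦋n⦌) : t ⟶ (TOp.fiber n).obj (t.image φ) :=
  ⟨φ, le_rfl, le_rfl⟩

lemma image_le {t t' : TOp} (s : t ⟶ t') (φ : t'.n ⟶ ⦋n⦌) : t.image (s.φ ≫ φ) ≤ t'.image φ :=
  ⟨φ.toOrderHom.monotone s.le_a, φ.toOrderHom.monotone s.b_le⟩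

section

variable (X : TwObj n ⥤ SSet.{0})

lemma π_comp_map (t : TOp) {φ φ' : t.n ⟶ ⦋n⦌} (e : φ' = φ) (f : t.image φ' ⟶ t.image φ) :
    Pi.π (fun φ : t.n ⟶ ⦋n⦌ ↦ X.obj (t.image φ)) φ' ≫ X.map f = Pi.π _ φ := by
  subst e
  rw [Subsingleton.elim f (𝟙 _), X.map_id, Category.comp_id]

/-- The right Kan extension along the inclusion of a fiber of `𝒯ᵒᵖ ⥤ Δ`. -/
noncomputable def ranFiber : TOp ⥤ SSet.{0} where
  obj t := ∏ᶜ fun φ : t.n ⟶ ⦋n⦌ ↦ X.obj (t.image φ)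
  map s := Pi.lift fun φ ↦ Pi.π _ (s.φ ≫ φ) ≫ X.map (homOfLE (image_le s φ))
  map_id t := Pi.hom_ext _ _ fun φ ↦ by
    rw [Pi.lift_π, Category.id_comp]
    exact π_comp_map X t (Category.id_comp φ) _
  map_comp s s' := Pi.hom_ext _ _ fun φ ↦ by
    rw [Pi.lift_π, Category.assoc, Pi.lift_π, Pi.lift_π_assoc, Category.assoc, ← X.map_comp]
    rfl

variable {X}

/-- The functoriality of `ranFiber`. -/
noncomputable def ranFiberMap {Y : TwObj n ⥤ SSet.{0}} (π : X ⟶ Y) : ranFiber X ⟶ ranFiber Y where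
  app t := Limits.Pi.map fun φ ↦ π.app (t.image φ)
  naturality t t' s := Pi.hom_ext _ _ fun φ ↦ by
    dsimp only [ranFiber]
    rw [Category.assoc, Category.assoc, Pi.map_π, Pi.lift_π_assoc, Pi.lift_π, Pi.map_π_assoc,
      Category.assoc, π.naturality]

/-- The map to `ranFiber X` corresponding to a map from the restriction to the fiber. -/
noncomputable def toRanFiber {Q : TOp ⥤ SSet.{0}} (g : TOp.fiber n ⋙ Q ⟶ X) : Q ⟶ ranFiber X where
  app t := Pi.lift fun φ ↦ Q.map (t.toImage φ) ≫ g.app (t.image φ)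
  naturality t t' s := Pi.hom_ext _ _ fun φ ↦ by
    dsimp only [ranFiber]
    rw [Category.assoc, Category.assoc, Pi.lift_π, Pi.lift_π, Pi.lift_π_assoc, Category.assoc,
      ← g.naturality, ← Category.assoc, ← Category.assoc, ← Q.map_comp]
    refine congrArg (· ≫ _) ?_
    dsimp only [Functor.comp_map]
    rw [← Q.map_comp]
    rfl

/-- The evaluation of `ranFiber X` on the fiber. -/
noncomputable def ranFiberπ (X : TwObj n ⥤ SSet.{0}) (x : TwObj n) :
    (ranFiber X).obj ((TOp.fiber n).obj x) ⟶ X.obj x :=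
  Pi.π (fun φ : ((TOp.fiber n).obj x).n ⟶ ⦋n⦌ ↦ X.obj (((TOp.fiber n).obj x).image φ)) (𝟙 _)

lemma ranFiberπ_naturality {x y : TwObj n} (f : x ⟶ y) :
    (ranFiber X).map ((TOp.fiber n).map f) ≫ ranFiberπ X y = ranFiberπ X x ≫ X.map f :=
  Pi.lift_π _ _

lemma ranFiberMap_π {Y : TwObj n ⥤ SSet.{0}} (π : X ⟶ Y) (x : TwObj n) :
    (ranFiberMap π).app ((TOp.fiber n).obj x) ≫ ranFiberπ Y x = ranFiberπ X x ≫ π.app x :=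
  Limits.Pi.map_π (fun φ : ((TOp.fiber n).obj x).n ⟶ ⦋n⦌ ↦
    π.app (((TOp.fiber n).obj x).image φ)) (𝟙 _)

lemma toRanFiber_π {Q : TOp ⥤ SSet.{0}} (g : TOp.fiber n ⋙ Q ⟶ X) (x : TwObj n) :
    (toRanFiber g).app ((TOp.fiber n).obj x) ≫ ranFiberπ X x = g.app x :=
  (Pi.lift_π _ _).trans ((congrArg (· ≫ g.app x) (Q.map_id ((TOp.fiber n).obj x))).trans
    (Category.id_comp _))

/-- The map from the restriction to the fiber corresponding to a map to `ranFiber X`. -/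
noncomputable def ofRanFiber {Q : TOp ⥤ SSet.{0}} (h : Q ⟶ ranFiber X) : TOp.fiber n ⋙ Q ⟶ X where
  app x := h.app ((TOp.fiber n).obj x) ≫ ranFiberπ X x
  naturality x y f := by
    dsimp only [Functor.comp_map]
    rw [h.naturality_assoc, Category.assoc, ranFiberπ_naturality]

end

end TOp

lemma rlp_piMap {J : Type} {X Y : J → SSet.{0}} (π : ∀ j, X j ⟶ Y j)
    (h : ∀ j, (MorphismProperty.monomorphisms SSet.{0}).rlp (π j)) :
    (MorphismProperty.monomorphisms SSet.{0}).rlp (Limits.Pi.map π) := by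
  intro A B i hi
  refine ⟨fun {a b} sq ↦ ?_⟩
  have (j : J) := h j i hi
  have sq' (j : J) : CommSq (a ≫ Pi.π _ j) i (π j) (b ≫ Pi.π _ j) := ⟨by
    rw [← sq.w_assoc, Pi.map_π, Category.assoc]⟩
  refine ⟨⟨Pi.lift fun j ↦ (sq' j).lift, ?_, ?_⟩⟩
  · refine Pi.hom_ext _ _ fun j ↦ ?_
    rw [Category.assoc, Pi.lift_π, (sq' j).fac_left]
  · refine Pi.hom_ext _ _ fun j ↦ ?_
    rw [Category.assoc, Pi.map_π, Pi.lift_π_assoc, (sq' j).fac_right]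

/-- Restriction to the fiber is left adjoint to `ranFiber`, whose values are products, and products
of trivial fibrations are trivial fibrations. -/
lemma IsProjectivelyCofibrant.fiber {Q : TOp ⥤ SSet.{0}} (hQ : IsProjectivelyCofibrant Q) (n : ℕ) :
    IsProjectivelyCofibrant (TOp.fiber n ⋙ Q) := by
  intro X Y π hπ g
  obtain ⟨h, hh⟩ := hQ (TOp.ranFiberMap π) (fun t ↦ rlp_piMap _ fun φ ↦ hπ _) (TOp.toRanFiber g)
  refine ⟨TOp.ofRanFiber h, ?_⟩
  ext x : 2
  have : (h.app _ ≫ (TOp.ranFiberMap π).app _) ≫ TOp.ranFiberπ Y x = _ ≫ TOp.ranFiberπ Y x :=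
    congrArg (fun u ↦ u.app ((TOp.fiber n).obj x) ≫ TOp.ranFiberπ Y x) hh
  rw [TOp.toRanFiber_π, Category.assoc, TOp.ranFiberMap_π] at this
  rw [← this]
  exact Category.assoc _ _ _

/-- The inclusion of the fiber in the category of objects over `[n]`. -/
def TOp.fiberToOver (n : ℕ) : TwObj n ⥤ CostructuredArrow TOp.proj ⦋n⦌ where
  obj x := CostructuredArrow.mk (Y := (TOp.fiber n).obj x) (𝟙 ⦋n⦌)
  map f := CostructuredArrow.homMk ((TOp.fiber n).map f) rfl

/-- The morphism of an object to its image in `Tw(Δ^n)` is initial among its morphisms over `[n]` to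
the fiber. -/
instance (n : ℕ) : (TOp.fiberToOver n).Final where
  out d := by
    have hd (y : StructuredArrow d (TOp.fiberToOver n)) : y.hom.left.φ = d.hom :=
      (Category.comp_id _).symm.trans (CostructuredArrow.w y.hom)
    let z : StructuredArrow d (TOp.fiberToOver n) :=
      StructuredArrow.mk (Y := d.left.image d.hom)
        (CostructuredArrow.homMk (d.left.toImage d.hom) (Category.comp_id _))
    refine isConnected_of_isInitial _ (x := z) (IsInitial.ofUniqueHom (fun y ↦
      StructuredArrow.homMk (homOfLE ⟨?_, ?_⟩) ?_) (fun y m ↦ ?_))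
    · have := y.hom.left.le_a
      rw [hd y] at this
      exact this
    · have := y.hom.left.b_le
      rw [hd y] at this
      exact this
    · ext : 1
      refine TOp.Hom.ext ?_
      refine Eq.trans ?_ (hd y).symm
      exact Category.comp_id _
    · ext : 1
      exact Subsingleton.elim _ _

lemma lanUnit_comp_derivedLanDesc {D E : Type} [SmallCategory D] [SmallCategory E] (p : D ⥤ E)
    {A : D ⥤ SSet.{0}} (R : CofibrantReplacement A) {B : E ⥤ SSet.{0}} (θ : A ⟶ p ⋙ B) :
    p.lanUnit.app R.obj ≫ Functor.whiskerLeft p (derivedLanDesc p R θ) = R.hom ≫ θ := by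
  rw [← p.lanAdjunction_unit SSet.{0}]
  exact ((p.lanAdjunction SSet.{0}).homEquiv_unit ..).symm.trans (Equiv.apply_symm_apply _ _)

/-- By finality, the pointwise formula for the Kan extension becomes a colimit over the fiber. The
restricted diagram is still cofibrant, so the result on colimits over `Tw(Δ^n)` applies. -/
theorem isCategoricalEquivalence_lopToAr (R : CofibrantReplacement (TOp.F ⋙ bisimplex))
    (n : SimplexCategory) : IsCategoricalEquivalence ((LopToAr R).app n) := by
  obtain ⟨n⟩ := n
  have hcolim := Functor.Final.isColimitWhiskerEquiv (TOp.fiberToOver n) _ |>.symm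
    (TOp.proj.isPointwiseLeftKanExtensionLeftKanExtensionUnit R.obj ⦋n⦌)
  refine isCategoricalEquivalence_of_isColimit (R.cofibrant.fiber n)
    (Functor.whiskerLeft (TOp.fiber n) R.hom) (fun y ↦ R.isEquivalence _) hcolim
    ((LopToAr R).app ⦋n⦌) (fun y ↦ ?_)
  have h : (TOp.proj.lanUnit.app R.obj).app ((TOp.fiber n).obj y) ≫ (LopToAr R).app ⦋n⦌ =
      (R.hom ≫ theta).app ((TOp.fiber n).obj y) :=
    congr_app (lanUnit_comp_derivedLanDesc TOp.proj R theta) ((TOp.fiber n).obj y)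
  refine Eq.trans ?_ h
  refine congrArg (· ≫ (LopToAr R).app ⦋n⦌) ?_
  exact (congrArg (_ ≫ ·) ((TOp.proj.leftKanExtension R.obj).map_id ⦋n⦌)).trans
    (Category.comp_id _)

theorem mainTheorem8 :
    -- a saturated simplicial subset containing the small squares has inner anodyne inclusion
    (∀ (n : ℕ) (X : (Ar.obj ⦋n⦌).Subcomplex), Ar.IsSaturated X → Ar.ContainsSmallSquares X →
      SSet.innerAnodyneExtensions X.ι) ∧
    -- `L^op(Δ^{•,•})` exists and the canonical map `L^op(Δ^{•,•}) ⟶ Ar(Δ^•)` is an equivalence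
    (Nonempty (CofibrantReplacement (TOp.F ⋙ bisimplex)) ∧
      ∀ (R : CofibrantReplacement (TOp.F ⋙ bisimplex)) (n : SimplexCategory),
        IsCategoricalEquivalence ((LopToAr R).app n)) ∧
    -- `Ar(Δ^n)` is the homotopy colimit of the `Δ^a × Δ^{n-b}` over `Tw(Δ^n)`
    (∀ n : ℕ, Nonempty (CofibrantReplacement (twDiagram n)) ∧
      ∀ R : CofibrantReplacement (twDiagram n),
        IsCategoricalEquivalence (hocolimDesc R (twCocone n))) :=
  ⟨fun _ X hs hX ↦ innerAnodyneExtensions_of_isSaturated X hs hX,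
    ⟨nonempty_cofibrantReplacement _, isCategoricalEquivalence_lopToAr⟩,
    fun n ↦ ⟨nonempty_cofibrantReplacement _, isCategoricalEquivalence_hocolimDesc n⟩⟩
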